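/- **Notation.** For a sequence $\boldsymbol{x}=(x_1,x_2,\dots)$ let the Schur polynomials $S_j(\boldsymbol{x})$ be given by $\sum_{j\ge0}S_j(\boldsymbol{x})\epsilon^j=\exp\big(\sum_{i\ge1}x_i\epsilon^i\big)$, with $S_j=0$ for $j<0$. Let $\boldsymbol{s}=(s_1,s_2,\dots)$ be defined by $\sum_{j\ge1}s_j\lambda^j=\ln\big[\tfrac{2}{\lambda}\tanh\tfrac{\lambda}{2}\big]$. For vectors $\boldsymbol{x}^{+},\boldsymbol{x}^{-}$ and $N\ge0$ put $$D_N(\boldsymbol{x}^+,\boldsymbol{x}^-)=\det_{1\le i,j\le N}\big(\phi_{2i-1,2j-1}\big),\qquad \phi_{i,j}=\sum_{\nu=0}^{\min(i,j)}\frac{1}{4^{\nu}}\,S_{i-\nu}(\boldsymbol{x}^{+}+\nu\boldsymbol{s})\,S_{j-\nu}(\boldsymbol{x}^{-}+\nu\boldsymbol{s}).$$ *NLS rogue waves.* For complex $a_3,a_5,\dots,a_{2N-1}$, $$u_N(x,t;a_3,\dots,a_{2N-1})=\frac{\sigma_1}{\sigma_0}e^{\mathrm{i}t},\qquad \sigma_n=D_N(\boldsymbol{x}^+(n),\boldsymbol{x}^-(n)),$$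 where $x_1^{\pm}=x\pm\mathrm{i}t\pm n$, $x_{2j}^{\pm}=0$, $x_{2j+1}^{+}=\frac{x+2^{2j}\mathrm{i}t}{(2j+1)!}+a_{2j+1}$ and $x_{2j+1}^-=(x_{2j+1}^+)^*$ for $j\ge1$. These are the rogue waves of $\mathrm{i}u_t+\frac12u_{xx}+|u|^2u=0$. *GDNLS rogue waves.* For real $\gamma$, real $\alpha>0$ and complex $a_3,\dots,a_{2N-1}$, $$u_N(x,t;a_3,\dots,a_{2N-1})=e^{\mathrm{i}(1-\gamma-\alpha)x-\frac12\mathrm{i}[\alpha^2+2(\gamma-2)\alpha+1-\gamma]t}\,\frac{(f_N^*)^{\gamma-1}g_N}{f_N^{\gamma}},\qquad f_N=\sigma_{0,0},\quad g_N=\sigma_{-1,1},$$ where $\sigma_{n,k}=D_N(\boldsymbol{x}^+(n,k),\boldsymbol{x}^-(n,k))$, $x^\pm_{2j}=0$, $$x_1^{+}=k+(n+\tfrac12)(h_1+\tfrac12)+\sqrt\alpha\,x+[\sqrt\alpha(\alpha-1)+\mathrm{i}\alpha]t,\qquad x_1^{-}=-k-(n+\tfrac12)(h_1^*+\tfrac12)+\sqrt\alpha\,x+[\sqrt\alpha(\alpha-1)-\mathrm{i}\alpha]t,$$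 and, for $j\ge1$, $$x_{2j+1}^{+}=(n+\tfrac12)h_{2j+1}+\tfrac{1}{(2j+1)!}\{\sqrt\alpha\,x+[\sqrt\alpha(\alpha-1)+2^{2j}\mathrm{i}\alpha]t\}+a_{2j+1},$$ $$x_{2j+1}^{-}=-(n+\tfrac12)h_{2j+1}^*+\tfrac{1}{(2j+1)!}\{\sqrt\alpha\,x+[\sqrt\alpha(\alpha-1)-2^{2j}\mathrm{i}\alpha]t\}+a_{2j+1}^*,$$ with $\sum_{j\ge1}h_j\lambda^j=\ln\frac{\mathrm{i}e^{\lambda/2}+\sqrt\alpha\,e^{-\lambda/2}}{\mathrm{i}+\sqrt\alpha}$. The real powers of $f_N$ and $f_N^*$ are taken with the logarithm of $f_N$ that is continuous on the $(x,t)$ plane and whose imaginary part tends to $0$ at infinity, and with its complex conjugate, respectively. These are the rogue waves of $\mathrm{i}u_t+\frac12u_{xx}+\mathrm{i}\gamma|u|^2u_x+\mathrm{i}(\gamma-1)u^2u_x^*+\frac12(\gamma-1)(\gamma-2)|u|^4u=0$. *Adler--Moser polynomials.* $\Theta_N(z;\kappa_1,\dots,\kappa_{N-1})=c_N\det_{1\le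 i,j\le N}\big(\theta_{2i-j}(z)\big)$, where $c_N=\prod_{j=1}^N(2j-1)!!$, $\sum_{j\ge0}\theta_j(z)\epsilon^j=\exp\big(z\epsilon+\sum_{i\ge1}\kappa_i\epsilon^{2i+1}\big)$ and $\theta_j=0$ for $j<0$. **Theorem 4.** Let $\kappa_1,\dots,\kappa_{N-1}$ be complex constants, not all zero, and suppose that $z=0$ is a root of $\Theta_N(z;\kappa_1,\dots,\kappa_{N-1})$ of multiplicity $N_0(N_0+1)/2$ with $N_0\ge1$ (a multiple root if $N_0\ge2$). For $A>0$ let $a_{2j+1}=\kappa_jA^{2j+1}$, $1\le j\le N-1$. Then $N_0<N$, and in every $O(1)$ neighborhood of the origin the rogue wave $u_N$ is approximated, with error $O(A^{-1})$, by the lower $N_0$-th order rogue wave with all internal parameters zero: for the NLS rogue waves, and for the GDNLS rogue waves with any real $\gamma$ and any $\alpha>0$, $$u_N(x,t;a_3,a_5,\dots,a_{2N-1})=u_{N_0}(x,t;0,0,\dots,0)+O(A^{-1})\qquad(A\to\infty),$$ uniformly in $x^2+t^2\le R$, for every $R>0$. That is, for every $R>0$ there are constants $C$ and $A_0>0$ (which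 may depend on $N$, the $\kappa_j$, $R$ and, for GDNLS, on $\gamma$ and $\alpha$) such that the modulus of the difference is at most $C/A$ for all $A\ge A_0$ and all real $x,t$ with $x^2+t^2\le R$. -/

import Mathlib

noncomputable section

namespace RogueWave

open PowerSeries

/-- The Schur polynomial `S_j(x₁, x₂, …)`, i.e. the coefficient of `ε ^ j` in
`exp (∑_{i ≥ 1} x_i ε ^ i)`; it is `0` for `j < 0`. The entry `x 0` of the sequence is not used. -/
def schur {R : Type} [CommRing R] [Algebra ℚ R] (x : ℕ → R) (j : ℤ) : R :=
  if 0 ≤ j then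
    PowerSeries.coeff j.toNat
      ((PowerSeries.exp R).subst (PowerSeries.mk fun i => if i = 0 then 0 else x i) :
        PowerSeries R)
  else 0

/-! ### Adler--Moser polynomials -/

/-- `θ_j(z)`, as a polynomial in `z`: `∑_j θ_j(z) ε ^ j = exp (z ε + ∑_{i ≥ 1} κ_i ε ^ (2 i + 1))`.
The entry `κ 0` is not used. -/
def theta (κ : ℕ → ℂ) (j : ℤ) : Polynomial ℂ :=
  schur (fun i => if i = 1 then Polynomial.X else if Odd i then Polynomial.C (κ (i / 2)) else 0) j

/-- The Adler--Moser polynomial `Θ_N(z; κ_1, …, κ_{N-1})`,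
`Θ_N = c_N det_{1 ≤ i, j ≤ N} (θ_{2 i - j})` with `c_N = ∏_{j=1}^N (2 j - 1)!!`
(rows and columns are numbered from `0` here). -/
def adlerMoser (N : ℕ) (κ : ℕ → ℂ) : Polynomial ℂ :=
  Polynomial.C ((∏ j ∈ Finset.Icc 1 N, Nat.doubleFactorial (2 * j - 1) : ℕ) : ℂ) *
    (Matrix.of fun i j : Fin N => theta κ (2 * ((i : ℤ) + 1) - ((j : ℤ) + 1))).det

/-! ### The determinants of the rogue waves -/

/-- `e ^ (λ / 2)` as a power series in `λ`. -/
def expHalf : PowerSeries ℂ := PowerSeries.rescale (1 / 2 : ℂ) (PowerSeries.exp ℂ)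

/-- `e ^ (-λ / 2)` as a power series in `λ`. -/
def expNegHalf : PowerSeries ℂ := PowerSeries.rescale (-1 / 2 : ℂ) (PowerSeries.exp ℂ)

/-- `tanh (λ / 2)` as a power series in `λ`. -/
def tanhHalf : PowerSeries ℂ := (expHalf - expNegHalf) * (expHalf + expNegHalf)⁻¹

/-- `(2 / λ) tanh (λ / 2)` as a power series in `λ` (division by `λ` shifts the coefficients). -/
def tanhQuot : PowerSeries ℂ :=
  PowerSeries.mk fun n => 2 * PowerSeries.coeff (n + 1) tanhHalf

/-- The coefficients `s_j` in `∑_j s_j λ ^ j = ln ((2 / λ) tanh (λ / 2))`. -/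
def sCoeff (j : ℕ) : ℂ := PowerSeries.coeff j (PowerSeries.logOf tanhQuot)

/-- The determinant `det_{1 ≤ i, j ≤ N} (φ_{2 i - 1, 2 j - 1})`, where
`φ_{i, j} = ∑_{ν = 0}^{min (i, j)} 4 ^ (-ν) S_{i - ν}(x⁺ + ν s) S_{j - ν}(x⁻ + ν s)`
(rows and columns are numbered from `0` here). -/
def rogueDet (N : ℕ) (xp xm : ℕ → ℂ) : ℂ :=
  (Matrix.of fun i j : Fin N =>
    ∑ ν ∈ Finset.range (min (2 * (i : ℕ) + 1) (2 * (j : ℕ) + 1) + 1),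
      1 / (4 : ℂ) ^ ν
        * schur (fun l => xp l + (ν : ℂ) * sCoeff l) (2 * (i : ℤ) + 1 - (ν : ℤ))
        * schur (fun l => xm l + (ν : ℂ) * sCoeff l) (2 * (j : ℤ) + 1 - (ν : ℤ))).det

/-! ### Rogue waves of the nonlinear Schrödinger equation

An internal parameter sequence `a : ℕ → ℂ` stands for `a_{2 j + 1} = a j`, `j ≥ 1`; the waves of
order `N` depend on `a 1, …, a (N - 1)` only. -/

/-- The vector `x⁺(n)` for the NLS equation. -/
def nlsPlus (a : ℕ → ℂ) (n : ℤ) (x t : ℝ) (i : ℕ) : ℂ :=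
  if i = 1 then x + Complex.I * t + n
  else if Odd i then
    (x + 2 ^ (i - 1) * (Complex.I * t)) / (Nat.factorial i : ℂ) + a (i / 2)
  else 0

/-- The vector `x⁻(n)` for the NLS equation. -/
def nlsMinus (a : ℕ → ℂ) (n : ℤ) (x t : ℝ) (i : ℕ) : ℂ :=
  if i = 1 then x - Complex.I * t - n
  else (starRingEnd ℂ) (nlsPlus a n x t i)

/-- `σ_n` for the NLS equation. -/
def nlsSigma (N : ℕ) (a : ℕ → ℂ) (n : ℤ) (x t : ℝ) : ℂ :=
  rogueDet N (nlsPlus a n x t) (nlsMinus a n x t)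

/-- The `N`-th order NLS rogue wave `u_N(x, t; a_3, a_5, …, a_{2 N - 1})`. -/
def nlsRogue (N : ℕ) (a : ℕ → ℂ) (x t : ℝ) : ℂ :=
  nlsSigma N a 1 x t / nlsSigma N a 0 x t * Complex.exp (Complex.I * t)

/-! ### Rogue waves of the generalized derivative nonlinear Schrödinger equations -/

/-- The coefficients `h_j(α)` in
`∑_j h_j λ ^ j = ln ((i e ^ (λ / 2) + √α e ^ (-λ / 2)) / (i + √α))`. -/
def hCoeff (α : ℝ) (j : ℕ) : ℂ :=
  PowerSeries.coeff j (PowerSeries.logOf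
    (PowerSeries.C (Complex.I + (Real.sqrt α : ℂ))⁻¹ *
      (PowerSeries.C Complex.I * expHalf + PowerSeries.C (Real.sqrt α : ℂ) * expNegHalf)))

/-- The vector `x⁺(n, k)` for the GDNLS equations. -/
def gdnlsPlus (α : ℝ) (a : ℕ → ℂ) (n k : ℤ) (x t : ℝ) (i : ℕ) : ℂ :=
  if i = 1 then
    k + (n + 1 / 2) * (hCoeff α 1 + 1 / 2) + Real.sqrt α * x
      + (Real.sqrt α * (α - 1) + Complex.I * α) * t
  else if Odd i then
    (n + 1 / 2) * hCoeff α i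
      + 1 / (Nat.factorial i : ℂ) *
        (Real.sqrt α * x + (Real.sqrt α * (α - 1) + 2 ^ (i - 1) * Complex.I * α) * t)
      + a (i / 2)
  else 0

/-- The vector `x⁻(n, k)` for the GDNLS equations. -/
def gdnlsMinus (α : ℝ) (a : ℕ → ℂ) (n k : ℤ) (x t : ℝ) (i : ℕ) : ℂ :=
  if i = 1 then
    -k - (n + 1 / 2) * ((starRingEnd ℂ) (hCoeff α 1) + 1 / 2) + Real.sqrt α * x
      + (Real.sqrt α * (α - 1) - Complex.I * α) * t
  else if Odd i then
    -(n + 1 / 2) * (starRingEnd ℂ) (hCoeff α i)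
      + 1 / (Nat.factorial i : ℂ) *
        (Real.sqrt α * x + (Real.sqrt α * (α - 1) - 2 ^ (i - 1) * Complex.I * α) * t)
      + (starRingEnd ℂ) (a (i / 2))
  else 0

/-- `σ_{n, k}` for the GDNLS equations. -/
def gdnlsSigma (N : ℕ) (α : ℝ) (a : ℕ → ℂ) (n k : ℤ) (x t : ℝ) : ℂ :=
  rogueDet N (gdnlsPlus α a n k x t) (gdnlsMinus α a n k x t)

/-- `L` is the logarithm of `F : ℝ² → ℂ` that is continuous on the whole plane and whose imaginary
part (the argument of `F`) tends to `0` at infinity. There is at most one such `L`. -/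
def IsLogBranch (F L : ℝ × ℝ → ℂ) : Prop :=
  Continuous L ∧ (∀ p, Complex.exp (L p) = F p) ∧
    Filter.Tendsto (fun p => (L p).im) (Filter.cocompact (ℝ × ℝ)) (nhds 0)

/-- The logarithm of `F` in the sense of `IsLogBranch` (an arbitrary function if none exists). -/
def logBranch (F : ℝ × ℝ → ℂ) : ℝ × ℝ → ℂ := Classical.epsilon (IsLogBranch F)

/-- The function `f_N = σ_{0, 0}`. -/
def gdnlsF (N : ℕ) (α : ℝ) (a : ℕ → ℂ) (p : ℝ × ℝ) : ℂ := gdnlsSigma N α a 0 0 p.1 p.2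

/-- The function `g_N = σ_{-1, 1}`. -/
def gdnlsG (N : ℕ) (α : ℝ) (a : ℕ → ℂ) (p : ℝ × ℝ) : ℂ := gdnlsSigma N α a (-1) 1 p.1 p.2

/-- The `N`-th order GDNLS rogue wave `u_N(x, t; a_3, a_5, …, a_{2 N - 1})`, equal to
`e ^ (i (1 - γ - α) x - (i / 2) (α ^ 2 + 2 (γ - 2) α + 1 - γ) t) (f_N^*) ^ (γ - 1) g_N / f_N ^ γ`.
The real powers are the continuous ones, `f_N ^ γ = exp (γ L)` and
`(f_N^*) ^ (γ - 1) = exp ((γ - 1) L^*)`, where `L` is the continuous logarithm of `f_N` with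
argument tending to `0` at infinity, as the background condition on `u_N` requires. (For integer
`γ` the choice of the logarithm makes no difference.) -/
def gdnlsRogue (N : ℕ) (γ α : ℝ) (a : ℕ → ℂ) (x t : ℝ) : ℂ :=
  Complex.exp (Complex.I * (1 - γ - α) * x
      - 1 / 2 * Complex.I * (α ^ 2 + 2 * (γ - 2) * α + 1 - γ) * t)
    * (Complex.exp ((γ - 1) * (starRingEnd ℂ) (logBranch (gdnlsF N α a) (x, t)))
        * gdnlsG N α a (x, t)
        / Complex.exp (γ * logBranch (gdnlsF N α a) (x, t)))

end RogueWave

end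

noncomputable section

namespace RogueWave

/-! Put u = tanh(λ/2). Since exp(∑ s_j λ^j) = 2u/λ, the entry φ_{i,j} equals ∑_ν [λ^i](f u^ν) ·
[λ^j](g u^ν), where f and g are the exponentials of ∑ x⁺_l λ^l and ∑ x⁻_l λ^l (`rogueDet_eq`). The
determinants of the rogue waves are thus Gram-type determinants in odd coefficients. They do not
change when f or g is multiplied by an even series with constant term 1 (`gramDet_even_mul`).

The internal parameters multiply f by a = exp(∑ κ_j A^(2j+1) λ^(2j+1)) and g by its conjugate, so
the Gram matrix is compressed by the rows of coefficients of a. For A = 1 the same rows produce the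
Adler--Moser determinant. Their span is stable under the shift by 2, so the leading positions of an
echelon basis are closed under subtracting 2. The multiplicity of the root 0 is the sum of these
positions minus N(N-1)/2 (`rootMultiplicity_adlerMoser`). The value N₀(N₀+1)/2 therefore forces the
staircase 0, …, r-1, r+1, r+3, … with r = N - N₀ (`stair_mem`).

Scaling by A weights an entry at distance d from its leading entry by A^(-d). Up to a positive
factor, the determinant of order N is then that of the Gram matrix compressed by a matrix polynomial
in A⁻¹, whose value at A⁻¹ = 0 selects the staircase positions (`exists_degeneration`). On the
staircase, block elimination removes the first r rows and leaves a positive multiple of the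
determinant of order N₀ without parameters (`det_gram_stair`). Since the NLS denominator of order N₀
is positive, this gives the NLS estimate.

For GDNLS the real powers require a logarithm of f_N. Up to even factors and a nonzero constant, f_N
is the Gram determinant of (1 + i b e^λ) G and the conjugate of G, with b = 1/√α. It never vanishes:
because e^λ = (1+u)/(1-u), a kernel vector would give a Hermitian form obeying a discrete Lyapunov
equation that forces the vector to be zero (`gramDet_ne_zero`). Deforming b to 0, where the
determinant is positive, yields a logarithm continuous in A⁻¹, x, t and b together
(`exists_log_family`). The asymptotics at infinity show that it is the required branch, and
continuity at A⁻¹ = 0 turns the estimate for f_N into one for its logarithm. -/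

section

open PowerSeries

set_option linter.unusedSectionVars false

/-! ### Exponentials and logarithms of formal power series over a ℚ-algebra. -/

section ExpSeries

variable {R : Type} [CommRing R] [Algebra ℚ R]

/-- The power series `∑_{i ≥ 1} x_i X ^ i`. -/
def seqSeries (x : ℕ → R) : PowerSeries R := PowerSeries.mk fun i => if i = 0 then 0 else x i

/-- The power series `exp (∑_{i ≥ 1} x_i X ^ i)`. -/
def expSeries (x : ℕ → R) : PowerSeries R := (PowerSeries.exp R).subst (seqSeries x)

theorem schur_eq (x : ℕ → R) (j : ℤ) :
    schur x j = if 0 ≤ j then coeff j.toNat (expSeries x) else 0 := rfl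

theorem hasSubst_seqSeries (x : ℕ → R) : HasSubst (seqSeries x) :=
  HasSubst.of_constantCoeff_zero' (by simp [seqSeries, ← coeff_zero_eq_constantCoeff_apply])

/-- The equation f' = f w determines (n+1) f_{n+1} from f_0, …, f_n, and n+1 is invertible over ℚ.
Identities between exponentials are checked below by this uniqueness, after differentiating. -/
theorem eq_of_derivative_eq_mul {f h w : PowerSeries R} (hf : d⁄dX R f = f * w)
    (hh : d⁄dX R h = h * w) (h0 : constantCoeff f = constantCoeff h) : f = h := by
  ext n
  induction n using Nat.strong_induction_on with
  | _ n ih =>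
    cases n with
    | zero => simpa using h0
    | succ n =>
      have e1 := congrArg (coeff n) hf
      have e2 := congrArg (coeff n) hh
      rw [coeff_derivative, coeff_mul] at e1 e2
      have e3 : ∑ p ∈ Finset.HasAntidiagonal.antidiagonal n, coeff p.1 f * coeff p.2 w
          = ∑ p ∈ Finset.HasAntidiagonal.antidiagonal n, coeff p.1 h * coeff p.2 w := by
        refine Finset.sum_congr rfl fun p hp => ?_
        rw [ih p.1 (by have := Finset.HasAntidiagonal.mem_antidiagonal.mp hp; omega)]
      have e4 : coeff (n + 1) f * ((n : R) + 1) = coeff (n + 1) h * ((n : R) + 1) := by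
        rw [e1, e2, e3]
      have hu : ((n : R) + 1) * algebraMap ℚ R (1 / ((n : ℚ) + 1)) = 1 := by
        have : ((n : R) + 1) = algebraMap ℚ R ((n : ℚ) + 1) := by simp
        rw [this, ← map_mul, mul_one_div_cancel (by positivity), map_one]
      calc coeff (n + 1) f = coeff (n + 1) f * ((n : R) + 1) * algebraMap ℚ R (1 / ((n : ℚ) + 1)) := by
            rw [mul_assoc, hu, mul_one]
        _ = _ := by rw [e4, mul_assoc, hu, mul_one]

theorem constantCoeff_seqSeries (x : ℕ → R) : constantCoeff (seqSeries x) = 0 := by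
  simp [seqSeries, ← coeff_zero_eq_constantCoeff_apply]

theorem constantCoeff_subst_of_zero (f g : PowerSeries R) (hg : constantCoeff g = 0) :
    constantCoeff (f.subst g : PowerSeries R) = constantCoeff f := by
  have h : f = C (constantCoeff f) + (f - C (constantCoeff f)) := by ring
  have hs : HasSubst g := HasSubst.of_constantCoeff_zero' hg
  have hC : ((C (constantCoeff f) : PowerSeries R).subst g : PowerSeries R)
      = C (constantCoeff f) := PowerSeries.subst_C _
  conv_lhs => rw [h]
  rw [subst_add hs, map_add, hC, constantCoeff_C]
  have : constantCoeff ((f - C (constantCoeff f)).subst g : PowerSeries R) = 0 :=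
    constantCoeff_subst_eq_zero hg _ (by simp)
  rw [this, add_zero]

@[simp]
theorem constantCoeff_expSeries (x : ℕ → R) : constantCoeff (expSeries x) = 1 := by
  rw [expSeries, constantCoeff_subst_of_zero _ _ (constantCoeff_seqSeries x), constantCoeff_exp]

theorem derivative_expSeries (x : ℕ → R) :
    d⁄dX R (expSeries x) = expSeries x * d⁄dX R (seqSeries x) := by
  rw [expSeries, derivative_subst (hasSubst_seqSeries x), derivative_exp]

theorem seqSeries_add (x y : ℕ → R) : seqSeries (fun i => x i + y i) = seqSeries x + seqSeries y := by
  ext n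
  simp only [seqSeries, coeff_mk, map_add]
  split_ifs <;> simp

theorem expSeries_add (x y : ℕ → R) :
    expSeries (fun i => x i + y i) = expSeries x * expSeries y := by
  refine eq_of_derivative_eq_mul (w := d⁄dX R (seqSeries (fun i => x i + y i)))
    (derivative_expSeries _) ?_ (by simp)
  rw [Derivation.leibniz, derivative_expSeries, derivative_expSeries, seqSeries_add, map_add]
  simp only [smul_eq_mul]
  ring

theorem eq_expSeries {f : PowerSeries R} {x : ℕ → R} (hc : constantCoeff f = 1)
    (hf : d⁄dX R f = f * d⁄dX R (seqSeries x)) : f = expSeries x :=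
  eq_of_derivative_eq_mul hf (derivative_expSeries x) (by simp [hc])

theorem expSeries_congr {x y : ℕ → R} (h : ∀ i, i ≠ 0 → x i = y i) : expSeries x = expSeries y := by
  have : seqSeries x = seqSeries y := by
    ext n; simp only [seqSeries, coeff_mk]; split_ifs with h0
    · rfl
    · exact h n h0
  rw [expSeries, expSeries, this]

theorem expSeries_zero : expSeries (fun _ => (0 : R)) = 1 := by
  refine (eq_expSeries (by simp) ?_).symm
  have : seqSeries (fun _ => (0 : R)) = 0 := by ext n; simp [seqSeries]
  rw [this]; simp

theorem expSeries_nsmul (x : ℕ → R) (n : ℕ) :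
    expSeries (fun i => (n : R) * x i) = expSeries x ^ n := by
  induction n with
  | zero => simpa using expSeries_zero
  | succ n ih =>
    rw [pow_succ, ← ih, ← expSeries_add]
    congr 1; ext i; push_cast; ring

theorem expSeries_mul_neg (x : ℕ → R) : expSeries x * expSeries (fun i => - x i) = 1 := by
  rw [← expSeries_add]; simpa using expSeries_zero

theorem coeff_expSeries_succ (x : ℕ → R) (n : ℕ) :
    ((n : R) + 1) * coeff (n + 1) (expSeries x) =
      ∑ p ∈ Finset.HasAntidiagonal.antidiagonal n, coeff p.1 (expSeries x) * (x (p.2 + 1) * ((p.2 : R) + 1)) := by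
  have e1 := congrArg (coeff n) (derivative_expSeries x)
  rw [coeff_derivative, coeff_mul] at e1
  rw [mul_comm, e1]
  refine Finset.sum_congr rfl fun p _ => ?_
  rw [coeff_derivative, seqSeries, coeff_mk, if_neg (Nat.succ_ne_zero _)]

theorem derivative_map {S : Type} [CommRing S] (φ : R →+* S) (f : PowerSeries R) :
    d⁄dX S (map φ f) = map φ (d⁄dX R f) := by
  ext n; simp [coeff_derivative]

theorem map_expSeries {S : Type} [CommRing S] [Algebra ℚ S] (φ : R →+* S) (x : ℕ → R) :
    map φ (expSeries x) = expSeries (fun i => φ (x i)) := by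
  refine eq_expSeries ?_ ?_
  · rw [← coeff_zero_eq_constantCoeff_apply, coeff_map]; simp
  · rw [derivative_map, derivative_expSeries, map_mul, ← derivative_map]
    congr 2
    ext n; simp only [seqSeries, coeff_map, coeff_mk]; split_ifs <;> simp

theorem coeff_expSeries_rescale (c : R) (x : ℕ → R) (n : ℕ) :
    coeff n (expSeries (fun i => c ^ i * x i)) = c ^ n * coeff n (expSeries x) := by
  have : rescale c (expSeries x) = expSeries (fun i => c ^ i * x i) := by
    refine eq_expSeries ?_ ?_
    · rw [← coeff_zero_eq_constantCoeff_apply, coeff_rescale]; simp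
    · have h : ∀ f : PowerSeries R, d⁄dX R (rescale c f) = C c * rescale c (d⁄dX R f) := by
        intro f; ext n; simp only [coeff_derivative, coeff_rescale, coeff_C_mul]; ring
      rw [h, derivative_expSeries, map_mul, mul_left_comm, ← h]
      congr 2
      ext n; simp only [seqSeries, coeff_rescale, coeff_mk]; split_ifs <;> simp
  rw [← this, coeff_rescale]

theorem seqSeries_coeff {f : PowerSeries R} (hf : constantCoeff f = 0) :
    seqSeries (fun i => coeff i f) = f := by
  ext n; simp only [seqSeries, coeff_mk]; split_ifs with h
  · subst h; simpa using hf.symm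
  · rfl

/-- The derivative of `log` is ∑ (-1)^n X^n, the inverse of 1 + X; substituting f - 1 turns it into
the inverse of f. -/
theorem derivative_logOf {f : PowerSeries R} (hf : constantCoeff f = 1) :
    f * d⁄dX R (logOf f) = d⁄dX R f := by
  have hs : HasSubst (f - 1) := HasSubst.of_constantCoeff_zero' (by simp [hf])
  have hg : (mk fun n ↦ algebraMap ℚ R ((-1 : ℚ) ^ n)) * (1 + X) = 1 := by
    ext n
    rw [mul_add, mul_one, map_add]
    cases n with
    | zero => simp
    | succ n => rw [coeff_succ_mul_X]; simp [pow_succ, coeff_one]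
  have h1 := congrArg (fun g => g.subst (f - 1)) hg
  beta_reduce at h1
  rw [subst_mul hs, subst_add hs, subst_X hs] at h1
  have hone : ((1 : PowerSeries R).subst (f - 1) : PowerSeries R) = 1 := by
    have := PowerSeries.subst_C (S := R) (a := f - 1) (1 : R)
    simpa using this
  rw [hone] at h1
  rw [logOf_eq, derivative_subst hs, deriv_log]
  have h2 : d⁄dX R (f - 1) = d⁄dX R f := by simp
  rw [h2, ← mul_assoc]
  have h3 : f * ((mk fun n ↦ algebraMap ℚ R ((-1 : ℚ) ^ n)).subst (f - 1) : PowerSeries R) = 1 := by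
    rw [mul_comm]; simpa using h1
  rw [h3, one_mul]

theorem expSeries_coeff_logOf {f : PowerSeries R} (hf : constantCoeff f = 1) :
    expSeries (fun i => coeff i (logOf f)) = f := by
  refine (eq_expSeries hf ?_).symm
  rw [seqSeries_coeff (constantCoeff_logOf hf), derivative_logOf hf]

theorem expSeries_injective {x y : ℕ → R} (h : expSeries x = expSeries y) {i : ℕ} (hi : i ≠ 0) :
    x i = y i := by
  have hx := derivative_expSeries x
  have hu : expSeries y * expSeries (fun i => - y i) = 1 := expSeries_mul_neg y
  have hd : d⁄dX R (seqSeries x) = d⁄dX R (seqSeries y) := by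
    have h1 : expSeries y * d⁄dX R (seqSeries x) = expSeries y * d⁄dX R (seqSeries y) := by
      rw [← derivative_expSeries y, ← h, derivative_expSeries x]
    calc d⁄dX R (seqSeries x)
        = expSeries y * expSeries (fun i => - y i) * d⁄dX R (seqSeries x) := by rw [hu, one_mul]
      _ = expSeries (fun i => - y i) * (expSeries y * d⁄dX R (seqSeries x)) := by ring
      _ = expSeries y * expSeries (fun i => - y i) * d⁄dX R (seqSeries y) := by rw [h1]; ring
      _ = _ := by rw [hu, one_mul]
  obtain ⟨n, rfl⟩ := Nat.exists_eq_succ_of_ne_zero hi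
  have e := congrArg (coeff n) hd
  rw [coeff_derivative, coeff_derivative, seqSeries, seqSeries, coeff_mk, coeff_mk,
    if_neg (Nat.succ_ne_zero _), if_neg (Nat.succ_ne_zero _)] at e
  have hu : ((n : R) + 1) * algebraMap ℚ R (1 / ((n : ℚ) + 1)) = 1 := by
    have : ((n : R) + 1) = algebraMap ℚ R ((n : ℚ) + 1) := by simp
    rw [this, ← map_mul, mul_one_div_cancel (by positivity), map_one]
  calc x (n + 1) = x (n + 1) * ((n : R) + 1) * algebraMap ℚ R (1 / ((n : ℚ) + 1)) := by
        rw [mul_assoc, hu, mul_one]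
    _ = _ := by rw [e, mul_assoc, hu, mul_one]

end ExpSeries

/-- Continuity is for the product topology, so convergence of every single x_i suffices. It follows
from the recursion for the coefficients. -/
theorem continuous_coeff_expSeries (n : ℕ) :
    Continuous fun x : ℕ → ℂ => coeff n (expSeries x) := by
  induction n using Nat.strong_induction_on with
  | _ n ih =>
    cases n with
    | zero => simpa using continuous_const
    | succ n =>
      have h : ∀ x : ℕ → ℂ, coeff (n + 1) (expSeries x) = ((n : ℂ) + 1)⁻¹ *
          ∑ p ∈ Finset.HasAntidiagonal.antidiagonal n, coeff p.1 (expSeries x) * (x (p.2 + 1) * ((p.2 : ℂ) + 1)) := by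
        intro x
        rw [← coeff_expSeries_succ, ← mul_assoc, inv_mul_cancel₀ (Nat.cast_add_one_ne_zero n), one_mul]
      simp only [h]
      refine continuous_const.mul (continuous_finsetSum _ fun p hp => ?_)
      refine (ih p.1 (by have := Finset.HasAntidiagonal.mem_antidiagonal.mp hp; omega)).mul ?_
      fun_prop

/-! ### The series `tanh (λ / 2)` -/

theorem constantCoeff_expHalf : constantCoeff expHalf = 1 := by
  rw [← coeff_zero_eq_constantCoeff_apply, expHalf, coeff_rescale]; simp

theorem constantCoeff_expNegHalf : constantCoeff expNegHalf = 1 := by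
  rw [← coeff_zero_eq_constantCoeff_apply, expNegHalf, coeff_rescale]; simp

theorem constantCoeff_expHalf_add_ne_zero : constantCoeff (expHalf + expNegHalf) ≠ 0 := by
  rw [map_add, constantCoeff_expHalf, constantCoeff_expNegHalf]; norm_num

theorem tanhHalf_mul : tanhHalf * (expHalf + expNegHalf) = expHalf - expNegHalf := by
  rw [tanhHalf, mul_assoc, PowerSeries.inv_mul_cancel _ constantCoeff_expHalf_add_ne_zero, mul_one]

theorem constantCoeff_tanhHalf : constantCoeff tanhHalf = 0 := by
  rw [tanhHalf, map_mul, map_sub, constantCoeff_expHalf, constantCoeff_expNegHalf]; simp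

theorem X_mul_tanhQuot : X * tanhQuot = C 2 * tanhHalf := by
  ext n
  cases n with
  | zero => simp [constantCoeff_tanhHalf]
  | succ n => rw [coeff_succ_X_mul, tanhQuot, coeff_mk, coeff_C_mul]

theorem constantCoeff_tanhQuot : constantCoeff tanhQuot = 1 := by
  have h := congrArg (coeff 1) tanhHalf_mul
  rw [coeff_mul, Finset.Nat.antidiagonal_succ] at h
  simp [constantCoeff_tanhHalf, constantCoeff_expHalf, constantCoeff_expNegHalf] at h
  simp only [expHalf, expNegHalf, coeff_rescale, coeff_exp] at h
  rw [← coeff_zero_eq_constantCoeff_apply, tanhQuot, coeff_mk]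
  norm_num at h ⊢
  linear_combination h

/-- This is the Cayley transform e^λ = (1+u)/(1-u) with u = tanh(λ/2), the source of the telescoping
sums in `gramDet_ne_zero`. -/
theorem one_sub_tanhHalf_mul_exp : (1 - tanhHalf) * PowerSeries.exp ℂ = 1 + tanhHalf := by
  have hne : expHalf + expNegHalf ≠ 0 := fun h =>
    constantCoeff_expHalf_add_ne_zero (by rw [h, map_zero])
  have hp : PowerSeries.exp ℂ * expNegHalf = expHalf := by
    have := exp_mul_exp_eq_exp_add (1 : ℂ) (-1 / 2)
    rw [rescale_one] at this
    simp only [RingHom.id_apply] at this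
    rw [expNegHalf, this, expHalf]; norm_num
  have h := tanhHalf_mul
  refine mul_right_cancel₀ hne ?_
  linear_combination (-PowerSeries.exp ℂ - 1) * h + 2 * hp

theorem map_conj_tanhHalf : map (starRingEnd ℂ) tanhHalf = tanhHalf := by
  have hne : expHalf + expNegHalf ≠ 0 := fun h =>
    constantCoeff_expHalf_add_ne_zero (by rw [h, map_zero])
  have h1 : map (starRingEnd ℂ) expHalf = expHalf := by
    ext n; simp [expHalf, coeff_rescale, map_ofNat]
  have h2 : map (starRingEnd ℂ) expNegHalf = expNegHalf := by
    ext n; simp [expNegHalf, coeff_rescale, map_ofNat]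
  have h := congrArg (map (starRingEnd ℂ)) tanhHalf_mul
  rw [map_mul, map_add, map_sub, h1, h2, ← tanhHalf_mul] at h
  exact mul_right_cancel₀ hne h

theorem rescale_neg_one_tanhHalf : rescale (-1 : ℂ) tanhHalf = - tanhHalf := by
  have hne : expHalf + expNegHalf ≠ 0 := fun h =>
    constantCoeff_expHalf_add_ne_zero (by rw [h, map_zero])
  have h1 : rescale (-1 : ℂ) expHalf = expNegHalf := by
    rw [expHalf, rescale_rescale, expNegHalf]; norm_num
  have h2 : rescale (-1 : ℂ) expNegHalf = expHalf := by
    rw [expNegHalf, rescale_rescale, expHalf]; norm_num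
  have h := congrArg (rescale (-1 : ℂ)) tanhHalf_mul
  rw [map_mul, map_add, map_sub, h1, h2] at h
  refine mul_right_cancel₀ hne ?_
  linear_combination h + tanhHalf_mul

theorem coeff_tanhQuot_of_odd {n : ℕ} (hn : Odd n) : coeff n tanhQuot = 0 := by
  have h := congrArg (coeff (n + 1)) rescale_neg_one_tanhHalf
  rw [coeff_rescale, (hn.add_one).neg_one_pow, one_mul, map_neg] at h
  rw [tanhQuot, coeff_mk]
  have : coeff (n + 1) tanhHalf = 0 := by linear_combination h / 2
  rw [this, mul_zero]

theorem expSeries_add_sCoeff (x : ℕ → ℂ) (ν : ℕ) :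
    expSeries (fun l => x l + (ν : ℂ) * sCoeff l) = expSeries x * tanhQuot ^ ν := by
  rw [expSeries_add, expSeries_nsmul]
  congr 2
  exact expSeries_coeff_logOf constantCoeff_tanhQuot

/-- Since 2u = X · `tanhQuot`, the shift of indices by ν and the factor exp(ν ∑ s_j λ^j) are both
absorbed into u^ν. -/
theorem coeff_mul_tanhHalf_pow (f : PowerSeries ℂ) (m ν : ℕ) :
    (2 : ℂ) ^ ν * coeff m (f * tanhHalf ^ ν) =
      if ν ≤ m then coeff (m - ν) (f * tanhQuot ^ ν) else 0 := by
  have h : C ((2 : ℂ) ^ ν) * (f * tanhHalf ^ ν) = X ^ ν * (f * tanhQuot ^ ν) := by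
    rw [map_pow, mul_left_comm, ← mul_pow, ← X_mul_tanhQuot, mul_pow]; ring
  rw [← coeff_C_mul, h, coeff_X_pow_mul']

theorem coeff_mul_tanhHalf_pow_of_lt (f : PowerSeries ℂ) {m ν : ℕ} (h : m < ν) :
    coeff m (f * tanhHalf ^ ν) = 0 := by
  have := coeff_mul_tanhHalf_pow f m ν
  rw [if_neg (by omega)] at this
  exact (mul_eq_zero.mp this).resolve_left (pow_ne_zero _ two_ne_zero)

theorem coeff_mul_tanhHalf_pow_self (f : PowerSeries ℂ) (ν : ℕ) :
    coeff ν (f * tanhHalf ^ ν) = ((2 : ℂ) ^ ν)⁻¹ * constantCoeff f := by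
  have := coeff_mul_tanhHalf_pow f ν ν
  rw [if_pos le_rfl, Nat.sub_self, coeff_zero_eq_constantCoeff_apply, map_mul (constantCoeff (R := ℂ)),
    map_pow (constantCoeff (R := ℂ)), constantCoeff_tanhQuot, one_pow, mul_one] at this
  rw [← this, ← mul_assoc, inv_mul_cancel₀ (pow_ne_zero _ two_ne_zero), one_mul]

theorem schur_add_sCoeff (x : ℕ → ℂ) (m ν : ℕ) :
    schur (fun l => x l + (ν : ℂ) * sCoeff l) ((m : ℤ) - ν) =
      (2 : ℂ) ^ ν * coeff m (expSeries x * tanhHalf ^ ν) := by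
  rw [coeff_mul_tanhHalf_pow, schur_eq, expSeries_add_sCoeff]
  by_cases h : ν ≤ m
  · rw [if_pos (by omega), if_pos h]
    congr 2; omega
  · rw [if_neg (by omega), if_neg h]

/-- The sum `∑_{ν < n} [X ^ i] (f u ^ ν) [X ^ j] (g u ^ ν)` with `u = tanh (λ / 2)`. -/
def gram (n : ℕ) (f g : PowerSeries ℂ) (i j : ℕ) : ℂ :=
  ∑ ν ∈ Finset.range n, coeff i (f * tanhHalf ^ ν) * coeff j (g * tanhHalf ^ ν)

/-- The series u^ν has order ν, so the terms with ν > i vanish and the length of the sum is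
immaterial beyond that. -/
theorem gram_eq_of_lt {n n' i : ℕ} (f g : PowerSeries ℂ) (j : ℕ) (h : i < n) (hn : n ≤ n') :
    gram n' f g i j = gram n f g i j := by
  unfold gram
  refine (Finset.sum_subset (Finset.range_mono hn) fun ν _ hν => ?_).symm
  rw [coeff_mul_tanhHalf_pow_of_lt f (by simp at hν; omega), zero_mul]

/-- The determinant of the odd-indexed entries of `gram`. -/
def gramDet (N : ℕ) (f g : PowerSeries ℂ) : ℂ :=
  (Matrix.of fun i j : Fin N => gram (2 * N) f g (2 * i + 1) (2 * j + 1)).det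

/-- The two factors 2^ν coming from the Schur polynomials cancel 4^(-ν), and the terms with ν beyond
the smaller index vanish, so one common range of summation serves all entries. -/
theorem rogueDet_eq (N : ℕ) (xp xm : ℕ → ℂ) :
    rogueDet N xp xm = gramDet N (expSeries xp) (expSeries xm) := by
  unfold rogueDet gramDet
  congr 1
  ext i j
  simp only [Matrix.of_apply, gram]
  refine Finset.sum_subset_zero_on_sdiff (fun ν hν => ?_) (fun ν hν => ?_) (fun ν hν => ?_)
  · have := i.2; simp at hν ⊢; omega
  · simp at hν
    by_cases h : 2 * (i : ℕ) + 1 < ν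
    · rw [coeff_mul_tanhHalf_pow_of_lt _ h, zero_mul]
    · rw [coeff_mul_tanhHalf_pow_of_lt (expSeries xm) (by omega), mul_zero]
  · have h1 := schur_add_sCoeff xp (2 * i + 1) ν
    have h2 := schur_add_sCoeff xm (2 * j + 1) ν
    push_cast at h1 h2
    rw [h1, h2]
    have : (4 : ℂ) ^ ν = 2 ^ ν * 2 ^ ν := by rw [← mul_pow]; norm_num
    rw [this]
    field_simp

end

section

open PowerSeries

/-! ### Invariance of the Gram determinants under multiplication by even series -/

theorem sum_range_two_mul {M : Type*} [AddCommMonoid M] (f : ℕ → M) (n : ℕ) :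
    ∑ m ∈ Finset.range (2 * n), f m = ∑ l ∈ Finset.range n, (f (2 * l) + f (2 * l + 1)) := by
  induction n with
  | zero => simp
  | succ n ih =>
    rw [mul_add, mul_one, Finset.sum_range_succ, Finset.sum_range_succ, Finset.sum_range_succ, ih,
      add_assoc]

theorem coeff_mul_eq_sum_range {R : Type*} [CommRing R] (a h : PowerSeries R) {k n : ℕ}
    (hk : k < n) : coeff k (a * h) =
      ∑ m ∈ Finset.range n, (if m ≤ k then coeff (k - m) a else 0) * coeff m h := by
  rw [mul_comm, coeff_mul, Finset.Nat.sum_antidiagonal_eq_sum_range_succ_mk]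
  have : ∀ m ∈ Finset.range (k + 1), coeff m h * coeff (k - m) a
      = (if m ≤ k then coeff (k - m) a else 0) * coeff m h := by
    intro m hm
    rw [if_pos (by simp at hm; omega), mul_comm]
  rw [Finset.sum_congr rfl this]
  refine Finset.sum_subset (Finset.range_mono hk) fun m _ hm => ?_
  rw [if_neg (by simp at hm; omega), zero_mul]

/-- All odd coefficients vanish. -/
def IsEven (e : PowerSeries ℂ) : Prop := ∀ n, Odd n → coeff n e = 0

theorem IsEven.mul {e e' : PowerSeries ℂ} (h : IsEven e) (h' : IsEven e') : IsEven (e * e') := by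
  intro n hn
  rw [coeff_mul]
  refine Finset.sum_eq_zero fun p hp => ?_
  have hp' : p.1 + p.2 = n := by simpa using hp
  rcases Nat.even_or_odd p.1 with h1 | h1
  · rw [h' p.2, mul_zero]
    rw [← hp'] at hn
    exact (Nat.odd_add'.mp hn).mpr h1
  · rw [h p.1 h1, zero_mul]

theorem IsEven.pow {e : PowerSeries ℂ} (h : IsEven e) (n : ℕ) : IsEven (e ^ n) := by
  induction n with
  | zero =>
    intro m hm
    rw [pow_zero, coeff_one, if_neg (by rintro rfl; simp at hm)]
  | succ n ih => rw [pow_succ]; exact ih.mul h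

theorem coeff_odd_even_mul {e : PowerSeries ℂ} (he : IsEven e) (h : PowerSeries ℂ) {i n : ℕ}
    (hi : i < n) : coeff (2 * i + 1) (e * h) = ∑ l ∈ Finset.range n,
      (if l ≤ i then coeff (2 * (i - l)) e else 0) * coeff (2 * l + 1) h := by
  rw [coeff_mul_eq_sum_range e h (show 2 * i + 1 < 2 * n by omega), sum_range_two_mul]
  refine Finset.sum_congr rfl fun l _ => ?_
  have h0 : (if 2 * l ≤ 2 * i + 1 then coeff (2 * i + 1 - 2 * l) e else 0) = 0 := by
    split_ifs with hl
    · exact he _ ⟨i - l, by omega⟩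
    · rfl
  rw [h0, zero_mul, zero_add]
  by_cases hl : l ≤ i
  · rw [if_pos (by omega), if_pos hl]
    congr 3; omega
  · rw [if_neg (by omega), if_neg hl]

/-- The matrix by which multiplication by an even series acts on the odd coefficients. -/
def evenMat (N : ℕ) (e : PowerSeries ℂ) : Matrix (Fin N) (Fin N) ℂ :=
  Matrix.of fun i l => if (l : ℕ) ≤ i then coeff (2 * ((i : ℕ) - l)) e else 0

theorem det_evenMat (N : ℕ) {e : PowerSeries ℂ} (he : constantCoeff e = 1) :
    (evenMat N e).det = 1 := by
  rw [Matrix.det_of_isLowerTriangular]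
  · simp [evenMat, he]
  · intro i j hij
    have : (i : ℕ) < j := by simpa using hij
    simp only [evenMat, Matrix.of_apply]
    exact if_neg (by omega)

theorem gram_even_mul {N : ℕ} {e : PowerSeries ℂ} (he : IsEven e) (n : ℕ) (f g : PowerSeries ℂ)
    (i : Fin N) (j : ℕ) : gram n (e * f) g (2 * i + 1) j =
      ∑ l : Fin N, evenMat N e i l * gram n f g (2 * l + 1) j := by
  simp only [gram, Finset.mul_sum]
  rw [Finset.sum_comm]
  refine Finset.sum_congr rfl fun ν _ => ?_
  rw [mul_assoc, coeff_odd_even_mul he _ i.2, ← Fin.sum_univ_eq_sum_range (fun l =>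
    (if l ≤ (i : ℕ) then coeff (2 * ((i : ℕ) - l)) e else 0)
      * coeff (2 * l + 1) (f * tanhHalf ^ ν)) N, Finset.sum_mul]
  refine Finset.sum_congr rfl fun l _ => ?_
  simp only [evenMat, Matrix.of_apply]
  ring

/-- The odd coefficients of e h depend only on those of h, through a lower triangular matrix with
unit diagonal. Hence the even-indexed part of an exponent does not affect the determinant. -/
theorem gramDet_even_mul (N : ℕ) {e : PowerSeries ℂ} (he : IsEven e) (he1 : constantCoeff e = 1)
    (f g : PowerSeries ℂ) : gramDet N (e * f) g = gramDet N f g := by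
  symm
  rw [gramDet, gramDet, ← one_mul (Matrix.det _), ← det_evenMat N he1, ← Matrix.det_mul]
  congr 1
  ext i j
  simp only [Matrix.of_apply, Matrix.mul_apply]
  exact (gram_even_mul he _ f g i _).symm

theorem gramDet_comm (N : ℕ) (f g : PowerSeries ℂ) : gramDet N f g = gramDet N g f := by
  rw [gramDet, gramDet, ← Matrix.det_transpose]
  congr 1
  ext i j
  simp only [Matrix.transpose_apply, Matrix.of_apply, gram]
  exact Finset.sum_congr rfl fun ν _ => mul_comm _ _

theorem gramDet_mul_even (N : ℕ) {e : PowerSeries ℂ} (he : IsEven e) (he1 : constantCoeff e = 1)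
    (f g : PowerSeries ℂ) : gramDet N f (e * g) = gramDet N f g := by
  rw [gramDet_comm, gramDet_even_mul N he he1, gramDet_comm]

theorem gramDet_C_mul (N : ℕ) (c : ℂ) (f g : PowerSeries ℂ) :
    gramDet N (C c * f) g = c ^ N * gramDet N f g := by
  have : (Matrix.of fun i j : Fin N => gram (2 * N) (C c * f) g (2 * i + 1) (2 * j + 1))
      = c • (Matrix.of fun i j : Fin N => gram (2 * N) f g (2 * i + 1) (2 * j + 1)) := by
    ext i j
    simp only [Matrix.of_apply, gram, Matrix.smul_apply, smul_eq_mul, Finset.mul_sum, mul_assoc,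
      coeff_C_mul]
  rw [gramDet, this, Matrix.det_smul, Fintype.card_fin, gramDet]

/-! ### Positivity -/

theorem conj_coeff (f : PowerSeries ℂ) (n : ℕ) :
    (starRingEnd ℂ) (coeff n f) = coeff n (map (starRingEnd ℂ) f) := by
  rw [coeff_map]

-- As u has real coefficients, the matrix is B Bᴴ. The columns of B of index ν = 2j+1 form a
-- triangular minor with diagonal entries 2^(-ν) f(0), so B has full row rank and B Bᴴ is positive
-- definite.
open scoped ComplexOrder in
theorem gramDet_conj_pos (N : ℕ) {f : PowerSeries ℂ} (hf : constantCoeff f ≠ 0) :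
    0 < gramDet N f (map (starRingEnd ℂ) f) := by
  classical
  let B : Matrix (Fin N) (Fin (2 * N)) ℂ :=
    Matrix.of fun i ν => coeff (2 * (i : ℕ) + 1) (f * tanhHalf ^ (ν : ℕ))
  have hB : (Matrix.of fun i j : Fin N =>
      gram (2 * N) f (map (starRingEnd ℂ) f) (2 * i + 1) (2 * j + 1)) = B * B.conjTranspose := by
    ext i j
    simp only [Matrix.of_apply, gram, Matrix.mul_apply, Matrix.conjTranspose_apply, B]
    rw [← Fin.sum_univ_eq_sum_range (fun ν => coeff (2 * (i : ℕ) + 1) (f * tanhHalf ^ ν) *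
      coeff (2 * (j : ℕ) + 1) (map (starRingEnd ℂ) f * tanhHalf ^ ν))]
    refine Finset.sum_congr rfl fun ν _ => ?_
    rw [← starRingEnd_apply, conj_coeff, map_mul (map (starRingEnd ℂ)),
      map_pow (map (starRingEnd ℂ)), map_conj_tanhHalf]
  have hinj : Function.Injective B.vecMul := by
    let σ : Fin N → Fin (2 * N) := fun j => ⟨2 * j + 1, by have := j.2; omega⟩
    have hdet : (B.submatrix id σ).det ≠ 0 := by
      rw [Matrix.det_of_isLowerTriangular]
      · refine Finset.prod_ne_zero_iff.mpr fun i _ => ?_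
        simp only [Matrix.submatrix_apply, id, B, Matrix.of_apply, σ, coeff_mul_tanhHalf_pow_self]
        exact mul_ne_zero (inv_ne_zero (pow_ne_zero _ two_ne_zero)) hf
      · intro i j hij
        have : (i : ℕ) < j := by simpa using hij
        simp only [Matrix.submatrix_apply, id, B, Matrix.of_apply, σ]
        exact coeff_mul_tanhHalf_pow_of_lt f (by omega)
    intro x y hxy
    have hu : IsUnit (B.submatrix id σ) :=
      (Matrix.isUnit_iff_isUnit_det _).mpr (isUnit_iff_ne_zero.mpr hdet)
    refine (Matrix.vecMul_injective_iff_isUnit.mpr hu) ?_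
    ext j
    exact congrFun hxy (σ j)
  rw [gramDet, hB]
  exact (Matrix.PosDef.mul_conjTranspose_self B hinj).det_pos

/-! ### Nonvanishing -/

/-- The form g is Hermitian, so g(i,i) is real and 2 Re g(i+1,i) = |v_i|². Where v vanishes, g only
changes sign along antidiagonals. This moves the entries in `hm` next to the diagonal, where real
and imaginary parts can be compared; the interval of zeros of v grows around 0 by one point on each
side. -/
theorem eq_zero_of_lyapunov {g : ℤ → ℤ → ℂ} {v : ℤ → ℂ} {a : ℝ} (ha : a ≠ 0)
    (hg : ∀ i j, (starRingEnd ℂ) (g i j) = g j i)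
    (hv : ∀ i j, g (i + 1) j + g i (j + 1) = (starRingEnd ℂ) (v i) * v j)
    (hm : ∀ k : ℕ, g (k + 1) 0 + g (1 - k) 0 = Complex.I * a * (g k 0 + g (-k) 0)) (i : ℤ) :
    v i = 0 := by
  have hre : ∀ i, (g i i).im = 0 := fun i => Complex.conj_eq_iff_im.mp (hg i i)
  have hhalf : ∀ i, (g (i + 1) i).re = Complex.normSq (v i) / 2 := by
    intro i
    have h := hv i i
    rw [← hg (i + 1) i, ← Complex.normSq_eq_conj_mul_self, Complex.add_conj] at h
    have := Complex.ofReal_injective h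
    linarith
  have hhalf' : ∀ i, (g i (i + 1)).re = Complex.normSq (v i) / 2 := by
    intro i
    rw [← hhalf i, ← hg (i + 1) i, Complex.conj_re]
  -- While v_j = 0, the relation `hv` reads g(i+1,j) = -g(i,j+1), so one may walk along the
  -- antidiagonal from (i,0).
  have up : ∀ (n : ℕ) (i : ℤ), (∀ j : ℤ, 0 ≤ j → j < n → v j = 0) →
      g i 0 = (-1) ^ n * g (i - n) n := by
    intro n i
    induction n with
    | zero => simp
    | succ n ih =>
      intro h
      rw [ih fun j h0 h1 => h j h0 (by push_cast; omega)]
      have h1 := hv (i - n - 1) n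
      rw [h n (by omega) (by push_cast; omega), mul_zero, sub_add_cancel] at h1
      push_cast
      rw [show i - ((n : ℤ) + 1) = i - n - 1 by ring, eq_neg_of_add_eq_zero_left h1]
      ring
  have down : ∀ (n : ℕ) (i : ℤ), (∀ j : ℤ, -n ≤ j → j < 0 → v j = 0) →
      g i 0 = (-1) ^ n * g (i + n) (-n) := by
    intro n i
    induction n with
    | zero => simp
    | succ n ih =>
      intro h
      rw [ih fun j h0 h1 => h j (by push_cast; omega) h1]
      have h1 := hv (i + n) (-n - 1)
      rw [h (-n - 1) (by push_cast; omega) (by omega), mul_zero, sub_add_cancel] at h1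
      push_cast
      rw [show i + ((n : ℤ) + 1) = i + n + 1 by ring, show -((n : ℤ) + 1) = -n - 1 by ring,
        eq_neg_of_add_eq_zero_right h1]
      ring
  have sgn : ∀ (k : ℕ) (z : ℂ), ((-1) ^ k * z).re = (-1) ^ k * z.re
      ∧ ((-1) ^ k * z).im = (-1) ^ k * z.im := by
    intro k z
    have : ((-1 : ℂ)) ^ k = (((-1 : ℝ) ^ k : ℝ) : ℂ) := by push_cast; rfl
    rw [this]; exact ⟨Complex.re_ofReal_mul _ _, Complex.im_ofReal_mul _ _⟩
  have hpm : ∀ k : ℕ, ((-1 : ℝ)) ^ k ≠ 0 := fun k => pow_ne_zero _ (by norm_num)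
  have key : ∀ k : ℕ, ∀ j : ℤ, -k ≤ j → j < k → v j = 0 := by
    intro k
    induction k with
    | zero => intro j h1 h2; push_cast at h1 h2; omega
    | succ k ih =>
      have hup : ∀ j : ℤ, 0 ≤ j → j < k → v j = 0 := fun j h0 h1 => ih j (by omega) h1
      have hdn : ∀ j : ℤ, -k ≤ j → j < 0 → v j = 0 := fun j h0 h1 => ih j h0 (by omega)
      -- In `hm` at index 2k the right side reduces to i a times diagonal entries and is purely
      -- imaginary. The real part of the left side is ±(|v_k|² + |v_{-k}|²)/2.
      have hvk : v k = 0 := by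
        have h := congrArg Complex.re (hm (2 * k))
        rw [up k _ hup, down k _ hdn, up k _ hup, down k (-((2 * k : ℕ) : ℤ)) hdn] at h
        push_cast at h
        rw [show (2 * (k : ℤ) + 1 - k) = k + 1 by ring, show (1 - 2 * (k : ℤ) + k) = -k + 1 by ring,
          show (2 * (k : ℤ) - k) = k by ring, show (-(2 * (k : ℤ)) + k) = -k by ring] at h
        simp only [Complex.add_re, Complex.mul_re, Complex.mul_im, Complex.I_re, Complex.I_im,
          Complex.ofReal_re, Complex.ofReal_im, Complex.add_im, (sgn _ _).1, (sgn _ _).2, hre,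
          hhalf] at h
        have h2 : (-1 : ℝ) ^ k * (Complex.normSq (v k) / 2 + Complex.normSq (v (-k)) / 2) = 0 := by
          linear_combination h
        have h3 := (mul_eq_zero.mp h2).resolve_left (hpm k)
        have h4 := Complex.normSq_nonneg (v k)
        have h5 := Complex.normSq_nonneg (v (-k))
        exact Complex.normSq_eq_zero.mp (by linarith)
      have hup' : ∀ j : ℤ, 0 ≤ j → j < (k + 1 : ℕ) → v j = 0 := by
        intro j h0 h1
        rcases eq_or_ne j k with rfl | hne
        · exact hvk
        · exact hup j h0 (by push_cast at h1; omega)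
      -- At index 2k+1 it is the left side that is real. Because v_k = 0 is already known, the
      -- imaginary part of the right side is ±a |v_{-k-1}|²/2.
      have hvk' : v (-k - 1) = 0 := by
        have h := congrArg Complex.im (hm (2 * k + 1))
        rw [up (k + 1) _ hup', down k _ hdn, up k _ hup,
          down k (-((2 * k + 1 : ℕ) : ℤ)) hdn] at h
        push_cast at h
        rw [show (2 * (k : ℤ) + 1 + 1 - (k + 1)) = k + 1 by ring,
          show (1 - (2 * (k : ℤ) + 1) + k) = -k by ring,
          show (2 * (k : ℤ) + 1 - k) = k + 1 by ring,
          show (-(2 * (k : ℤ) + 1) + k) = -k - 1 by ring,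
          show (-(k : ℤ)) = -k - 1 + 1 by ring] at h
        simp only [Complex.add_re, Complex.mul_re, Complex.mul_im, Complex.I_re, Complex.I_im,
          Complex.ofReal_re, Complex.ofReal_im, Complex.add_im, (sgn _ _).1, (sgn _ _).2, hre,
          hhalf, hvk, map_zero] at h
        rw [show (-(k : ℤ) - 1 + 1 - 1) = -k - 1 by ring] at h
        have h2 : a * ((-1 : ℝ) ^ k * (Complex.normSq (v (-k - 1)) / 2)) = 0 := by
          simp only [hhalf'] at h
          linear_combination -h
        have h3 := (mul_eq_zero.mp ((mul_eq_zero.mp h2).resolve_left ha)).resolve_left (hpm k)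
        exact Complex.normSq_eq_zero.mp (by linarith)
      intro j h1 h2
      push_cast at h1 h2
      rcases eq_or_ne j k with rfl | hne
      · exact hvk
      rcases eq_or_ne j (-k - 1) with rfl | hne'
      · exact hvk'
      exact ih j (by omega) (by omega)
  exact key (i.natAbs + 1) i (by omega) (by omega)

/-- The series `e ^ (i λ)`. -/
def expZ (i : ℤ) : PowerSeries ℂ := rescale (i : ℂ) (PowerSeries.exp ℂ)

theorem expZ_add (i j : ℤ) : expZ (i + j) = expZ i * expZ j := by
  rw [expZ, expZ, expZ, exp_mul_exp_eq_exp_add]; push_cast; rfl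

theorem expZ_zero : expZ 0 = 1 := by
  rw [expZ]; simp

theorem expZ_one : expZ 1 = PowerSeries.exp ℂ := by
  rw [expZ]; simp

theorem expZ_natCast (n : ℕ) : expZ n = PowerSeries.exp ℂ ^ n := by
  rw [exp_pow_eq_rescale_exp, expZ]; simp

theorem map_conj_expZ (i : ℤ) : map (starRingEnd ℂ) (expZ i) = expZ i := by
  ext n; simp [expZ, coeff_rescale]

theorem isEven_expZ_add (i : ℤ) : IsEven (expZ i + expZ (-i)) := by
  intro n hn
  rw [map_add, expZ, expZ, coeff_rescale, coeff_rescale]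
  push_cast
  rw [hn.neg_pow]; ring

/-- Here b ≠ 0 and the two series are not conjugate, so positivity is not available. A kernel vector
x is turned into the functional ℓ below; the Lyapunov argument gives ℓ(e^(iλ)/(1-u)) = 0 for all
integers i, and combinations of these series have every possible leading order. -/
theorem gramDet_ne_zero (N : ℕ) {b : ℝ} (hb : b ≠ 0) {G : PowerSeries ℂ}
    (hG : constantCoeff G ≠ 0) :
    gramDet N ((1 + C (Complex.I * b) * PowerSeries.exp ℂ) * G) (map (starRingEnd ℂ) G) ≠ 0 := by
  classical
  intro hdet
  set F := (1 + C (Complex.I * b) * PowerSeries.exp ℂ) * G with hF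
  set G' := map (starRingEnd ℂ) G with hG'
  obtain ⟨x, hx0, hx⟩ := Matrix.exists_mulVec_eq_zero_iff.mpr hdet
  apply hx0
  let ℓ : PowerSeries ℂ →ₗ[ℂ] ℂ := ∑ j : Fin N, x j • (coeff (2 * (j : ℕ) + 1)).comp
    (LinearMap.mulLeft ℂ G')
  have hℓ : ∀ h, ℓ h = ∑ j : Fin N, x j * coeff (2 * (j : ℕ) + 1) (G' * h) := by
    intro h; simp [ℓ, LinearMap.sum_apply]
  have hker : ∀ i : Fin N, ∑ ν ∈ Finset.range (2 * N),
      coeff (2 * (i : ℕ) + 1) (F * tanhHalf ^ ν) * ℓ (tanhHalf ^ ν) = 0 := by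
    intro i
    have h := congrFun hx i
    simp only [Matrix.mulVec, dotProduct, Matrix.of_apply, gram, Pi.zero_apply,
      Finset.sum_mul] at h
    rw [Finset.sum_comm] at h
    rw [← h]
    refine Finset.sum_congr rfl fun ν _ => ?_
    rw [hℓ, Finset.mul_sum]
    exact Finset.sum_congr rfl fun j _ => by ring
  -- Even factors mix the rows of F only among themselves, so the kernel equations persist after
  -- multiplying F by any even e.
  have hkerE : ∀ e, IsEven e → ∀ i : Fin N, ∑ ν ∈ Finset.range (2 * N),
      coeff (2 * (i : ℕ) + 1) (e * F * tanhHalf ^ ν) * ℓ (tanhHalf ^ ν) = 0 := by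
    intro e he i
    have : ∀ ν, coeff (2 * (i : ℕ) + 1) (e * F * tanhHalf ^ ν) * ℓ (tanhHalf ^ ν) =
        ∑ l : Fin N, evenMat N e i l *
          (coeff (2 * (l : ℕ) + 1) (F * tanhHalf ^ ν) * ℓ (tanhHalf ^ ν)) := by
      intro ν
      rw [mul_assoc, coeff_odd_even_mul he _ i.2, ← Fin.sum_univ_eq_sum_range (fun l =>
        (if l ≤ (i : ℕ) then coeff (2 * ((i : ℕ) - l)) e else 0)
          * coeff (2 * l + 1) (F * tanhHalf ^ ν)) N, Finset.sum_mul]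
      exact Finset.sum_congr rfl fun l _ => by simp only [evenMat, Matrix.of_apply]; ring
    simp only [this]
    rw [Finset.sum_comm]
    refine Finset.sum_eq_zero fun l _ => ?_
    rw [← Finset.mul_sum, hker, mul_zero]
  have hconj : ∀ h, (starRingEnd ℂ) (ℓ h) =
      ∑ i : Fin N, (starRingEnd ℂ) (x i) *
        coeff (2 * (i : ℕ) + 1) (G * map (starRingEnd ℂ) h) := by
    intro h
    rw [hℓ, map_sum]
    refine Finset.sum_congr rfl fun i _ => ?_
    rw [map_mul, conj_coeff, map_mul]
    congr 3
    ext n; simp [hG']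
  let Φ : PowerSeries ℂ → PowerSeries ℂ → ℂ := fun g h =>
    ∑ ν ∈ Finset.range (2 * N), (starRingEnd ℂ) (ℓ (g * tanhHalf ^ ν)) * ℓ (h * tanhHalf ^ ν)
  -- The sign of i b is reversed because the first argument of Φ is conjugated; conjugation restores
  -- the factor contained in F.
  have hΦE : ∀ e, IsEven e → map (starRingEnd ℂ) e = e →
      Φ (e * (1 + C (-(Complex.I * b)) * PowerSeries.exp ℂ)) 1 = 0 := by
    intro e he he'
    have hreal : ∀ ν, map (starRingEnd ℂ)
        (e * (1 + C (-(Complex.I * b)) * PowerSeries.exp ℂ) * tanhHalf ^ ν)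
        = e * (1 + C (Complex.I * b) * PowerSeries.exp ℂ) * tanhHalf ^ ν := by
      intro ν
      rw [map_mul, map_mul, map_pow, he', map_conj_tanhHalf, map_add, map_mul, map_C, map_exp]
      simp
    simp only [Φ, hconj, hreal, one_mul, Finset.sum_mul]
    rw [Finset.sum_comm]
    refine Finset.sum_eq_zero fun i _ => ?_
    have h := hkerE e he i
    simp only [mul_assoc]
    rw [← Finset.mul_sum]
    convert mul_zero _ using 2
    rw [← h]
    refine Finset.sum_congr rfl fun ν _ => ?_
    congr 2
    rw [hF]; ring
  have hvan : ∀ g, ℓ (g * tanhHalf ^ (2 * N)) = 0 := by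
    intro g
    rw [hℓ]
    refine Finset.sum_eq_zero fun j _ => ?_
    rw [← mul_assoc, coeff_mul_tanhHalf_pow_of_lt _ (by have := j.2; omega), mul_zero]
  have h1u : constantCoeff (1 - tanhHalf) ≠ 0 := by simp [constantCoeff_tanhHalf]
  set w := (1 - tanhHalf)⁻¹ with hw
  have hw1 : w * (1 - tanhHalf) = 1 := PowerSeries.inv_mul_cancel _ h1u
  have hwp : w * (1 + tanhHalf) = PowerSeries.exp ℂ := by
    rw [← one_sub_tanhHalf_mul_exp, ← mul_assoc, hw1, one_mul]
  -- With a_ν = ℓ(g w u^ν), multiplication by 1 = w(1-u) and by e^λ = w(1+u) gives a_ν - a_{ν+1} and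
  -- a_ν + a_{ν+1}. The cross terms cancel and the sum telescopes; its upper end vanishes because
  -- u^(2N) has order 2N.
  have hlyap : ∀ g h, Φ (PowerSeries.exp ℂ * g) h + Φ g (PowerSeries.exp ℂ * h)
      = 2 * ((starRingEnd ℂ) (ℓ (g * w)) * ℓ (h * w)) := by
    intro g h
    let t : ℕ → ℂ := fun ν => (starRingEnd ℂ) (ℓ (g * w * tanhHalf ^ ν)) * ℓ (h * w * tanhHalf ^ ν)
    have hsplit : ∀ (k : PowerSeries ℂ) (ν : ℕ),
        ℓ (k * tanhHalf ^ ν) = ℓ (k * w * tanhHalf ^ ν) - ℓ (k * w * tanhHalf ^ (ν + 1)) := by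
      intro k ν
      rw [← map_sub]; congr 1
      linear_combination (-k * tanhHalf ^ ν) * hw1
    have hsplit' : ∀ (k : PowerSeries ℂ) (ν : ℕ), ℓ (PowerSeries.exp ℂ * k * tanhHalf ^ ν)
        = ℓ (k * w * tanhHalf ^ ν) + ℓ (k * w * tanhHalf ^ (ν + 1)) := by
      intro k ν
      rw [← map_add]; congr 1
      linear_combination (-k * tanhHalf ^ ν) * hwp
    have hstep : ∀ ν,
        (starRingEnd ℂ) (ℓ (PowerSeries.exp ℂ * g * tanhHalf ^ ν)) * ℓ (h * tanhHalf ^ ν) +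
        (starRingEnd ℂ) (ℓ (g * tanhHalf ^ ν)) * ℓ (PowerSeries.exp ℂ * h * tanhHalf ^ ν)
        = 2 * (t ν - t (ν + 1)) := by
      intro ν
      rw [hsplit' g, hsplit h, hsplit g, hsplit' h, map_add, map_sub]
      simp only [t]
      ring
    simp only [Φ]
    rw [← Finset.sum_add_distrib, Finset.sum_congr rfl fun ν _ => hstep ν, ← Finset.mul_sum,
      Finset.sum_range_sub', show t (2 * N) = 0 by simp only [t, hvan, mul_zero]]
    simp [t]
  have hv : ∀ i : ℤ, ℓ (expZ i * w) = 0 := by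
    have h2 : (Real.sqrt 2 : ℂ) * Real.sqrt 2 = 2 := by
      rw [← Complex.ofReal_mul, Real.mul_self_sqrt (by norm_num)]; norm_num
    intro i
    have := eq_zero_of_lyapunov (g := fun i j => Φ (expZ i) (expZ j))
      (v := fun i => (Real.sqrt 2 : ℂ) * ℓ (expZ i * w)) (a := b⁻¹) (inv_ne_zero hb) ?_ ?_ ?_ i
    · refine (mul_eq_zero.mp this).resolve_left ?_
      exact_mod_cast (Real.sqrt_pos.mpr (by norm_num : (0 : ℝ) < 2)).ne'
    · intro i j
      simp only [Φ, map_sum, map_mul, Complex.conj_conj]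
      exact Finset.sum_congr rfl fun ν _ => mul_comm _ _
    · intro i j
      rw [add_comm i, add_comm j, expZ_add, expZ_add, expZ_one, hlyap, map_mul (starRingEnd ℂ),
        Complex.conj_ofReal]
      linear_combination (-(starRingEnd ℂ) (ℓ (expZ i * w)) * ℓ (expZ j * w)) * h2
    -- The even series e^(kλ) + e^(-kλ) in `hΦE` gives the remaining hypothesis, with the constant
    -- -1/(i b) = i/b.
    · intro k
      have h := hΦE (expZ k + expZ (-k)) (isEven_expZ_add k) (by
        rw [map_add, map_conj_expZ, map_conj_expZ])
      have hexp : ∀ ν : ℕ, (starRingEnd ℂ) (ℓ ((expZ k + expZ (-k)) *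
          (1 + C (-(Complex.I * b)) * PowerSeries.exp ℂ) * tanhHalf ^ ν)) =
          (starRingEnd ℂ) (ℓ (expZ k * tanhHalf ^ ν)) +
          (starRingEnd ℂ) (ℓ (expZ (-k) * tanhHalf ^ ν)) +
          Complex.I * b * ((starRingEnd ℂ) (ℓ (expZ (k + 1) * tanhHalf ^ ν)) +
          (starRingEnd ℂ) (ℓ (expZ (1 - k) * tanhHalf ^ ν))) := by
        intro ν
        have : (expZ k + expZ (-k)) *
          (1 + C (-(Complex.I * b)) * PowerSeries.exp ℂ) * tanhHalf ^ ν
          = expZ k * tanhHalf ^ ν + expZ (-k) * tanhHalf ^ ν +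
            (-(Complex.I * b)) • (expZ (k + 1) * tanhHalf ^ ν + expZ (1 - k) * tanhHalf ^ ν) := by
          rw [expZ_add, sub_eq_add_neg, expZ_add, expZ_one, smul_eq_C_mul]; ring
        rw [this]
        simp only [map_add, map_smul, smul_eq_mul, map_mul, map_neg, Complex.conj_I,
          Complex.conj_ofReal]
        ring
      simp only [Φ] at h
      simp only [hexp] at h
      simp only [add_mul, mul_add, mul_assoc, Finset.sum_add_distrib, ← Finset.mul_sum] at h
      simp only [Φ, expZ_zero]
      push_cast
      have hb' : (b : ℂ) ≠ 0 := by exact_mod_cast hb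
      set S1 := ∑ ν ∈ Finset.range (2 * N),
        (starRingEnd ℂ) (ℓ (expZ (k + 1) * tanhHalf ^ ν)) * ℓ (1 * tanhHalf ^ ν)
      set S2 := ∑ ν ∈ Finset.range (2 * N),
        (starRingEnd ℂ) (ℓ (expZ (1 - k) * tanhHalf ^ ν)) * ℓ (1 * tanhHalf ^ ν)
      field_simp
      linear_combination (-Complex.I) * h + (b * (S1 + S2)) * Complex.I_sq
  have hpoly : ∀ q : Polynomial ℂ, ℓ (Polynomial.aeval (PowerSeries.exp ℂ) q * w) = 0 := by
    intro q
    induction q using Polynomial.induction_on' with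
    | add p q hp hq => rw [map_add, add_mul, map_add, hp, hq, add_zero]
    | monomial n c =>
      rw [Polynomial.aeval_monomial, ← expZ_natCast, mul_assoc, ← Algebra.smul_def, map_smul,
        hv, smul_zero]
  obtain ⟨r, hr⟩ : ∃ r, PowerSeries.exp ℂ - 1 = X * r :=
    X_dvd_iff.mpr (by simp)
  have hr0 : constantCoeff r = 1 := by
    have h := congrArg (coeff 1) hr
    rw [show (1 : ℕ) = 0 + 1 from rfl, coeff_succ_X_mul] at h
    simp [coeff_one] at h
    exact h.symm
  -- With j the last index at which x is nonzero, the test series (e^λ - 1)^(2j+1) w has order 2j+1.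
  -- Only the term of index j survives in ℓ, and its coefficient is a product of nonzero constants.
  by_contra hne
  obtain ⟨j, hj⟩ := Function.ne_iff.mp hne
  obtain ⟨j, hjmem, hjmax⟩ := (Finset.univ.filter fun j => x j ≠ 0).exists_max_image id
    ⟨j, by simpa using hj⟩
  have hxj : x j ≠ 0 := by simpa using hjmem
  have h0 := hpoly ((Polynomial.X - 1) ^ (2 * (j : ℕ) + 1))
  have hval : G' * (Polynomial.aeval (PowerSeries.exp ℂ)
      ((Polynomial.X - 1 : Polynomial ℂ) ^ (2 * (j : ℕ) + 1)) * w)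
      = X ^ (2 * (j : ℕ) + 1) * (G' * w * r ^ (2 * (j : ℕ) + 1)) := by
    simp only [map_pow, map_sub, Polynomial.aeval_X, map_one, hr, mul_pow]
    ring
  rw [hℓ, hval, Finset.sum_eq_single j] at h0
  · rw [coeff_X_pow_mul', if_pos le_rfl, Nat.sub_self, coeff_zero_eq_constantCoeff_apply,
      map_mul, map_mul, map_pow, hr0, one_pow, mul_one] at h0
    have hG0 : constantCoeff G' ≠ 0 := by
      rw [hG', ← coeff_zero_eq_constantCoeff_apply, coeff_map, coeff_zero_eq_constantCoeff_apply]
      simpa using hG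
    have hw0 : constantCoeff w ≠ 0 := by
      intro h
      have := congrArg constantCoeff hw1
      rw [map_mul, h, zero_mul] at this
      simp at this
    exact (mul_ne_zero hxj (mul_ne_zero hG0 hw0)) h0
  · intro l _ hl
    by_cases hxl : x l = 0
    · rw [hxl, zero_mul]
    · have hle : l ≤ j := hjmax l (by simpa using hxl)
      have hlt : (l : ℕ) < j := lt_of_le_of_ne hle (by simpa [Fin.ext_iff] using hl)
      rw [coeff_X_pow_mul', if_neg (by omega), mul_zero]
  · simp

end

section

open PowerSeries

/-! ### Echelon bases -/

/-- The positions of the leading entries of the elements of a space of sequences. -/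
theorem exists_echelon (W : Submodule ℂ (ℕ → ℂ)) (M : ℕ) (hM : ∀ f ∈ W, ∀ m, M ≤ m → f m = 0) :
    ∃ (I : Finset ℕ) (w : ℕ → ℕ → ℂ), I.card = Module.finrank ℂ W ∧ (∀ m ∈ I, m < M) ∧
      (∀ m ∈ I, w m ∈ W ∧ w m m = 1 ∧ ∀ m' < m, w m m' = 0) ∧
      (∀ f ∈ W, f ∈ Submodule.span ℂ (w '' I)) ∧
      (∀ f ∈ W, ∀ m, f m ≠ 0 → (∀ m' < m, f m' = 0) → m ∈ I) := by
  classical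
  let P : ℕ → (ℕ → ℂ) → Prop := fun m f => f ∈ W ∧ f m = 1 ∧ ∀ m' < m, f m' = 0
  let I : Finset ℕ := (Finset.range M).filter fun m => ∃ f, P m f
  let w : ℕ → ℕ → ℂ := fun m => if h : ∃ f, P m f then h.choose else 0
  have hw : ∀ m ∈ I, P m (w m) := by
    intro m hm
    have h : ∃ f, P m f := (Finset.mem_filter.mp hm).2
    simp only [w, dif_pos h]
    exact h.choose_spec
  have hpiv : ∀ f ∈ W, ∀ m, f m ≠ 0 → (∀ m' < m, f m' = 0) → m ∈ I := by
    intro f hf m hm hm'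
    refine Finset.mem_filter.mpr ⟨Finset.mem_range.mpr ?_, (f m)⁻¹ • f, W.smul_mem _ hf, ?_, ?_⟩
    · by_contra h
      exact hm (hM f hf m (not_lt.mp h))
    · simp [hm]
    · intro m' h; simp [hm' m' h]
  -- Elimination from the top: the induction is on the number n of positions at which f may still be
  -- nonzero.
  have hspan : ∀ n ≤ M, ∀ f ∈ W, (∀ m' < M - n, f m' = 0) →
      f ∈ Submodule.span ℂ (w '' I) := by
    intro n
    induction n with
    | zero =>
      intro _ f hf h
      have : f = 0 := by
        ext m
        by_cases hm : m < M
        · exact h m hm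
        · exact hM f hf m (not_lt.mp hm)
      rw [this]; exact Submodule.zero_mem _
    | succ n ih =>
      intro hn f hf h
      by_cases h0 : f (M - (n + 1)) = 0
      · refine ih (by omega) f hf fun m' hm' => ?_
        rcases eq_or_ne m' (M - (n + 1)) with rfl | hne
        · exact h0
        · exact h m' (by omega)
      · have hI := hpiv f hf _ h0 h
        obtain ⟨hwW, hw1, hw0⟩ := hw _ hI
        have h1 := ih (by omega) (f - f (M - (n + 1)) • w (M - (n + 1)))
          (W.sub_mem hf (W.smul_mem _ hwW)) fun m' hm' => by
            rcases eq_or_ne m' (M - (n + 1)) with rfl | hne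
            · simp [hw1]
            · simp [h m' (by omega), hw0 m' (by omega)]
        have h2 := Submodule.smul_mem (Submodule.span ℂ (w '' (I : Set ℕ))) (f (M - (n + 1)))
          (Submodule.subset_span ⟨_, hI, rfl⟩)
        have := Submodule.add_mem _ h1 h2
        rwa [sub_add_cancel] at this
  have hW : W = Submodule.span ℂ (w '' I) := by
    refine le_antisymm (fun f hf => hspan M le_rfl f hf (by simp)) ?_
    rw [Submodule.span_le]
    rintro _ ⟨m, hm, rfl⟩
    exact (hw m hm).1
  have hli : LinearIndependent ℂ (fun m : I => w m) := by
    rw [Fintype.linearIndependent_iff]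
    intro c hc
    by_contra hne
    push Not at hne
    obtain ⟨m, hmmem, hmin⟩ := (Finset.univ.filter fun m : I => c m ≠ 0).exists_min_image
      (fun m => (m : ℕ)) ⟨hne.choose, by simpa using hne.choose_spec⟩
    have h := congrFun hc (m : ℕ)
    simp only [Finset.sum_apply, Pi.smul_apply, smul_eq_mul, Pi.zero_apply] at h
    rw [Finset.sum_eq_single m] at h
    · rw [(hw m m.2).2.1, mul_one] at h
      exact (by simpa using hmmem : c m ≠ 0) h
    · intro m' _ hm'
      by_cases hcm : c m' = 0
      · rw [hcm, zero_mul]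
      · have hle := hmin m' (by simpa using hcm)
        have hlt : (m : ℕ) < m' := lt_of_le_of_ne hle fun h => hm' (Subtype.ext h.symm)
        rw [(hw m' m'.2).2.2 _ hlt, mul_zero]
    · simp
  refine ⟨I, w, ?_, fun m hm => Finset.mem_range.mp (Finset.mem_filter.mp hm).1, hw,
    fun f hf => hW ▸ hf, hpiv⟩
  have hr : Set.range (fun m : I => w m) = w '' I := by
    ext f; simp
  rw [hW, ← hr, finrank_span_eq_card hli, Fintype.card_coe]

/-! ### The rows of the coefficient matrix -/

/-- The sequence of coefficients by which multiplication by `a` contributes to the coefficient of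
index `2 i + 1`. -/
def rowFun (a : PowerSeries ℂ) (i m : ℕ) : ℂ :=
  if m ≤ 2 * i + 1 then coeff (2 * i + 1 - m) a else 0

theorem sum_rowFun_odd {N : ℕ} (a : PowerSeries ℂ) (i j : Fin N) :
    rowFun a i (2 * j + 1) = evenMat N a i j := by
  simp only [rowFun, evenMat, Matrix.of_apply]
  by_cases h : (j : ℕ) ≤ i
  · rw [if_pos (by omega), if_pos h]; congr 2; omega
  · rw [if_neg (by omega), if_neg h]

/-- The span of the rows. -/
def rowSpace (N : ℕ) (a : PowerSeries ℂ) : Submodule ℂ (ℕ → ℂ) :=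
  Submodule.span ℂ (Set.range fun i : Fin N => rowFun a i)

/-- Restricted to odd positions, the rows form the unitriangular matrix `evenMat N a`, so they are
independent. -/
theorem finrank_rowSpace (N : ℕ) {a : PowerSeries ℂ} (ha : constantCoeff a = 1) :
    Module.finrank ℂ (rowSpace N a) = N := by
  have hli : LinearIndependent ℂ fun i : Fin N => rowFun a i := by
    rw [Fintype.linearIndependent_iff]
    intro c hc
    have hu : IsUnit (evenMat N a) :=
      (Matrix.isUnit_iff_isUnit_det _).mpr (by rw [det_evenMat N ha]; exact isUnit_one)
    have h0 : Matrix.vecMul c (evenMat N a) = Matrix.vecMul 0 (evenMat N a) := by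
      ext j
      have h := congrFun hc (2 * (j : ℕ) + 1)
      simp only [Finset.sum_apply, Pi.smul_apply, smul_eq_mul, Pi.zero_apply, sum_rowFun_odd] at h
      simpa [Matrix.vecMul, dotProduct] using h
    exact fun i => congrFun (Matrix.vecMul_injective_iff_isUnit.mpr hu h0) i
  rw [rowSpace, finrank_span_eq_card hli, Fintype.card_fin]

theorem rowSpace_eq_zero_of_le {N : ℕ} {a : PowerSeries ℂ} {f : ℕ → ℂ} (hf : f ∈ rowSpace N a)
    (m : ℕ) (hm : 2 * N ≤ m) : f m = 0 := by
  have : rowSpace N a ≤ LinearMap.ker (LinearMap.proj (R := ℂ) (φ := fun _ : ℕ => ℂ) m) := by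
    rw [rowSpace, Submodule.span_le]
    rintro _ ⟨i, rfl⟩
    simp only [SetLike.mem_coe, LinearMap.mem_ker, LinearMap.proj_apply, rowFun]
    rw [if_neg (by have := i.2; omega)]
  simpa using this hf

/-- Shifting row i by 2 gives row i - 1, and row 0 lives at the positions 0 and 1 only. Hence the
leading positions are closed under subtracting 2. -/
theorem shift_mem_rowSpace {N : ℕ} {a : PowerSeries ℂ} {f : ℕ → ℂ} (hf : f ∈ rowSpace N a) :
    (fun m => f (m + 2)) ∈ rowSpace N a := by
  have : rowSpace N a ≤ (rowSpace N a).comap (LinearMap.funLeft ℂ ℂ fun m : ℕ => m + 2) := by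
    conv_lhs => rw [rowSpace]
    rw [Submodule.span_le]
    rintro _ ⟨i, rfl⟩
    simp only [SetLike.mem_coe, Submodule.mem_comap]
    obtain ⟨i, hi⟩ := i
    cases i with
    | zero =>
      convert Submodule.zero_mem _
      ext m
      simp [LinearMap.funLeft_apply, rowFun]
    | succ i =>
      refine Submodule.subset_span ⟨⟨i, by omega⟩, ?_⟩
      ext m
      simp only [LinearMap.funLeft_apply, rowFun]
      by_cases h : m ≤ 2 * i + 1
      · rw [if_pos h, if_pos (by omega)]; congr 2; omega
      · rw [if_neg h, if_neg (by omega)]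
  exact this hf

/-! ### Positions closed under subtracting `2` -/

theorem eq_range_of_closed (S : Finset ℕ) (h : ∀ s, s + 1 ∈ S → s ∈ S) :
    S = Finset.range S.card := by
  have hdown : ∀ s ∈ S, ∀ t ≤ s, t ∈ S := by
    intro s
    induction s with
    | zero => intro hs t ht; rwa [Nat.le_zero.mp ht]
    | succ s ih =>
      intro hs t ht
      rcases Nat.lt_or_eq_of_le ht with h1 | rfl
      · exact ih (h s hs) t (by omega)
      · exact hs
  refine Finset.eq_of_subset_of_card_le (fun s hs => ?_) (by simp)
  rw [Finset.mem_range]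
  have : Finset.range (s + 1) ⊆ S := fun t ht => hdown s hs t (by simp at ht; omega)
  have := Finset.card_le_card this
  simp at this
  omega

/-- Each parity class is an initial segment, of length a for the even and b for the odd positions;
the sums are a(a-1) and b². -/
theorem exists_parity_lengths (I : Finset ℕ) (h : ∀ m, m + 2 ∈ I → m ∈ I) :
    ∃ a b : ℕ, (∀ m, m ∈ I ↔ (m % 2 = 0 ∧ m / 2 < a) ∨ (m % 2 = 1 ∧ m / 2 < b)) ∧
      I.card = a + b ∧ 2 * ∑ m ∈ I, (m : ℤ) = 2 * a * (a - 1) + 2 * b ^ 2 := by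
  classical
  have hex : ∀ c, c < 2 → ∃ n, ∀ i, 2 * i + c ∈ I ↔ i < n := by
    intro c hc
    let S : Finset ℕ := (I.filter fun m => m % 2 = c).image (· / 2)
    have hS : ∀ i, i ∈ S ↔ 2 * i + c ∈ I := by
      intro i
      simp only [S, Finset.mem_image, Finset.mem_filter]
      constructor
      · rintro ⟨m, ⟨hm, hmc⟩, rfl⟩
        rwa [show 2 * (m / 2) + c = m by omega]
      · intro hi
        exact ⟨_, ⟨hi, by omega⟩, by omega⟩
    have := eq_range_of_closed S fun s hs => (hS s).mpr (h _ (by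
      have := (hS _).mp hs; rwa [show 2 * s + c + 2 = 2 * (s + 1) + c by ring]))
    exact ⟨S.card, fun i => by rw [← hS, this, Finset.mem_range, Finset.card_range]⟩
  obtain ⟨a, ha⟩ := hex 0 (by norm_num)
  obtain ⟨b, hb⟩ := hex 1 (by norm_num)
  have hmem : ∀ m, m ∈ I ↔ (m % 2 = 0 ∧ m / 2 < a) ∨ (m % 2 = 1 ∧ m / 2 < b) := by
    intro m
    rcases Nat.mod_two_eq_zero_or_one m with h0 | h0
    · have := ha (m / 2)
      rw [show 2 * (m / 2) + 0 = m by omega] at this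
      simp [this, h0]
    · have := hb (m / 2)
      rw [show 2 * (m / 2) + 1 = m by omega] at this
      simp [this, h0]
  have hI : I = (Finset.range a).image (fun i => 2 * i) ∪ (Finset.range b).image
      (fun i => 2 * i + 1) := by
    ext m
    rw [hmem]
    simp only [Finset.mem_union, Finset.mem_image, Finset.mem_range]
    constructor
    · rintro (⟨h1, h2⟩ | ⟨h1, h2⟩)
      · exact Or.inl ⟨_, h2, by omega⟩
      · exact Or.inr ⟨_, h2, by omega⟩
    · rintro (⟨i, h1, rfl⟩ | ⟨i, h1, rfl⟩)
      · left; omega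
      · right; omega
  have hdisj : Disjoint ((Finset.range a).image (fun i => 2 * i)) ((Finset.range b).image
      (fun i => 2 * i + 1)) := by
    rw [Finset.disjoint_left]
    intro m h1 h2
    simp only [Finset.mem_image] at h1 h2
    obtain ⟨i, _, rfl⟩ := h1
    obtain ⟨j, _, hj⟩ := h2
    omega
  have hi1 : Function.Injective fun i : ℕ => 2 * i := fun i j h => by simpa using h
  have hi2 : Function.Injective fun i : ℕ => 2 * i + 1 := fun i j h => by simpa using h
  refine ⟨a, b, hmem, ?_, ?_⟩
  · rw [hI, Finset.card_union_of_disjoint hdisj, Finset.card_image_of_injective _ hi1,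
      Finset.card_image_of_injective _ hi2, Finset.card_range, Finset.card_range]
  · rw [hI, Finset.sum_union hdisj, Finset.sum_image fun x _ y _ h => hi1 h,
      Finset.sum_image fun x _ y _ h => hi2 h]
    have e1 : ∀ n : ℕ, ∑ i ∈ Finset.range n, ((2 * i : ℕ) : ℤ) = n * (n - 1) := by
      intro n
      induction n with
      | zero => simp
      | succ n ih => rw [Finset.sum_range_succ, ih]; push_cast; ring
    have e2 : ∀ n : ℕ, ∑ i ∈ Finset.range n, ((2 * i + 1 : ℕ) : ℤ) = n ^ 2 := by
      intro n
      induction n with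
      | zero => simp
      | succ n ih => rw [Finset.sum_range_succ, ih]; push_cast; ring
    rw [e1, e2]; ring

/-- The staircase positions `0, …, r - 1, r + 1, r + 3, …`. -/
def stair (r k : ℕ) : ℕ := if k < r then k else 2 * k - r + 1

theorem stair_injective (r : ℕ) : Function.Injective (stair r) := by
  intro k l h
  simp only [stair] at h
  split_ifs at h <;> omega

/-- Since a + b = N, the sum condition says (b-a)(b-a+1) = N₀(N₀+1), so N₀ is b - a or a - b - 1.
Both cases give the same staircase, with N - N₀ equal to 2a or 2b + 1. If N₀ = N then a = 0, so
there are no even positions. -/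
theorem stair_mem {I : Finset ℕ} (hI : ∀ m, m + 2 ∈ I → m ∈ I) {N N₀ : ℕ} (hcard : I.card = N)
    (hsum : 2 * ∑ m ∈ I, (m : ℤ) = N * (N - 1) + N₀ * (N₀ + 1)) :
    N₀ ≤ N ∧ (N₀ = N → 0 ∉ I) ∧ ∀ k < N, stair (N - N₀) k ∈ I := by
  obtain ⟨a, b, hmem, hab, hs⟩ := exists_parity_lengths I hI
  rw [hcard] at hab
  have h1 : ((b : ℤ) - a - N₀) * ((b : ℤ) - a + N₀ + 1) = 0 := by
    have hN : (N : ℤ) = a + b := by exact_mod_cast hab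
    rw [hs, hN] at hsum
    linear_combination hsum
  rcases mul_eq_zero.mp h1 with h | h
  · refine ⟨by omega, fun h' h0 => ?_, fun k hk => ?_⟩
    · rw [hmem] at h0; omega
    · rw [hmem, stair]; split_ifs <;> omega
  · refine ⟨by omega, fun h' h0 => ?_, fun k hk => ?_⟩
    · omega
    · rw [hmem, stair]; split_ifs <;> omega

end

/-! ### The multiplicity of the root 0 of the Adler--Moser polynomial. -/

section

open PowerSeries

/-- Coefficients `(κ_i)` placed at the odd positions `2 i + 1 ≥ 3`. -/
def oddSeq (κ : ℕ → ℂ) (i : ℕ) : ℂ := if i = 1 then 0 else if Odd i then κ (i / 2) else 0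

/-- The factor e^(zε) is split off the exponential. The Adler--Moser matrix becomes the matrix of
the rows times the matrix with entries z^(m-j)/(m-j)!. -/
theorem theta_eq (κ : ℕ → ℂ) (N : ℕ) (i j : Fin N) :
    theta κ (2 * ((i : ℤ) + 1) - ((j : ℤ) + 1)) =
      ∑ m ∈ Finset.range (2 * N), Polynomial.C (rowFun (expSeries (oddSeq κ)) i m) *
        (if (j : ℕ) ≤ m then Polynomial.X ^ (m - j) *
          Polynomial.C (((m - (j : ℕ)).factorial : ℂ)⁻¹) else 0) := by
  let a := expSeries (oddSeq κ)
  let y : ℕ → Polynomial ℂ := fun i => if i = 1 then Polynomial.X else 0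
  have hsplit : expSeries (fun i => if i = 1 then (Polynomial.X : Polynomial ℂ) else
      if Odd i then Polynomial.C (κ (i / 2)) else 0) = map Polynomial.C a * expSeries y := by
    rw [map_expSeries, ← expSeries_add]
    congr 1
    ext1 i
    simp only [oddSeq, y]
    split_ifs <;> simp
  have hy : ∀ l, coeff l (expSeries y) = Polynomial.X ^ l *
      Polynomial.C ((l.factorial : ℂ)⁻¹) := by
    have h : rescale (Polynomial.X : Polynomial ℂ) (PowerSeries.exp (Polynomial ℂ))
        = expSeries y := by
      refine eq_expSeries ?_ ?_
      · rw [← coeff_zero_eq_constantCoeff_apply, coeff_rescale]; simp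
      · have h1 : ∀ f : PowerSeries (Polynomial ℂ), d⁄dX _ (rescale Polynomial.X f)
            = C Polynomial.X * rescale Polynomial.X (d⁄dX _ f) := by
          intro f; ext1 n; simp only [coeff_derivative, coeff_rescale, coeff_C_mul]; ring
        rw [h1, derivative_exp, mul_comm]
        congr 1
        ext1 n
        rw [coeff_derivative, seqSeries, coeff_mk, coeff_C]
        simp only [y]
        by_cases hn : n = 0
        · simp [hn]
        · simp [hn]
    intro l
    rw [← h, coeff_rescale, coeff_exp]
    congr 1
    rw [one_div, Polynomial.algebraMap_apply]
    simp
  rw [theta, schur_eq, hsplit]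
  have hcoef : (if (0 : ℤ) ≤ 2 * ((i : ℤ) + 1) - ((j : ℤ) + 1) then
      coeff (2 * ((i : ℤ) + 1) - ((j : ℤ) + 1)).toNat (map Polynomial.C a * expSeries y) else 0)
      = coeff (2 * (i : ℕ) + 1) (map Polynomial.C a * (X ^ (j : ℕ) * expSeries y)) := by
    rw [mul_left_comm, coeff_X_pow_mul']
    by_cases h : (j : ℕ) ≤ 2 * i + 1
    · rw [if_pos (by omega), if_pos h]; congr 2; omega
    · rw [if_neg (by omega), if_neg h]
  rw [hcoef, coeff_mul_eq_sum_range _ _ (show 2 * (i : ℕ) + 1 < 2 * N by have := i.2; omega)]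
  refine Finset.sum_congr rfl fun m _ => ?_
  rw [coeff_X_pow_mul']
  congr 1
  · simp only [rowFun, coeff_map]
    split_ifs <;> simp [a]
  · split_ifs
    · rw [hy]
    · rfl

/-- Multiplying row k by (p_k)! turns the entries into descending factorials of p_k. These are monic
polynomials of degree j in p_k, so the determinant is a Vandermonde determinant at distinct points.
-/
theorem det_inv_factorial_ne_zero {N : ℕ} {p : Fin N → ℕ} (hp : Function.Injective p) :
    (Matrix.of fun k j : Fin N =>
      if (j : ℕ) ≤ p k then (((p k - (j : ℕ)).factorial : ℂ)⁻¹) else 0).det ≠ 0 := by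
  have h : (Matrix.of fun k j : Fin N =>
      if (j : ℕ) ≤ p k then (((p k - (j : ℕ)).factorial : ℂ)⁻¹) else 0) =
      Matrix.of fun k j : Fin N => (((p k).factorial : ℂ)⁻¹) *
        (Matrix.of fun k j : Fin N => (descPochhammer ℂ j).eval ((p k : ℕ) : ℂ)) k j := by
    ext k j
    simp only [Matrix.of_apply]
    rw [descPochhammer_eval_eq_descFactorial]
    split_ifs with hj
    · have h1 := Nat.factorial_mul_descFactorial hj
      have h2 : ((p k).factorial : ℂ) ≠ 0 := by exact_mod_cast Nat.factorial_ne_zero _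
      have h3 : ((p k - (j : ℕ)).factorial : ℂ) ≠ 0 := by exact_mod_cast Nat.factorial_ne_zero _
      field_simp
      exact_mod_cast h1.symm
    · rw [Nat.descFactorial_of_lt (not_le.mp hj)]; simp
  rw [h, Matrix.det_mul_column]
  refine mul_ne_zero (Finset.prod_ne_zero_iff.mpr fun k _ => inv_ne_zero ?_) ?_
  · exact_mod_cast Nat.factorial_ne_zero _
  · have h2 := Matrix.det_eval_matrixOfPolynomials_eq_det_vandermonde
      (fun k : Fin N => ((p k : ℕ) : ℂ)) (fun j : Fin N => descPochhammer ℂ j)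
      (fun j => descPochhammer_natDegree ℂ j) (fun j => monic_descPochhammer ℂ j)
    rw [← h2, Matrix.det_vandermonde_ne_zero_iff]
    intro k l hkl
    exact hp (Nat.cast_injective (R := ℂ) hkl)

theorem rootMultiplicity_of_X_pow_mul {P Y : Polynomial ℂ} {s t : ℕ} (hY : Y.eval 0 ≠ 0)
    (h : Polynomial.X ^ s * P = Polynomial.X ^ t * Y) : s + P.rootMultiplicity 0 = t := by
  have hX : (Polynomial.X : Polynomial ℂ) = Polynomial.X - Polynomial.C 0 := by simp
  have hY0 : Y ≠ 0 := by rintro rfl; simp at hY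
  have hR : (Polynomial.X : Polynomial ℂ) ^ t * Y ≠ 0 :=
    mul_ne_zero (pow_ne_zero _ Polynomial.X_ne_zero) hY0
  have h1 := congrArg (Polynomial.rootMultiplicity 0) h
  rw [Polynomial.rootMultiplicity_mul (h ▸ hR), Polynomial.rootMultiplicity_mul hR, hX,
    Polynomial.rootMultiplicity_X_sub_C_pow, Polynomial.rootMultiplicity_X_sub_C_pow,
    Polynomial.rootMultiplicity_eq_zero hY, add_zero] at h1
  exact h1

/-- If the rows are combinations of an echelon family with leading positions `p`, then the
multiplicity of the root `0` of the Adler--Moser polynomial is determined by `p`. -/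
theorem rootMultiplicity_adlerMoser {N : ℕ} {κ : ℕ → ℂ} {p : Fin N → ℕ}
    (hp : Function.Injective p) {H : Matrix (Fin N) (Fin N) ℂ} (hH : H.det ≠ 0)
    {E : Fin N → ℕ → ℂ} (hpN : ∀ k, p k < 2 * N) (hE1 : ∀ k, E k (p k) = 1)
    (hE0 : ∀ k, ∀ m < p k, E k m = 0)
    (hrow : ∀ (i : Fin N) m, rowFun (expSeries (oddSeq κ)) i m = ∑ k, H i k * E k m) :
    ∑ j : Fin N, (j : ℕ) + (adlerMoser N κ).rootMultiplicity 0 = ∑ k, p k := by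
  let Z : ℕ → Fin N → Polynomial ℂ := fun m j => if (j : ℕ) ≤ m then Polynomial.X ^ (m - j) *
          Polynomial.C (((m - (j : ℕ)).factorial : ℂ)⁻¹) else 0
  -- The powers z^(p_k) and z^(-j) are extracted from rows and columns. At z = 0 only the leading
  -- entry m = p_k remains, which leaves the determinant of inverse factorials.
  let Y : Matrix (Fin N) (Fin N) (Polynomial ℂ) := Matrix.of fun k j =>
    ∑ m ∈ Finset.range (2 * N), Polynomial.C (E k m) * Polynomial.X ^ (m - p k) *
      (if (j : ℕ) ≤ m then Polynomial.C (((m - (j : ℕ)).factorial : ℂ)⁻¹) else 0)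
  let EZ : Matrix (Fin N) (Fin N) (Polynomial ℂ) := Matrix.of fun k j =>
    ∑ m ∈ Finset.range (2 * N), Polynomial.C (E k m) * Z m j
  have hYEZ : Matrix.diagonal (fun k => Polynomial.X ^ p k) * Y
      = EZ * Matrix.diagonal (fun j : Fin N => Polynomial.X ^ (j : ℕ)) := by
    ext1 k j
    rw [Matrix.diagonal_mul, Matrix.mul_diagonal]
    simp only [Y, EZ, Matrix.of_apply, Finset.mul_sum, Finset.sum_mul]
    refine Finset.sum_congr rfl fun m _ => ?_
    by_cases hm : m < p k
    · simp [hE0 k m hm]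
    · simp only [Z]
      split_ifs with hj
      · have e1 : (Polynomial.X : Polynomial ℂ) ^ p k * Polynomial.X ^ (m - p k)
            = Polynomial.X ^ (m - j) * Polynomial.X ^ (j : ℕ) := by
          rw [← pow_add, ← pow_add]; congr 1; omega
        linear_combination (Polynomial.C (E k m) *
          Polynomial.C (((m - (j : ℕ)).factorial : ℂ)⁻¹)) * e1
      · simp
  have htheta : (Matrix.of fun i j : Fin N => theta κ (2 * ((i : ℤ) + 1) - ((j : ℤ) + 1)))
      = H.map Polynomial.C * EZ := by
    ext1 i j
    rw [Matrix.of_apply, theta_eq]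
    simp only [Matrix.mul_apply, Matrix.map_apply, EZ, Matrix.of_apply, Finset.mul_sum, hrow]
    rw [Finset.sum_comm]
    refine Finset.sum_congr rfl fun m _ => ?_
    rw [map_sum, Finset.sum_mul]
    refine Finset.sum_congr rfl fun k _ => ?_
    rw [map_mul, mul_assoc]
  have hdet := congrArg Matrix.det hYEZ
  rw [Matrix.det_mul, Matrix.det_mul, Matrix.det_diagonal, Matrix.det_diagonal,
    Finset.prod_pow_eq_pow_sum, Finset.prod_pow_eq_pow_sum] at hdet
  have hYeval : Y.det.eval 0 ≠ 0 := by
    have h : Y.det.eval 0 = (Y.map (Polynomial.eval 0)).det := by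
      have := RingHom.map_det (Polynomial.evalRingHom (0 : ℂ)) Y
      exact this
    rw [h]
    convert det_inv_factorial_ne_zero hp using 2
    ext k j
    simp only [Matrix.map_apply, Y, Matrix.of_apply, Polynomial.eval_finsetSum]
    rw [Finset.sum_eq_single (p k)]
    · rw [hE1]; split_ifs <;> simp
    · intro m _ hm
      rcases lt_or_gt_of_ne hm with h1 | h1
      · simp [hE0 k m h1]
      · have : m - p k ≠ 0 := by omega
        simp only [Polynomial.eval_mul, Polynomial.eval_pow, Polynomial.eval_X, zero_pow this,
          mul_zero, zero_mul]
    · intro h; exact absurd (Finset.mem_range.mpr (hpN k)) h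
  set c : ℂ := ((∏ j ∈ Finset.Icc 1 N, Nat.doubleFactorial (2 * j - 1) : ℕ) : ℂ) with hc
  have hc0 : c ≠ 0 := by
    rw [hc]; norm_cast
    exact Finset.prod_ne_zero_iff.mpr fun j _ => (Nat.doubleFactorial_pos _).ne'
  have hHC : (H.map Polynomial.C).det = Polynomial.C H.det :=
    (RingHom.map_det (Polynomial.C (R := ℂ)) H).symm
  refine rootMultiplicity_of_X_pow_mul (Y := Polynomial.C (c * H.det) * Y.det) ?_ ?_
  · rw [Polynomial.eval_mul, Polynomial.eval_C]
    exact mul_ne_zero (mul_ne_zero hc0 hH) hYeval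
  · rw [adlerMoser, htheta, Matrix.det_mul, hHC, map_mul]
    linear_combination (-(Polynomial.C c * Polynomial.C H.det)) * hdet

/-! ### Degeneration of the Gram determinants for large internal parameters. -/

/-- The matrix of the rows. -/
def rowMat (N : ℕ) (a : PowerSeries ℂ) : Matrix (Fin N) (Fin (2 * N)) ℂ :=
  Matrix.of fun i m => rowFun a i m

/-- The matrix of `gram`. -/
def gramMat (n : ℕ) (f g : PowerSeries ℂ) : Matrix (Fin n) (Fin n) ℂ :=
  Matrix.of fun i j => gram n f g i j

/-- The coefficient of index 2i+1 of a h is row i of a paired with the coefficients of h. The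
indices below 2N suffice, so this is a finite compression of the Gram matrix. -/
theorem gramDet_mul (N : ℕ) (a f g : PowerSeries ℂ) :
    gramDet N (a * f) (map (starRingEnd ℂ) a * g) =
      (rowMat N a * gramMat (2 * N) f g * (rowMat N a).conjTranspose).det := by
  have hrow : ∀ (a h : PowerSeries ℂ) (i : Fin N), coeff (2 * (i : ℕ) + 1) (a * h) =
      ∑ m : Fin (2 * N), rowMat N a i m * coeff m h := by
    intro a h i
    rw [coeff_mul_eq_sum_range a h (show 2 * (i : ℕ) + 1 < 2 * N by have := i.2; omega),
      ← Fin.sum_univ_eq_sum_range (fun m => (if m ≤ 2 * (i : ℕ) + 1 then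
        coeff (2 * (i : ℕ) + 1 - m) a else 0) * coeff m h)]
    rfl
  have hconj : ∀ (i : Fin N) m, star (rowMat N a i m) = rowMat N (map (starRingEnd ℂ) a) i m := by
    intro i m
    simp only [rowMat, Matrix.of_apply, rowFun]
    split_ifs
    · rw [← starRingEnd_apply, conj_coeff]
    · exact star_zero _
  rw [gramDet]
  congr 1
  ext i j
  simp only [Matrix.of_apply, gram, Matrix.mul_apply, Matrix.conjTranspose_apply, gramMat, hconj,
    mul_assoc, hrow, Finset.mul_sum, Finset.sum_mul]
  rw [Finset.sum_comm]
  refine Finset.sum_congr rfl fun m _ => ?_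
  rw [Finset.sum_comm]
  refine Finset.sum_congr rfl fun m' _ => ?_
  refine Finset.sum_congr rfl fun ν _ => ?_
  ring

/-- The determinant of a Gram matrix at the staircase positions. -/
theorem det_gram_stair (r N₀ : ℕ) : ∃ c : ℝ, 0 < c ∧ ∀ f g : PowerSeries ℂ,
    constantCoeff f = 1 → constantCoeff g = 1 →
    (Matrix.of fun k l : Fin (r + N₀) =>
      gram (2 * (r + N₀)) f g (stair r k) (stair r l)).det = c * gramDet N₀ f g := by
  let d : ℝ := ∏ ν : Fin r, ((2 : ℝ) ^ (ν : ℕ))⁻¹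
  refine ⟨d * d * (((2 : ℝ) ^ r)⁻¹ ^ N₀ * ((2 : ℝ) ^ r)⁻¹ ^ N₀), by positivity, ?_⟩
  intro f g hf hg
  let q := tanhQuot ^ r
  have hq1 : constantCoeff q = 1 := by simp only [q, map_pow, constantCoeff_tanhQuot, one_pow]
  have hqe : IsEven q := IsEven.pow (fun n hn => coeff_tanhQuot_of_odd hn) r
  -- Here u^r = 2^(-r) X^r q with q even. The factor X^r moves the position r+1+2i back to 2i+1, and
  -- q drops out by invariance under even factors.
  have hur : tanhHalf ^ r = X ^ r * (C ((2 : ℂ) ^ r)⁻¹ * q) := by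
    have h2 : C ((2 : ℂ) ^ r)⁻¹ * C ((2 : ℂ) ^ r) = 1 := by
      rw [← map_mul, inv_mul_cancel₀ (pow_ne_zero _ two_ne_zero), map_one]
    have h1 : X ^ r * q = C ((2 : ℂ) ^ r) * tanhHalf ^ r := by
      rw [← mul_pow, X_mul_tanhQuot, mul_pow, map_pow]
    linear_combination (- tanhHalf ^ r) * h2 - (C ((2 : ℂ) ^ r)⁻¹) * h1
  let L : PowerSeries ℂ → Matrix (Fin r) (Fin r) ℂ := fun f =>
    Matrix.of fun k ν => coeff (k : ℕ) (f * tanhHalf ^ (ν : ℕ))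
  let D : PowerSeries ℂ → Matrix (Fin N₀) (Fin r) ℂ := fun f =>
    Matrix.of fun i ν => coeff (r + 1 + 2 * (i : ℕ)) (f * tanhHalf ^ (ν : ℕ))
  let S : Matrix (Fin N₀) (Fin N₀) ℂ := Matrix.of fun i j =>
    gram (2 * N₀) (C ((2 : ℂ) ^ r)⁻¹ * (q * f)) (C ((2 : ℂ) ^ r)⁻¹ * (q * g))
      (2 * i + 1) (2 * j + 1)
  have hL : ∀ f : PowerSeries ℂ, constantCoeff f = 1 → (L f).det = d := by
    intro f hf
    rw [Matrix.det_of_isLowerTriangular]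
    · simp only [L, Matrix.of_apply, coeff_mul_tanhHalf_pow_self, hf, mul_one, d]
      push_cast; rfl
    · intro i j hij
      have : (i : ℕ) < j := by simpa using hij
      exact coeff_mul_tanhHalf_pow_of_lt f (by omega)
  have hS : S.det = ((2 : ℂ) ^ r)⁻¹ ^ N₀ * ((2 : ℂ) ^ r)⁻¹ ^ N₀ * gramDet N₀ f g := by
    have : S.det = gramDet N₀ (C ((2 : ℂ) ^ r)⁻¹ * (q * f)) (C ((2 : ℂ) ^ r)⁻¹ * (q * g)) := rfl
    rw [this, gramDet_C_mul, gramDet_comm, gramDet_C_mul, gramDet_even_mul _ hqe hq1,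
      gramDet_mul_even _ hqe hq1, gramDet_comm]
    ring
  have hsum : ∀ k l, gram (2 * (r + N₀)) f g k l =
      ∑ ν : Fin r, coeff k (f * tanhHalf ^ (ν : ℕ)) * coeff l (g * tanhHalf ^ (ν : ℕ)) +
      ∑ ν ∈ Finset.range (r + 2 * N₀), coeff k (f * tanhHalf ^ (r + ν)) *
        coeff l (g * tanhHalf ^ (r + ν)) := by
    intro k l
    rw [gram, show 2 * (r + N₀) = r + (r + 2 * N₀) by ring, Finset.sum_range_add,
      Fin.sum_univ_eq_sum_range (fun ν => coeff k (f * tanhHalf ^ ν) * coeff l (g * tanhHalf ^ ν))]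
  have hhigh : ∀ (f : PowerSeries ℂ) (i ν : ℕ), coeff (r + 1 + 2 * i) (f * tanhHalf ^ (r + ν))
      = coeff (2 * i + 1) (C ((2 : ℂ) ^ r)⁻¹ * (q * f) * tanhHalf ^ ν) := by
    intro f i ν
    have : f * tanhHalf ^ (r + ν) = X ^ r * (C ((2 : ℂ) ^ r)⁻¹ * (q * f) * tanhHalf ^ ν) := by
      rw [pow_add, hur]; ring
    rw [this, coeff_X_pow_mul', if_pos (by omega)]
    congr 2; omega
  -- The first r staircase rows involve only ν < r, through the triangular matrices `L f` and `L g`.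
  -- The Schur complement `S` consists of the terms with ν ≥ r, which form a Gram matrix of order
  -- N₀.
  have hblock : (Matrix.of fun k l : Fin (r + N₀) =>
      gram (2 * (r + N₀)) f g (stair r k) (stair r l)).submatrix finSumFinEquiv finSumFinEquiv
      = Matrix.fromBlocks (L f) 0 (D f) 1 * (Matrix.fromBlocks 1 0 0 S *
        Matrix.fromBlocks (L g).transpose (D g).transpose 0 1) := by
    rw [Matrix.fromBlocks_multiply, Matrix.fromBlocks_multiply]
    have hs1 : ∀ k : Fin r, stair r (finSumFinEquiv (Sum.inl k : Fin r ⊕ Fin N₀)) = k := by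
      intro k; simp [stair]
    have hs2 : ∀ i : Fin N₀, stair r (finSumFinEquiv (Sum.inr i : Fin r ⊕ Fin N₀))
        = r + 1 + 2 * i := by
      intro k; simp [stair]; omega
    have hlow : ∀ (f : PowerSeries ℂ) (k : Fin r) (ν : ℕ),
        coeff (k : ℕ) (f * tanhHalf ^ (r + ν)) = 0 := fun f k ν =>
      coeff_mul_tanhHalf_pow_of_lt f (by omega)
    ext k l
    rcases k with k | k <;> rcases l with l | l
    · simp only [Matrix.submatrix_apply, Matrix.of_apply, hs1, hsum, hlow]
      simp [Matrix.mul_apply, L]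
    · simp only [Matrix.submatrix_apply, Matrix.of_apply, hs1, hs2, hsum, hlow]
      simp [Matrix.mul_apply, L, D]
    · simp only [Matrix.submatrix_apply, Matrix.of_apply, hs1, hs2, hsum, hlow]
      simp [Matrix.mul_apply, L, D]
    · simp only [Matrix.submatrix_apply, Matrix.of_apply, hs2, hsum, hhigh,
        Matrix.fromBlocks_apply₂₂, Matrix.mul_zero, Matrix.zero_mul, Matrix.mul_one,
        Matrix.one_mul, add_zero, zero_add, Matrix.add_apply, Matrix.mul_apply, D,
        Matrix.transpose_apply, S]
      congr 1
      exact gram_eq_of_lt _ _ _ (by have := k.2; omega) (by omega)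
  rw [← Matrix.det_submatrix_equiv_self finSumFinEquiv, hblock, Matrix.det_mul, Matrix.det_mul,
    Matrix.det_fromBlocks_zero₁₂, Matrix.det_fromBlocks_zero₁₂, Matrix.det_fromBlocks_zero₂₁,
    Matrix.det_transpose, hL f hf, hL g hg, hS, Matrix.det_one, Matrix.det_one]
  push_cast
  ring

/-- In the recursion for the coefficient of index 2i+1, the even entries of the exponent are zero
and the smaller odd ones vanish by induction. Only (2i+1) times the entry of index 2i+1 remains. -/
theorem kappa_eq_zero_of_coeff_eq_zero {N : ℕ} {κ : ℕ → ℂ}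
    (h : ∀ i < N, coeff (2 * i + 1) (expSeries (oddSeq κ)) = 0) (j : ℕ) (hj0 : 1 ≤ j)
    (hj : j < N) : κ j = 0 := by
  have key : ∀ i < N, oddSeq κ (2 * i + 1) = 0 := by
    intro i
    induction i using Nat.strong_induction_on with
    | _ i ih =>
      intro hi
      have h1 := coeff_expSeries_succ (oddSeq κ) (2 * i)
      rw [h i hi, mul_zero, Finset.sum_eq_single (0, 2 * i)] at h1
      · rw [coeff_zero_eq_constantCoeff_apply, constantCoeff_expSeries, one_mul] at h1
        exact (mul_eq_zero.mp h1.symm).resolve_right (Nat.cast_add_one_ne_zero _)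
      · rintro ⟨p, q⟩ hpq hne
        have hpq' : p + q = 2 * i := Finset.HasAntidiagonal.mem_antidiagonal.mp hpq
        have hq : q ≠ 2 * i := by
          rintro rfl; exact hne (by simp; omega)
        simp only
        rcases Nat.even_or_odd q with h2 | h2
        · obtain ⟨l, hl⟩ := h2
          rw [show q + 1 = 2 * l + 1 by omega, ih l (by omega) (by omega)]; ring
        · have : oddSeq κ (q + 1) = 0 := by
            rw [oddSeq, if_neg, if_neg]
            · rw [Nat.not_odd_iff_even]; exact h2.add_one
            · rintro h3
              have : q = 0 := by omega
              simp [this] at h2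
          rw [this]; ring
      · intro hmem; exact absurd (by simp) hmem
  have h1 := key j hj
  rw [oddSeq, if_neg (by omega), if_pos ⟨j, rfl⟩] at h1
  rwa [show (2 * j + 1) / 2 = j by omega] at h1

/-- The degeneration of the determinants of order `N` to those of order `N₀` for large internal
parameters. -/
theorem exists_degeneration (N N₀ : ℕ) (κ : ℕ → ℂ)
    (hκ : ∃ j ∈ Finset.Icc 1 (N - 1), κ j ≠ 0) (hN₀ : 1 ≤ N₀)
    (hroot : (adlerMoser N κ).rootMultiplicity 0 = N₀ * (N₀ + 1) / 2) :
    N₀ < N ∧ ∃ E : ℝ → Matrix (Fin N) (Fin (2 * N)) ℂ,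
      (∀ k m, ∃ (c : ℂ) (n : ℕ), ∀ δ : ℝ, E δ k m = c * (δ : ℂ) ^ n) ∧
      (∀ A : ℝ, A ≠ 0 → ∃ C : ℝ, 0 < C ∧ ∀ f g : PowerSeries ℂ,
        gramDet N (expSeries (oddSeq fun j => κ j * (A : ℂ) ^ (2 * j + 1)) * f)
          (map (starRingEnd ℂ) (expSeries (oddSeq fun j => κ j * (A : ℂ) ^ (2 * j + 1))) * g) =
        C * (E A⁻¹ * gramMat (2 * N) f g * (E A⁻¹).conjTranspose).det) ∧
      ∃ c : ℝ, 0 < c ∧ ∀ f g : PowerSeries ℂ, constantCoeff f = 1 → constantCoeff g = 1 →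
        (E 0 * gramMat (2 * N) f g * (E 0).conjTranspose).det = c * gramDet N₀ f g := by
  classical
  set a := expSeries (oddSeq κ) with ha
  have ha1 : constantCoeff a = 1 := constantCoeff_expSeries _
  obtain ⟨I, w, hcard, hlt, hw, hspan, hpiv⟩ :=
    exists_echelon (rowSpace N a) (2 * N) fun f hf m hm => rowSpace_eq_zero_of_le hf m hm
  rw [finrank_rowSpace N ha1] at hcard
  have hclosed : ∀ m, m + 2 ∈ I → m ∈ I := by
    intro m hm
    obtain ⟨hW, h1, h0⟩ := hw _ hm
    refine hpiv _ (shift_mem_rowSpace hW) m ?_ fun m' hm' => h0 _ (by omega)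
    rw [h1]; exact one_ne_zero
  have hrows : ∀ p : Fin N → ℕ, Function.Injective p → (∀ k, p k ∈ I) →
      ∃ H : Matrix (Fin N) (Fin N) ℂ, H.det ≠ 0 ∧
        ∀ (i : Fin N) m, rowFun a i m = ∑ k, H i k * w (p k) m := by
    intro p hp hpI
    have himg : w '' I = Set.range fun k => w (p k) := by
      have : Finset.univ.image p = I := by
        refine Finset.eq_of_subset_of_card_le (fun m hm => ?_) ?_
        · obtain ⟨k, _, rfl⟩ := Finset.mem_image.mp hm; exact hpI k
        · rw [Finset.card_image_of_injective _ hp, hcard, Finset.card_fin]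
      rw [← this]; ext f; simp
    have hex : ∀ i : Fin N, ∃ c : Fin N → ℂ, ∑ k, c k • w (p k) = rowFun a i := by
      intro i
      have := hspan (rowFun a i) (Submodule.subset_span ⟨i, rfl⟩)
      rw [himg] at this
      exact (Submodule.mem_span_range_iff_exists_fun ℂ).mp this
    choose H hH using hex
    have hH' : ∀ (i : Fin N) m, rowFun a i m = ∑ k, H i k * w (p k) m := by
      intro i m
      rw [← hH i]; simp [Finset.sum_apply]
    refine ⟨Matrix.of H, ?_, hH'⟩
    intro hdet
    have h1 : evenMat N a = Matrix.of H * Matrix.of fun k j : Fin N => w (p k) (2 * j + 1) := by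
      ext i j
      rw [← sum_rowFun_odd, hH', Matrix.mul_apply]; rfl
    have h2 := det_evenMat N ha1
    rw [h1, Matrix.det_mul, hdet, zero_mul] at h2
    exact zero_ne_one h2
  -- The multiplicity formula is applied with the increasing enumeration of I. It determines I,
  -- after which the staircase enumeration is used instead.
  have hsum : 2 * ∑ m ∈ I, (m : ℤ) = N * (N - 1) + N₀ * (N₀ + 1) := by
    let p : Fin N → ℕ := fun k => I.orderEmbOfFin hcard k
    have hpI : ∀ k, p k ∈ I := fun k => Finset.orderEmbOfFin_mem I hcard k
    have hp : Function.Injective p := (I.orderEmbOfFin hcard).injective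
    obtain ⟨H, hH, hrow⟩ := hrows p hp hpI
    have h1 := rootMultiplicity_adlerMoser (E := fun k => w (p k)) hp hH
      (fun k => hlt _ (hpI k)) (fun k => (hw _ (hpI k)).2.1) (fun k => (hw _ (hpI k)).2.2) hrow
    have h2 : ∑ k, p k = ∑ m ∈ I, m := by
      have : Finset.univ.image p = I := by
        refine Finset.eq_of_subset_of_card_le (fun m hm => ?_) ?_
        · obtain ⟨k, _, rfl⟩ := Finset.mem_image.mp hm; exact hpI k
        · rw [Finset.card_image_of_injective _ hp, hcard, Finset.card_fin]
      conv_rhs => rw [← this]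
      rw [Finset.sum_image fun x _ y _ h => hp h]
    rw [hroot, h2, Fin.sum_univ_eq_sum_range (fun j => j) N] at h1
    have h3 := Finset.sum_range_id_mul_two N
    have h4 : N₀ * (N₀ + 1) / 2 * 2 = N₀ * (N₀ + 1) :=
      Nat.div_mul_cancel (Nat.even_mul_succ_self N₀).two_dvd
    have h5 : 2 * ∑ m ∈ I, (m : ℤ) = (∑ i ∈ Finset.range N, i : ℕ) * 2
        + (N₀ * (N₀ + 1) / 2 : ℕ) * 2 := by
      rw [← Nat.cast_sum, ← h1]; push_cast; ring
    have hN1 : 1 ≤ N := by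
      obtain ⟨j, hj, _⟩ := hκ
      simp at hj; omega
    have h6 : ((∑ i ∈ Finset.range N, i : ℕ) : ℤ) * 2 = N * (N - 1) := by
      have := congrArg (Nat.cast (R := ℤ)) h3
      push_cast [Nat.cast_sub hN1] at this ⊢
      exact this
    have h7 : ((N₀ * (N₀ + 1) / 2 : ℕ) : ℤ) * 2 = N₀ * (N₀ + 1) := by exact_mod_cast h4
    rw [h5, h6, h7]
  obtain ⟨hle, hne, hmem⟩ := stair_mem hclosed hcard hsum
  -- If N₀ = N, then 0 is not a leading position, so every row vanishes at 0. The odd coefficients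
  -- of a then vanish up to index 2N-1, which makes all the κ_j zero.
  have hltN : N₀ < N := by
    refine lt_of_le_of_ne hle fun h => ?_
    have h0 := hne h
    have hzero : ∀ f ∈ rowSpace N a, f 0 = 0 := by
      intro f hf
      by_contra hf0
      exact h0 (hpiv f hf 0 hf0 (by simp))
    obtain ⟨j, hj, hκj⟩ := hκ
    simp only [Finset.mem_Icc] at hj
    refine hκj (kappa_eq_zero_of_coeff_eq_zero (N := N) (fun i hi => ?_) j hj.1 (by omega))
    have := hzero (rowFun a i) (Submodule.subset_span ⟨⟨i, hi⟩, rfl⟩)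
    simpa [rowFun] using this
  refine ⟨hltN, ?_⟩
  let p : Fin N → ℕ := fun k => stair (N - N₀) k
  have hp : Function.Injective p := (stair_injective _).comp Fin.val_injective
  have hpI : ∀ k, p k ∈ I := fun k => hmem k k.2
  obtain ⟨H, hH, hrow⟩ := hrows p hp hpI
  -- Below the leading position the truncated exponent is 0, which is harmless because `w (p k) m`
  -- vanishes there. At δ = 0 the convention 0^0 = 1 keeps exactly the leading entry.
  let E : ℝ → Matrix (Fin N) (Fin (2 * N)) ℂ := fun δ =>
    Matrix.of fun k m => w (p k) m * (δ : ℂ) ^ ((m : ℕ) - p k)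
  refine ⟨E, fun k m => ⟨_, _, fun δ => rfl⟩, ?_, ?_⟩
  · intro A hA
    have hA' : (A : ℂ) ≠ 0 := by exact_mod_cast hA
    -- The coefficient of index n of the rescaled exponential is A^n times the original one. The
    -- powers of A that depend on the row or on the leading position are collected in Γ; it enters
    -- the determinant only through |det Γ|² > 0.
    let Γ : Matrix (Fin N) (Fin N) ℂ := Matrix.of fun i k =>
      (A : ℂ) ^ (2 * (i : ℕ) + 1) * (((A : ℂ) ^ p k)⁻¹ * H i k)
    have hΓ : Γ.det ≠ 0 := by
      have : Γ = Matrix.diagonal (fun i : Fin N => (A : ℂ) ^ (2 * (i : ℕ) + 1)) * H *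
          Matrix.diagonal (fun k => ((A : ℂ) ^ p k)⁻¹) := by
        ext i k
        rw [Matrix.mul_diagonal, Matrix.diagonal_mul]
        simp only [Γ, Matrix.of_apply]; ring
      rw [this, Matrix.det_mul, Matrix.det_mul, Matrix.det_diagonal, Matrix.det_diagonal]
      refine mul_ne_zero (mul_ne_zero ?_ hH) ?_
      · exact Finset.prod_ne_zero_iff.mpr fun i _ => pow_ne_zero _ hA'
      · exact Finset.prod_ne_zero_iff.mpr fun i _ => inv_ne_zero (pow_ne_zero _ hA')
    set aA := expSeries (oddSeq fun j => κ j * (A : ℂ) ^ (2 * j + 1)) with haA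
    have hcoef : ∀ n, coeff n aA = (A : ℂ) ^ n * coeff n a := by
      intro n
      rw [ha, ← coeff_expSeries_rescale, haA]
      congr 2
      ext i
      simp only [oddSeq]
      split_ifs with h1 h2
      · simp
      · obtain ⟨l, rfl⟩ := h2
        rw [show (2 * l + 1) / 2 = l by omega, mul_comm]
      · simp
    have hrowA : rowMat N aA = Γ * E A⁻¹ := by
      ext i m
      simp only [rowMat, Matrix.of_apply, Matrix.mul_apply, Γ, E]
      have h1 : rowFun aA i m * (A : ℂ) ^ (m : ℕ) = (A : ℂ) ^ (2 * (i : ℕ) + 1) * rowFun a i m := by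
        simp only [rowFun]
        split_ifs with h
        · rw [hcoef, ← Nat.sub_add_cancel h, pow_add]
          simp only [Nat.add_sub_cancel]
          ring
        · simp
      have h2 : (A : ℂ) ^ (m : ℕ) ≠ 0 := pow_ne_zero _ hA'
      refine mul_right_cancel₀ h2 ?_
      rw [h1, hrow, Finset.mul_sum, Finset.sum_mul]
      refine Finset.sum_congr rfl fun k _ => ?_
      by_cases hm : (m : ℕ) < p k
      · rw [(hw _ (hpI k)).2.2 _ hm]; ring
      · obtain ⟨d, hd⟩ := Nat.exists_eq_add_of_le (not_lt.mp hm)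
        rw [hd, Nat.add_sub_cancel_left]
        push_cast
        rw [pow_add, inv_pow]
        have h3 : (A : ℂ) ^ p k ≠ 0 := pow_ne_zero _ hA'
        have h4 : (A : ℂ) ^ d ≠ 0 := pow_ne_zero _ hA'
        field_simp
        ring
    refine ⟨Complex.normSq Γ.det, Complex.normSq_pos.mpr hΓ, fun f g => ?_⟩
    rw [gramDet_mul, hrowA, Matrix.conjTranspose_mul]
    have : Γ * E A⁻¹ * gramMat (2 * N) f g * ((E A⁻¹).conjTranspose * Γ.conjTranspose)
        = Γ * (E A⁻¹ * gramMat (2 * N) f g * (E A⁻¹).conjTranspose) * Γ.conjTranspose := by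
      simp only [Matrix.mul_assoc]
    rw [this, Matrix.det_mul, Matrix.det_mul, Matrix.det_conjTranspose,
      Complex.normSq_eq_conj_mul_self, ← starRingEnd_apply]
    ring
  · obtain ⟨c, hc, hdet⟩ := det_gram_stair (N - N₀) N₀
    refine ⟨c, hc, fun f g hf hg => ?_⟩
    obtain ⟨r, rfl⟩ := Nat.exists_eq_add_of_le' hle
    rw [Nat.add_sub_cancel] at hdet
    rw [← hdet f g hf hg]
    congr 1
    have hE0 : ∀ k m, E 0 k m = if (m : ℕ) = p k then 1 else 0 := by
      intro k m
      simp only [E, Matrix.of_apply]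
      rcases lt_trichotomy (m : ℕ) (p k) with h | h | h
      · rw [(hw _ (hpI k)).2.2 _ h, if_neg h.ne, zero_mul]
      · rw [if_pos h, h, (hw _ (hpI k)).2.1]; simp
      · rw [if_neg h.ne']
        have : (m : ℕ) - p k ≠ 0 := by omega
        simp [this]
    ext k l
    have hpk : ∀ k, p k < 2 * (r + N₀) := fun k => hlt _ (hpI k)
    have hpr : ∀ k, p k = stair r k := fun k => by simp only [p, Nat.add_sub_cancel]
    simp only [Matrix.mul_apply, Matrix.conjTranspose_apply, hE0, gramMat, Matrix.of_apply]
    rw [Finset.sum_eq_single ⟨p l, hpk l⟩]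
    · rw [Finset.sum_eq_single ⟨p k, hpk k⟩]
      · simp [hpr]
      · intro m _ hm
        rw [if_neg fun h => hm (Fin.ext h), zero_mul]
      · simp
    · intro m _ hm
      rw [if_neg fun h => hm (Fin.ext h), star_zero, mul_zero]
    · simp

end

section

open PowerSeries Filter Topology

/-! ### Behaviour at infinity -/

theorem tendsto_matrix_iff {ι m n : Type*} {l : Filter ι} {B : ι → Matrix m n ℂ}
    {T : Matrix m n ℂ} :
    Tendsto B l (𝓝 T) ↔ ∀ i j, Tendsto (fun t => B t i j) l (𝓝 (T i j)) := by
  refine ⟨fun h i j => tendsto_pi_nhds.mp (tendsto_pi_nhds.mp h i) j, fun h => ?_⟩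
  exact tendsto_pi_nhds.mpr fun i => tendsto_pi_nhds.mpr fun j => h i j

theorem tendsto_matrix_inv {ι : Type*} {l : Filter ι} {n : ℕ}
    {B : ι → Matrix (Fin n) (Fin n) ℂ} {T : Matrix (Fin n) (Fin n) ℂ} (hB : Tendsto B l (𝓝 T))
    (hT : T.det ≠ 0) : Tendsto (fun t => (B t)⁻¹) l (𝓝 T⁻¹) := by
  have h1 : Tendsto (fun t => (B t).det) l (𝓝 T.det) :=
    ((continuous_id.matrix_det).tendsto T).comp hB
  have h2 : Tendsto (fun t => (B t).adjugate) l (𝓝 T.adjugate) :=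
    ((continuous_id.matrix_adjugate).tendsto T).comp hB
  simp only [Matrix.inv_def, Ring.inverse_eq_inv']
  exact (h1.inv₀ hT).smul h2

theorem tendsto_matrix_mul {ι : Type*} {l : Filter ι} {n : ℕ}
    {F G : ι → Matrix (Fin n) (Fin n) ℂ} {F₀ G₀ : Matrix (Fin n) (Fin n) ℂ}
    (hF : Tendsto F l (𝓝 F₀)) (hG : Tendsto G l (𝓝 G₀)) :
    Tendsto (fun t => F t * G t) l (𝓝 (F₀ * G₀)) := by
  rw [tendsto_matrix_iff] at hF hG ⊢
  intro i j
  simp only [Matrix.mul_apply]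
  exact tendsto_finsetSum _ fun k _ => (hF i k).mul (hG k j)

theorem tendsto_matrix_det {ι : Type*} {l : Filter ι} {n : ℕ}
    {F : ι → Matrix (Fin n) (Fin n) ℂ} {F₀ : Matrix (Fin n) (Fin n) ℂ}
    (hF : Tendsto F l (𝓝 F₀)) : Tendsto (fun t => (F t).det) l (𝓝 F₀.det) :=
  ((continuous_id.matrix_det).tendsto F₀).comp hF

/-- The quotient of the second summand by the diagonal part of the first one in
`tendsto_det_mul_diagonal`. -/
def tailMat {n : ℕ} (U U' : Matrix (Fin n) (Fin n) ℂ) (w : ℝ) : Matrix (Fin n) (Fin n) ℂ :=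
  Matrix.of fun ν ν' => ∑ μ : Fin n, U ν μ * U' ν' μ *
    ((w : ℂ) ^ (2 * (n + (μ : ℕ)) - 2 * (ν : ℕ)))⁻¹

theorem tendsto_tailMat {ι : Type*} {l : Filter ι} {n : ℕ}
    {U U' : ι → Matrix (Fin n) (Fin n) ℂ} {V V' : Matrix (Fin n) (Fin n) ℂ}
    {w : ι → ℝ} (hw : Tendsto w l atTop) (hU : Tendsto U l (𝓝 V)) (hU' : Tendsto U' l (𝓝 V')) :
    Tendsto (fun t => tailMat (U t) (U' t) (w t)) l (𝓝 0) := by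
  rw [tendsto_matrix_iff]; intro ν ν'
  have h0 : (0 : Matrix (Fin n) (Fin n) ℂ) ν ν' = ∑ μ : Fin n, V ν μ * V' ν' μ * 0 := by simp
  rw [h0]
  refine tendsto_finsetSum _ fun μ _ => ((Tendsto.mul ?_ ?_).mul ?_)
  · exact tendsto_matrix_iff.mp hU ν μ
  · exact tendsto_matrix_iff.mp hU' ν' μ
  · have h1 : Tendsto (fun t => (w t ^ (2 * (n + (μ : ℕ)) - 2 * (ν : ℕ)))⁻¹) l (𝓝 0) :=
      ((tendsto_pow_atTop (by have := ν.2; omega)).comp hw).inv_tendsto_atTop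
    have h2 := (Complex.continuous_ofReal.tendsto 0).comp h1
    simpa [Function.comp_def] using h2

/-- With R = B U and R' = B' U', the second summand is absorbed into the first as a perturbation of
the identity. Every exponent in `tailMat` is positive because n + μ > ν. -/
theorem det_mul_diagonal_add {n : ℕ} {B B' : Matrix (Fin n) (Fin n) ℂ}
    (R R' : Matrix (Fin n) (Fin n) ℂ) {w : ℝ} (hB : B.det ≠ 0) (hB' : B'.det ≠ 0) (hw : w ≠ 0) :
    (B * Matrix.diagonal (fun ν : Fin n => ((w : ℂ) ^ (2 * (ν : ℕ)))⁻¹) * B'.transpose +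
      R * Matrix.diagonal (fun ν : Fin n => ((w : ℂ) ^ (2 * (n + (ν : ℕ))))⁻¹) *
        R'.transpose).det =
      B.det * (1 + tailMat (B⁻¹ * R) (B'⁻¹ * R') w).det * B'.det *
        ∏ ν : Fin n, ((w : ℂ) ^ (2 * (ν : ℕ)))⁻¹ := by
  have hw0 : (w : ℂ) ≠ 0 := by exact_mod_cast hw
  have hu : IsUnit B.det := isUnit_iff_ne_zero.mpr hB
  have hu' : IsUnit B'.det := isUnit_iff_ne_zero.mpr hB'
  set D1 := Matrix.diagonal (fun ν : Fin n => ((w : ℂ) ^ (2 * (ν : ℕ)))⁻¹) with hD1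
  set D2 := Matrix.diagonal (fun ν : Fin n => ((w : ℂ) ^ (2 * (n + (ν : ℕ))))⁻¹) with hD2
  set U := B⁻¹ * R with hU
  set U' := B'⁻¹ * R' with hU'
  have hfac : D1 * tailMat U U' w = U * (D2 * U'.transpose) := by
    ext ν ν'
    rw [hD1, Matrix.diagonal_mul, Matrix.mul_apply]
    simp only [tailMat, Matrix.of_apply, Finset.mul_sum, hD2, Matrix.diagonal_mul,
      Matrix.transpose_apply]
    refine Finset.sum_congr rfl fun μ _ => ?_
    have hp : (w : ℂ) ^ (2 * (n + (μ : ℕ))) =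
        (w : ℂ) ^ (2 * (ν : ℕ)) * (w : ℂ) ^ (2 * (n + (μ : ℕ)) - 2 * (ν : ℕ)) := by
      rw [← pow_add]; congr 1; have := ν.2; omega
    rw [hp, mul_inv]
    ring
  have e1 : R = B * U := by
    rw [hU, ← Matrix.mul_assoc, Matrix.mul_nonsing_inv _ hu, Matrix.one_mul]
  have e2 : R' = B' * U' := by
    rw [hU', ← Matrix.mul_assoc, Matrix.mul_nonsing_inv _ hu', Matrix.one_mul]
  have hM : B * D1 * B'.transpose + R * D2 * R'.transpose
      = B * (D1 * (1 + tailMat U U' w)) * B'.transpose := by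
    rw [e1, e2, Matrix.mul_add, hfac, Matrix.mul_one, Matrix.mul_add, Matrix.add_mul,
      Matrix.transpose_mul]
    simp only [Matrix.mul_assoc]
  have hD1det : D1.det = ∏ ν : Fin n, ((w : ℂ) ^ (2 * (ν : ℕ)))⁻¹ := Matrix.det_diagonal
  rw [hM, ← hD1det, Matrix.det_mul, Matrix.det_mul, Matrix.det_mul, Matrix.det_transpose]
  ring

theorem tendsto_det_mul_diagonal {ι : Type*} {l : Filter ι} {n : ℕ}
    {B B' R R' : ι → Matrix (Fin n) (Fin n) ℂ} {T S S' : Matrix (Fin n) (Fin n) ℂ}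
    {w : ι → ℝ} (hw : Tendsto w l atTop) (hT : T.det ≠ 0) (hB : Tendsto B l (𝓝 T))
    (hB' : Tendsto B' l (𝓝 T)) (hR : Tendsto R l (𝓝 S)) (hR' : Tendsto R' l (𝓝 S')) :
    Tendsto (fun t => (B t * Matrix.diagonal (fun ν : Fin n => ((w t : ℂ) ^ (2 * (ν : ℕ)))⁻¹) *
        (B' t).transpose +
      R t * Matrix.diagonal (fun ν : Fin n => ((w t : ℂ) ^ (2 * (n + (ν : ℕ))))⁻¹) *
        (R' t).transpose).det / ∏ ν : Fin n, ((w t : ℂ) ^ (2 * (ν : ℕ)))⁻¹) l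
      (𝓝 (T.det * T.det)) := by
  have hdet := tendsto_matrix_det hB
  have hdet' := tendsto_matrix_det hB'
  have hY := tendsto_tailMat hw (tendsto_matrix_mul (tendsto_matrix_inv hB hT) hR)
    (tendsto_matrix_mul (tendsto_matrix_inv hB' hT) hR')
  have hYdet := tendsto_matrix_det (tendsto_const_nhds (x := (1 : Matrix (Fin n) (Fin n) ℂ)).add hY)
  have hlim := (hdet.mul hYdet).mul hdet'
  rw [add_zero, Matrix.det_one, mul_one] at hlim
  refine hlim.congr' ?_
  filter_upwards [hdet.eventually_ne hT, hdet'.eventually_ne hT, hw.eventually_gt_atTop 0]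
    with t h1 h2 h3
  have hw0 : (w t : ℂ) ≠ 0 := by exact_mod_cast h3.ne'
  rw [det_mul_diagonal_add _ _ h1 h2 h3.ne', mul_div_cancel_right₀]
  exact Finset.prod_ne_zero_iff.mpr fun ν _ => inv_ne_zero (pow_ne_zero _ hw0)

/-- The sequence `1, 0, 0, …` (starting at index `1`). -/
def unitSeq (i : ℕ) : ℂ := if i = 1 then 1 else 0

theorem coeff_expSeries_unitSeq (n : ℕ) :
    coeff n (expSeries unitSeq) = ((n.factorial : ℝ)⁻¹ : ℝ) := by
  have : PowerSeries.exp ℂ = expSeries unitSeq := by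
    refine eq_expSeries (by simp) ?_
    rw [derivative_exp]
    conv_lhs => rw [← mul_one (PowerSeries.exp ℂ)]
    congr 1
    ext1 n
    rw [coeff_derivative, seqSeries, coeff_mk, coeff_one]
    by_cases hn : n = 0
    · simp [hn, unitSeq]
    · simp [hn, unitSeq]
  rw [← this, coeff_exp]
  simp

/-- The limits of the scaled coefficients. -/
def limCoeff (m ν : ℕ) : ℝ := if ν ≤ m then (2 ^ ν)⁻¹ * ((m - ν).factorial : ℝ)⁻¹ else 0

/-- Weighted homogeneity: scaling x_i by w^(-i) scales the coefficient of index n by w^(-n). In the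
limit only x_1 survives, and the exponential becomes e^λ with coefficients 1/n!. -/
theorem tendsto_coeff_mul_tanhHalf_pow {ι : Type*} {l : Filter ι} {w : ι → ℂ} {x : ι → ℕ → ℂ}
    (hw : Tendsto (fun t => ‖w t‖) l atTop)
    (hx : ∀ i, Tendsto (fun t => x t i / w t ^ i) l (𝓝 (unitSeq i))) (m ν : ℕ) :
    Tendsto (fun t => coeff m (expSeries (x t) * tanhHalf ^ ν) / w t ^ m * w t ^ ν) l
      (𝓝 (limCoeff m ν)) := by
  have hw0 : ∀ᶠ t in l, w t ≠ 0 := by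
    filter_upwards [hw.eventually_gt_atTop 0] with t ht
    exact norm_pos_iff.mp ht
  have hs0 : sCoeff 0 = 0 := by
    rw [sCoeff, coeff_zero_eq_constantCoeff_apply, constantCoeff_logOf constantCoeff_tanhQuot]
  by_cases hν : ν ≤ m
  · have h1 : Tendsto (fun t => fun i => (w t)⁻¹ ^ i * (x t i + ν * sCoeff i)) l (𝓝 unitSeq) := by
      rw [tendsto_pi_nhds]
      intro i
      have h2 : Tendsto (fun t => (w t)⁻¹ ^ i * (ν * sCoeff i)) l (𝓝 0) := by
        rcases Nat.eq_zero_or_pos i with rfl | hi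
        · simpa [hs0] using tendsto_const_nhds
        · have h3 : Tendsto (fun t => (w t)⁻¹) l (𝓝 0) :=
            tendsto_inv₀_cobounded.comp (tendsto_norm_atTop_iff_cobounded.mp hw)
          have := (h3.pow i).mul_const (ν * sCoeff i)
          simpa [zero_pow hi.ne'] using this
      have h4 := (hx i).add h2
      rw [add_zero] at h4
      refine h4.congr fun t => ?_
      rw [mul_add, div_eq_mul_inv, inv_pow, mul_comm (x t i)]
    have h5 := (((continuous_coeff_expSeries (m - ν)).tendsto unitSeq).comp h1).const_mul
      ((2 : ℂ) ^ ν)⁻¹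
    have h6 : ((2 : ℂ) ^ ν)⁻¹ * coeff (m - ν) (expSeries unitSeq) = limCoeff m ν := by
      rw [limCoeff, if_pos hν, coeff_expSeries_unitSeq]; push_cast; rfl
    rw [h6] at h5
    refine h5.congr' ?_
    filter_upwards [hw0] with t ht
    have h7 := coeff_mul_tanhHalf_pow (expSeries (x t)) m ν
    rw [if_pos hν, ← expSeries_add_sCoeff] at h7
    simp only [Function.comp_apply]
    rw [coeff_expSeries_rescale, ← h7]
    have h8 : w t ^ m = w t ^ (m - ν) * w t ^ ν := by rw [← pow_add, Nat.sub_add_cancel hν]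
    have h9 : w t ^ (m - ν) ≠ 0 := pow_ne_zero _ ht
    have h10 : w t ^ ν ≠ 0 := pow_ne_zero _ ht
    have h11 : (2 : ℂ) ^ ν ≠ 0 := pow_ne_zero _ two_ne_zero
    rw [h8, inv_pow]
    field_simp
  · rw [limCoeff, if_neg hν]
    simp only [coeff_mul_tanhHalf_pow_of_lt _ (not_le.mp hν), zero_div, zero_mul]
    exact tendsto_const_nhds

/-- After scaling rows and columns by powers of w and its conjugate, the term of index ν carries
|w|^(-2ν). The terms with ν < N dominate and the limit is (det T)² with T real and invertible. The
normalization ρ is positive, so the limit also controls the argument. -/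
theorem exists_tendsto_gramDet {ι : Type*} {l : Filter ι} (N : ℕ) {w : ι → ℂ} {x y : ι → ℕ → ℂ}
    (hw : Tendsto (fun t => ‖w t‖) l atTop)
    (hx : ∀ i, Tendsto (fun t => x t i / w t ^ i) l (𝓝 (unitSeq i)))
    (hy : ∀ i, Tendsto (fun t => y t i / (starRingEnd ℂ) (w t) ^ i) l (𝓝 (unitSeq i))) :
    ∃ c : ℝ, 0 < c ∧ ∃ ρ : ι → ℝ, (∀ᶠ t in l, 0 < ρ t) ∧
      Tendsto (fun t => gramDet N (expSeries (x t)) (expSeries (y t)) / ρ t) l (𝓝 c) := by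
  let Tr : Matrix (Fin N) (Fin N) ℝ := Matrix.of fun i ν => limCoeff (2 * i + 1) ν
  let T : Matrix (Fin N) (Fin N) ℂ := Tr.map Complex.ofReal
  let S : Matrix (Fin N) (Fin N) ℂ := Matrix.of fun i ν => (limCoeff (2 * i + 1) (N + ν) : ℂ)
  have hTdet : T.det = (Tr.det : ℂ) := (RingHom.map_det Complex.ofRealHom Tr).symm
  have hT : T.det ≠ 0 := by
    have h1 : T = (Matrix.of fun k j : Fin N => if (j : ℕ) ≤ 2 * (k : ℕ) + 1 then
        (((2 * (k : ℕ) + 1 - (j : ℕ)).factorial : ℂ)⁻¹) else 0) *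
          Matrix.diagonal fun j : Fin N => ((2 : ℂ) ^ (j : ℕ))⁻¹ := by
      ext i ν
      rw [Matrix.mul_diagonal]
      simp only [T, Tr, Matrix.map_apply, Matrix.of_apply, limCoeff]
      split_ifs
      · push_cast; ring
      · simp
    rw [h1, Matrix.det_mul, Matrix.det_diagonal]
    refine mul_ne_zero (det_inv_factorial_ne_zero fun i j h => ?_)
      (Finset.prod_ne_zero_iff.mpr fun ν _ => inv_ne_zero (pow_ne_zero _ two_ne_zero))
    ext; simpa using h
  let Q : (ι → ℂ) → (ι → ℕ → ℂ) → ℕ → ι → Matrix (Fin N) (Fin N) ℂ := fun w x s t =>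
    Matrix.of fun i ν => coeff (2 * (i : ℕ) + 1) (expSeries (x t) * tanhHalf ^ (s + (ν : ℕ))) /
      w t ^ (2 * (i : ℕ) + 1) * w t ^ (s + (ν : ℕ))
  let w' : ι → ℂ := fun t => (starRingEnd ℂ) (w t)
  have hw' : Tendsto (fun t => ‖w' t‖) l atTop := by simpa [w'] using hw
  have hQT : ∀ {w : ι → ℂ} {x : ι → ℕ → ℂ}, Tendsto (fun t => ‖w t‖) l atTop →
      (∀ i, Tendsto (fun t => x t i / w t ^ i) l (𝓝 (unitSeq i))) →
      Tendsto (Q w x 0) l (𝓝 T) ∧ Tendsto (Q w x N) l (𝓝 S) := by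
    intro w x hw hx
    constructor
    · rw [tendsto_matrix_iff]; intro i ν
      simp only [Q, Matrix.of_apply, T, Tr, Matrix.map_apply, zero_add]
      exact tendsto_coeff_mul_tanhHalf_pow hw hx _ _
    · rw [tendsto_matrix_iff]; intro i ν
      exact tendsto_coeff_mul_tanhHalf_pow hw hx _ _
  have hlim := tendsto_det_mul_diagonal hw hT (hQT hw hx).1 (hQT hw' hy).1 (hQT hw hx).2
    (hQT hw' hy).2
  have hTr : Tr.det ≠ 0 := by
    intro h; rw [hTdet, h] at hT; exact hT (by simp)
  refine ⟨Tr.det * Tr.det, mul_self_pos.mpr hTr,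
    fun t => (∏ i : Fin N, (‖w t‖ ^ 2) ^ (2 * (i : ℕ) + 1)) *
      ∏ ν : Fin N, (‖w t‖ ^ (2 * (ν : ℕ)))⁻¹, ?_, ?_⟩
  · filter_upwards [hw.eventually_gt_atTop 0] with t ht
    refine mul_pos (Finset.prod_pos fun i _ => by positivity)
      (Finset.prod_pos fun i _ => by positivity)
  · rw [hTdet] at hlim
    push_cast
    refine hlim.congr' ?_
    filter_upwards [hw.eventually_gt_atTop 0] with t ht
    have ht0 : w t ≠ 0 := norm_pos_iff.mp ht
    have ht0' : w' t ≠ 0 := by simpa [w'] using ht0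
    have hnn : ((‖w t‖ : ℝ) : ℂ) ^ 2 = w t * w' t := by
      simp only [w']
      rw [Complex.mul_conj, Complex.normSq_eq_norm_sq]; push_cast; rfl
    set M := Q w x 0 t * Matrix.diagonal (fun ν : Fin N => ((‖w t‖ : ℂ) ^ (2 * (ν : ℕ)))⁻¹) *
        (Q w' y 0 t).transpose +
      Q w x N t * Matrix.diagonal (fun ν : Fin N => ((‖w t‖ : ℂ) ^ (2 * (N + (ν : ℕ))))⁻¹) *
        (Q w' y N t).transpose with hM
    have hG : gramDet N (expSeries (x t)) (expSeries (y t)) =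
        (∏ i : Fin N, ((‖w t‖ : ℂ) ^ 2) ^ (2 * (i : ℕ) + 1)) * M.det := by
      have h1 : (Matrix.of fun i j : Fin N =>
          gram (2 * N) (expSeries (x t)) (expSeries (y t)) (2 * i + 1) (2 * j + 1)) =
          Matrix.diagonal (fun i : Fin N => w t ^ (2 * (i : ℕ) + 1)) * M *
          Matrix.diagonal (fun i : Fin N => w' t ^ (2 * (i : ℕ) + 1)) := by
        ext i j
        rw [Matrix.mul_diagonal, Matrix.diagonal_mul, Matrix.of_apply, gram, two_mul,
          Finset.sum_range_add, hM, Matrix.add_apply, Matrix.mul_apply, Matrix.mul_apply]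
        simp only [Matrix.mul_diagonal, Matrix.transpose_apply, Q, Matrix.of_apply, zero_add]
        have hterm : ∀ s, coeff (2 * (i : ℕ) + 1) (expSeries (x t) * tanhHalf ^ s) *
            coeff (2 * (j : ℕ) + 1) (expSeries (y t) * tanhHalf ^ s) =
            w t ^ (2 * (i : ℕ) + 1) * (coeff (2 * (i : ℕ) + 1) (expSeries (x t) * tanhHalf ^ s) /
              w t ^ (2 * (i : ℕ) + 1) * w t ^ s * ((‖w t‖ : ℂ) ^ (2 * s))⁻¹ *
            (coeff (2 * (j : ℕ) + 1) (expSeries (y t) * tanhHalf ^ s) /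
              w' t ^ (2 * (j : ℕ) + 1) * w' t ^ s)) * w' t ^ (2 * (j : ℕ) + 1) := by
          intro s
          rw [pow_mul, hnn, mul_pow]
          have e1 := pow_ne_zero (2 * (i : ℕ) + 1) ht0
          have e2 := pow_ne_zero (2 * (j : ℕ) + 1) ht0'
          have e3 := pow_ne_zero s ht0
          have e4 := pow_ne_zero s ht0'
          field_simp
        rw [← Fin.sum_univ_eq_sum_range (fun ν => coeff (2 * (i : ℕ) + 1)
            (expSeries (x t) * tanhHalf ^ ν) *
            coeff (2 * (j : ℕ) + 1) (expSeries (y t) * tanhHalf ^ ν)),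
          ← Fin.sum_univ_eq_sum_range (fun ν => coeff (2 * (i : ℕ) + 1)
            (expSeries (x t) * tanhHalf ^ (N + ν)) *
            coeff (2 * (j : ℕ) + 1) (expSeries (y t) * tanhHalf ^ (N + ν)))]
        rw [mul_add, add_mul, Finset.mul_sum, Finset.mul_sum, Finset.sum_mul, Finset.sum_mul]
        congr 1 <;> exact Finset.sum_congr rfl fun ν _ => hterm _
      rw [gramDet, h1, Matrix.det_mul, Matrix.det_mul, Matrix.det_diagonal, Matrix.det_diagonal]
      simp only [hnn, mul_pow, Finset.prod_mul_distrib]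
      ring
    have hP : (∏ i : Fin N, ((‖w t‖ : ℂ) ^ 2) ^ (2 * (i : ℕ) + 1)) ≠ 0 := by
      refine Finset.prod_ne_zero_iff.mpr fun i _ => pow_ne_zero _ (pow_ne_zero _ ?_)
      exact_mod_cast ht.ne'
    rw [hG, mul_div_mul_left _ _ hP]

theorem eventually_gramDet_mem_slitPlane {ι : Type*} {l : Filter ι} (N : ℕ) {w : ι → ℂ}
    {x y : ι → ℕ → ℂ} (hw : Tendsto (fun t => ‖w t‖) l atTop)
    (hx : ∀ i, Tendsto (fun t => x t i / w t ^ i) l (𝓝 (unitSeq i)))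
    (hy : ∀ i, Tendsto (fun t => y t i / (starRingEnd ℂ) (w t) ^ i) l (𝓝 (unitSeq i))) :
    (∀ᶠ t in l, gramDet N (expSeries (x t)) (expSeries (y t)) ∈ Complex.slitPlane) ∧
      Tendsto (fun t => (gramDet N (expSeries (x t)) (expSeries (y t))).arg) l (𝓝 0) := by
  obtain ⟨c, hc, ρ, hρ, hlim⟩ := exists_tendsto_gramDet N hw hx hy
  have hcs : (c : ℂ) ∈ Complex.slitPlane := Complex.ofReal_mem_slitPlane.mpr hc
  have harg : ∀ᶠ t in l, (gramDet N (expSeries (x t)) (expSeries (y t)) / ρ t).arg =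
      (gramDet N (expSeries (x t)) (expSeries (y t))).arg := by
    filter_upwards [hρ] with t ht
    rw [div_eq_mul_inv, ← Complex.ofReal_inv, mul_comm, Complex.arg_real_mul _ (inv_pos.mpr ht)]
  constructor
  · filter_upwards [hlim.eventually (Complex.isOpen_slitPlane.mem_nhds hcs), hρ, harg]
      with t h1 h2 h3
    replace h1 := Complex.mem_slitPlane_iff_arg.mp h1
    rw [Complex.mem_slitPlane_iff_arg]
    rw [h3] at h1
    exact ⟨h1.1, fun h => h1.2 (by rw [h, zero_div])⟩
  · have h := (Complex.continuousAt_arg hcs).tendsto.comp hlim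
    rw [Complex.arg_ofReal_of_nonneg hc.le] at h
    exact h.congr' harg

end

section

open PowerSeries Filter Topology Asymptotics

/-! ### Approximation with an error of given order -/

/-- `f₀` is bounded along `l`, and `f - f₀` is of order `ε`. -/
structure Approx {ι : Type*} (l : Filter ι) (ε : ι → ℝ) (f f₀ : ι → ℂ) : Prop where
  bounded : f₀ =O[l] fun _ => (1 : ℝ)
  error : (fun t => f t - f₀ t) =O[l] ε

section Approx

variable {ι : Type*} {l : Filter ι} {ε : ι → ℝ} {f f₀ g g₀ : ι → ℂ}

theorem Approx.refl (h : f₀ =O[l] fun _ => (1 : ℝ)) : Approx l ε f₀ f₀ :=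
  ⟨h, by simpa using isBigO_zero _ _⟩

theorem Approx.mul (hε : Tendsto ε l (𝓝 0)) (hf : Approx l ε f f₀) (hg : Approx l ε g g₀) :
    Approx l ε (fun t => f t * g t) fun t => f₀ t * g₀ t := by
  have hε1 : ε =O[l] fun _ => (1 : ℝ) := hε.isBigO_one ℝ
  refine ⟨by simpa using hf.bounded.mul hg.bounded, ?_⟩
  have h1 : (fun t => (f t - f₀ t) * (g t - g₀ t)) =O[l] ε := by
    simpa using hf.error.mul (hg.error.trans hε1)
  have h2 : (fun t => f₀ t * (g t - g₀ t)) =O[l] ε := by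
    simpa using hf.bounded.mul hg.error
  have h3 : (fun t => (f t - f₀ t) * g₀ t) =O[l] ε := by
    simpa using hf.error.mul hg.bounded
  refine ((h1.add h2).add h3).congr_left fun t => ?_
  ring

theorem Approx.sum {κ : Type*} (s : Finset κ) {f f₀ : κ → ι → ℂ}
    (h : ∀ k ∈ s, Approx l ε (f k) (f₀ k)) :
    Approx l ε (fun t => ∑ k ∈ s, f k t) fun t => ∑ k ∈ s, f₀ k t := by
  refine ⟨IsBigO.fun_sum fun k hk => (h k hk).bounded, ?_⟩
  refine (IsBigO.fun_sum fun k hk => (h k hk).error).congr_left fun t => ?_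
  rw [Finset.sum_sub_distrib]

theorem Approx.prod (hε : Tendsto ε l (𝓝 0)) {κ : Type*} (s : Finset κ) {f f₀ : κ → ι → ℂ}
    (h : ∀ k ∈ s, Approx l ε (f k) (f₀ k)) :
    Approx l ε (fun t => ∏ k ∈ s, f k t) fun t => ∏ k ∈ s, f₀ k t := by
  classical
  induction s using Finset.induction_on with
  | empty => simpa using Approx.refl (ε := ε) (f₀ := fun _ : ι => (1 : ℂ)) (isBigO_const_const _ one_ne_zero _)
  | insert k s hk ih =>
    simp only [Finset.prod_insert hk]
    exact (h k (Finset.mem_insert_self _ _)).mul hε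
      (ih fun k' hk' => h k' (Finset.mem_insert_of_mem hk'))

theorem Approx.const_mul (hf : Approx l ε f f₀) (c : ℂ) :
    Approx l ε (fun t => c * f t) fun t => c * f₀ t := by
  refine ⟨hf.bounded.const_mul_left c, ?_⟩
  refine (hf.error.const_mul_left c).congr_left fun t => ?_
  ring

theorem Approx.conj (hf : Approx l ε f f₀) :
    Approx l ε (fun t => (starRingEnd ℂ) (f t)) fun t => (starRingEnd ℂ) (f₀ t) := by
  refine ⟨?_, ?_⟩
  · exact (hf.bounded.norm_left.congr_left (f₂ := fun t => ‖(starRingEnd ℂ) (f₀ t)‖)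
      fun t => (Complex.norm_conj _).symm).of_norm_left
  · have := hf.error.norm_left
    refine (this.congr_left (f₂ := fun t => ‖(starRingEnd ℂ) (f t) - (starRingEnd ℂ) (f₀ t)‖)
      fun t => ?_).of_norm_left
    rw [← map_sub, Complex.norm_conj]

theorem Approx.det (hε : Tendsto ε l (𝓝 0)) {n : Type*} [Fintype n] [DecidableEq n]
    {M M₀ : ι → Matrix n n ℂ} (h : ∀ i j, Approx l ε (fun t => M t i j) fun t => M₀ t i j) :
    Approx l ε (fun t => (M t).det) fun t => (M₀ t).det := by
  simp only [Matrix.det_apply']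
  exact Approx.sum _ fun σ _ => (Approx.prod hε _ fun i _ => h _ _).const_mul _

theorem Approx.exp (hε : Tendsto ε l (𝓝 0)) (hf : Approx l ε f f₀) :
    Approx l ε (fun t => Complex.exp (f t)) fun t => Complex.exp (f₀ t) := by
  have hb : (fun t => Complex.exp (f₀ t)) =O[l] fun _ => (1 : ℝ) := by
    obtain ⟨C, hC⟩ := hf.bounded.bound
    refine IsBigO.of_bound (Real.exp C) ?_
    filter_upwards [hC] with t ht
    rw [norm_one, mul_one] at ht ⊢
    rw [Complex.norm_exp]
    exact Real.exp_le_exp.mpr ((Complex.re_le_norm _).trans ht)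
  refine ⟨hb, ?_⟩
  have h0 : Tendsto (fun t => f t - f₀ t) l (𝓝 0) := hf.error.trans_tendsto hε
  have h1 : (fun t => Complex.exp (f t - f₀ t) - 1) =O[l] ε := by
    refine IsBigO.trans ?_ hf.error
    refine IsBigO.of_bound 2 ?_
    have hd : Tendsto (fun t => ‖f t - f₀ t‖) l (𝓝 0) := by simpa using h0.norm
    filter_upwards [hd.eventually_le_const zero_lt_one] with t ht
    exact Complex.norm_exp_sub_one_le ht
  have h2 := hb.mul h1
  simp only [one_mul] at h2
  refine h2.congr_left fun t => ?_
  rw [mul_sub, ← Complex.exp_add, mul_one]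
  congr 2; ring

theorem Approx.inv (hε : Tendsto ε l (𝓝 0)) (hf : Approx l ε f f₀)
    (h0 : (fun t => (f₀ t)⁻¹) =O[l] fun _ => (1 : ℝ)) (hne : ∀ᶠ t in l, f₀ t ≠ 0) :
    Approx l ε (fun t => (f t)⁻¹) fun t => (f₀ t)⁻¹ := by
  refine ⟨h0, ?_⟩
  have h1 : (fun t => (f t - f₀ t) * (f₀ t)⁻¹) =O[l] ε := by simpa using hf.error.mul h0
  have h2 : Tendsto (fun t => (f t - f₀ t) * (f₀ t)⁻¹) l (𝓝 0) := h1.trans_tendsto hε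
  have h3 : Tendsto (fun t => (1 + (f t - f₀ t) * (f₀ t)⁻¹)⁻¹) l (𝓝 1) := by
    have := (tendsto_const_nhds (x := (1 : ℂ))).add h2 |>.inv₀ (by simp)
    simpa using this
  have h4 := (h1.mul h0).mul (h3.isBigO_one ℝ)
  simp only [mul_one] at h4
  refine (h4.neg_left).congr' ?_ EventuallyEq.rfl
  have h5 : ∀ᶠ t in l, (f t - f₀ t) * (f₀ t)⁻¹ ≠ -1 :=
    h2.eventually_ne (by norm_num)
  filter_upwards [hne, h5] with t ht ht'
  have h6 : 1 + (f t - f₀ t) * (f₀ t)⁻¹ = f t * (f₀ t)⁻¹ := by field_simp; ring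
  have h7 : f t ≠ 0 := by
    intro h; rw [h] at ht'; apply ht'; field_simp; ring
  rw [h6]
  field_simp
  ring

/-- Logarithms which tend to each other are as close as their exponentials. -/
theorem Approx.of_exp (hb : f₀ =O[l] fun _ => (1 : ℝ))
    (hlim : Tendsto (fun t => f t - f₀ t) l (𝓝 0))
    (h : (fun t => Complex.exp (f t) - Complex.exp (f₀ t)) =O[l] ε) : Approx l ε f f₀ := by
  refine ⟨hb, ?_⟩
  have hb' : (fun t => Complex.exp (-f₀ t)) =O[l] fun _ => (1 : ℝ) := by
    obtain ⟨C, hC⟩ := hb.bound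
    refine IsBigO.of_bound (Real.exp C) ?_
    filter_upwards [hC] with t ht
    rw [norm_one, mul_one] at ht ⊢
    rw [Complex.norm_exp]
    refine Real.exp_le_exp.mpr (((Complex.re_le_norm _).trans ?_).trans ht)
    rw [norm_neg]
  have h1 : (fun t => Complex.exp (f t - f₀ t) - 1) =O[l] ε := by
    have := hb'.mul h
    simp only [one_mul] at this
    refine this.congr_left fun t => ?_
    rw [mul_sub, ← Complex.exp_add, ← Complex.exp_add]
    congr 1
    · congr 1; ring
    · simp
  -- For |z| ≤ 1/2 one has |e^z - 1 - z| ≤ |z|² ≤ |z|/2, hence |z| ≤ 2 |e^z - 1|.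
  refine IsBigO.trans (IsBigO.of_bound 2 ?_) h1
  have hd : Tendsto (fun t => ‖f t - f₀ t‖) l (𝓝 0) := by simpa using hlim.norm
  filter_upwards [hd.eventually_le_const (show (0 : ℝ) < 1 / 2 by norm_num)] with t ht
  have h2 := Complex.norm_exp_sub_one_sub_id_le (x := f t - f₀ t) (by linarith)
  have h3 := norm_sub_norm_le (f t - f₀ t) (Complex.exp (f t - f₀ t) - 1)
  rw [norm_sub_rev (f t - f₀ t)] at h3
  have h4 := norm_nonneg (f t - f₀ t)
  nlinarith

end Approx

/-! ### Continuous logarithms -/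

/-- Two such logarithms differ by 2πi times a continuous integer-valued function. It is constant on
the plane and tends to 0 at infinity. -/
theorem IsLogBranch.unique {F L L' : ℝ × ℝ → ℂ} (h : IsLogBranch F L) (h' : IsLogBranch F L') :
    L = L' := by
  obtain ⟨hc, he, hi⟩ := h
  obtain ⟨hc', he', hi'⟩ := h'
  have hdiff : ∀ p, ∃ n : ℤ, L p = L' p + n * (2 * Real.pi * Complex.I) := fun p =>
    Complex.exp_eq_exp_iff_exists_int.mp ((he p).trans (he' p).symm)
  choose n hn using hdiff
  have hre : ∀ p, (L p).im - (L' p).im = n p * (2 * Real.pi) := by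
    intro p
    have := congrArg Complex.im (hn p)
    simp at this
    linarith
  have hcont : Continuous fun p => (n p : ℝ) := by
    have h1 : (fun p => (n p : ℝ)) = fun p => ((L p).im - (L' p).im) / (2 * Real.pi) := by
      ext p; rw [hre p]; field_simp
    rw [h1]
    exact ((Complex.continuous_im.comp hc).sub (Complex.continuous_im.comp hc')).div_const _
  have hn' : Continuous n := Int.isClosedEmbedding_coe_real.isInducing.continuous_iff.mpr hcont
  have hconst : ∀ p, n p = n 0 := fun p =>
    PreconnectedSpace.constant inferInstance hn'
  have hlim : Tendsto (fun p => (n p : ℝ) * (2 * Real.pi)) (cocompact (ℝ × ℝ)) (𝓝 0) := by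
    have := hi.sub hi'
    rw [sub_zero] at this
    exact this.congr hre
  have hz : (n 0 : ℝ) * (2 * Real.pi) = 0 := by
    simp only [hconst] at hlim
    exact tendsto_nhds_unique tendsto_const_nhds hlim
  have hn0 : n 0 = 0 := by
    have := (mul_eq_zero.mp hz).resolve_right (by positivity)
    exact_mod_cast this
  ext p
  rw [hn p, hconst p, hn0]; simp

theorem IsLogBranch.logBranch_eq {F L : ℝ × ℝ → ℂ} (h : IsLogBranch F L) : logBranch F = L :=
  (Classical.epsilon_spec (p := IsLogBranch F) ⟨L, h⟩).unique h

theorem IsLogBranch.const_mul {F L : ℝ × ℝ → ℂ} (h : IsLogBranch F L) {c : ℝ} (hc : 0 < c) :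
    IsLogBranch (fun p => c * F p) fun p => L p + (Real.log c : ℂ) := by
  obtain ⟨h1, h2, h3⟩ := h
  refine ⟨h1.add continuous_const, fun p => ?_, ?_⟩
  · rw [Complex.exp_add, h2, ← Complex.ofReal_exp, Real.exp_log hc, mul_comm]
  · simpa using h3

/-- A logarithm of a nonvanishing function, continuous in parameters as well, obtained by
continuation from the parameter value `b = 0` at which the function is positive. -/
theorem exists_log_family {Φ : ℝ → ℝ × ℝ → ℝ → ℂ}
    (hc : Continuous fun z : ℝ × (ℝ × ℝ) × ℝ => Φ z.1 z.2.1 z.2.2)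
    (hne : ∀ δ q b, Φ δ q b ≠ 0) (hpos : ∀ δ q, ∃ r : ℝ, 0 < r ∧ Φ δ q 0 = r)
    {b₁ : ℝ} (hb₁ : 0 ≤ b₁)
    (hs : ∀ δ, ∀ᶠ z : (ℝ × ℝ) × ℝ in cocompact (ℝ × ℝ) ×ˢ 𝓟 (Set.Icc 0 b₁),
      Φ δ z.1 z.2 ∈ Complex.slitPlane)
    (harg : ∀ δ, Tendsto (fun q => (Φ δ q b₁).arg) (cocompact (ℝ × ℝ)) (𝓝 0)) :
    ∃ Λ : ℝ → ℝ × ℝ → ℂ, Continuous (fun z : ℝ × ℝ × ℝ => Λ z.1 z.2) ∧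
      ∀ δ, IsLogBranch (fun q => Φ δ q b₁) (Λ δ) := by
  let Z := ℝ × (ℝ × ℝ) × ℝ
  obtain ⟨r₀, hr₀, hΦ₀⟩ := hpos 0 0
  have hlp : LocallyPathConnectedSpace Z := inferInstance
  -- The parameter space is simply connected and exp is a covering of the punctured plane, so Φ
  -- lifts, with the real logarithm prescribed at one point with b = 0.
  obtain ⟨Λ, ⟨hΛ0, hΛ⟩, -⟩ := Complex.isCoveringMapOn_exp.existsUnique_continuousMap_lifts
    (A := Z) ⟨fun z => Φ z.1 z.2.1 z.2.2, hc⟩ (a₀ := (0, 0, 0)) (e₀ := (Real.log r₀ : ℂ))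
    (by
      rw [← Complex.ofReal_exp, Real.exp_log hr₀]
      exact hΦ₀.symm) (fun z => hne _ _ _)
  have hexp : ∀ δ q b, Complex.exp (Λ (δ, q, b)) = Φ δ q b := fun δ q b => congrFun hΛ (δ, q, b)
  -- As long as Φ stays in the slit plane, the lift and the principal logarithm differ by a
  -- continuous integer multiple of 2πi, so agreement at one point of a preconnected set propagates
  -- to all of it.
  have hconst : ∀ {T : Type} [TopologicalSpace T] (s : Set T), IsPreconnected s →
      ∀ (γ : T → Z), ContinuousOn γ s → (∀ t ∈ s, Φ (γ t).1 (γ t).2.1 (γ t).2.2 ∈ Complex.slitPlane) →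
      ∀ t₀ ∈ s, Λ (γ t₀) = Complex.log (Φ (γ t₀).1 (γ t₀).2.1 (γ t₀).2.2) →
      ∀ t ∈ s, Λ (γ t) = Complex.log (Φ (γ t).1 (γ t).2.1 (γ t).2.2) := by
    intro T _ s hsc γ hγ hsl t₀ ht₀ heq t ht
    have hγc : ContinuousOn (fun t => Φ (γ t).1 (γ t).2.1 (γ t).2.2) s := hc.comp_continuousOn hγ
    have hd : ContinuousOn (fun t => (Λ (γ t) - Complex.log (Φ (γ t).1 (γ t).2.1 (γ t).2.2)).im
        / (2 * Real.pi)) s := by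
      refine (Complex.continuous_im.comp_continuousOn ?_).div_const _
      exact (Λ.continuous.comp_continuousOn hγ).sub (hγc.clog hsl)
    have hint : ∀ t, ∃ n : ℤ, Λ (γ t) = Complex.log (Φ (γ t).1 (γ t).2.1 (γ t).2.2) +
        n * (2 * Real.pi * Complex.I) := by
      intro t
      refine Complex.exp_eq_exp_iff_exists_int.mp ?_
      rw [Complex.exp_log (hne _ _ _)]
      exact hexp _ _ _
    choose n hn using hint
    have hval : ∀ t, (Λ (γ t) - Complex.log (Φ (γ t).1 (γ t).2.1 (γ t).2.2)).im
        / (2 * Real.pi) = n t := by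
      intro t
      rw [hn t, add_sub_cancel_left]
      simp
    have hncont : ContinuousOn n s :=
      Int.isClosedEmbedding_coe_real.isInducing.continuousOn_iff.mpr
        (hd.congr fun t _ => (hval t).symm)
    have hnt : n t = n t₀ := hsc.constant hncont ht ht₀
    have hn0 : n t₀ = 0 := by
      have := hval t₀
      rw [heq, sub_self] at this
      have h2 : (n t₀ : ℝ) = 0 := by rw [← this]; simp
      exact_mod_cast h2
    rw [hn t, hnt, hn0]; simp
  have hpos_slit : ∀ δ q, Φ δ q 0 ∈ Complex.slitPlane := by
    intro δ q
    obtain ⟨r, hr, h⟩ := hpos δ q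
    rw [h]; exact Complex.ofReal_mem_slitPlane.mpr hr
  have hzero : ∀ δ q, Λ (δ, q, 0) = Complex.log (Φ δ q 0) := by
    intro δ q
    refine hconst (T := ℝ × (ℝ × ℝ)) Set.univ isPreconnected_univ (fun p => (p.1, p.2, 0))
      (by fun_prop) (fun p _ => hpos_slit _ _) (0, 0) (Set.mem_univ _) ?_ (δ, q) (Set.mem_univ _)
    change Λ (0, 0, 0) = Complex.log (Φ 0 0 0)
    rw [hΛ0, hΦ₀, Complex.ofReal_log hr₀.le]
  refine ⟨fun δ q => Λ (δ, q, b₁), Λ.continuous.comp (by fun_prop), fun δ =>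
    ⟨Λ.continuous.comp (by fun_prop), fun q => hexp δ q b₁, ?_⟩⟩
  -- Far from the origin the whole segment 0 ≤ b ≤ b₁ is mapped into the slit plane, so agreement
  -- with the principal logarithm passes from b = 0 to b₁. There the imaginary part of the lift is
  -- the argument of Φ.
  refine (harg δ).congr' ?_
  have h1 := hs δ
  rw [eventually_prod_principal_iff] at h1
  filter_upwards [h1] with q hq
  have h2 := hconst (Set.Icc 0 b₁) isPreconnected_Icc (fun b => (δ, q, b)) (by fun_prop)
    (fun b hb => hq b hb) 0 ⟨le_rfl, hb₁⟩ (hzero δ q) b₁ ⟨hb₁, le_rfl⟩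
  rw [h2, Complex.log_im]

theorem tendsto_sub_of_continuous {Λ : ℝ → ℝ × ℝ → ℂ}
    (hΛ : Continuous (fun z : ℝ × ℝ × ℝ => Λ z.1 z.2)) {K : Set (ℝ × ℝ)} (hK : IsCompact K) :
    Tendsto (fun z : ℝ × ℝ × ℝ => Λ z.1⁻¹ z.2 - Λ 0 z.2) (atTop ×ˢ 𝓟 K) (𝓝 0) := by
  rw [Metric.tendsto_nhds]
  intro e he
  have h2 : ∀ᶠ δ in 𝓝 (0 : ℝ), ∀ q ∈ K, dist (Λ δ q) (Λ 0 q) < e := by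
    obtain ⟨v, hv, h⟩ := hK.mem_uniformity_of_prod (f := Λ) (q := 0) (s := Set.univ)
      (u := {p | dist p.1 p.2 < e}) hΛ.continuousOn (Set.mem_univ _)
      (Metric.dist_mem_uniformity he)
    rw [nhdsWithin_univ] at hv
    filter_upwards [hv] with δ hδ q hq
    exact h δ hδ q hq
  rw [eventually_prod_principal_iff]
  filter_upwards [tendsto_inv_atTop_zero.eventually h2] with A hA q hq
  rw [dist_zero_right, ← dist_eq_norm]
  exact hA q hq

end

section

open PowerSeries Filter Topology Asymptotics

/-! ### The family of sequences deforming those of the GDNLS equations -/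

/-- The equation F · (log F)' = F' gives each coefficient of the logarithm recursively as a
polynomial in the coefficients of F, since F has constant term 1. -/
theorem continuous_coeff_logOf {T : Type*} [TopologicalSpace T] {F : T → PowerSeries ℂ}
    (h1 : ∀ t, constantCoeff (F t) = 1) (hF : ∀ n, Continuous fun t => coeff n (F t)) (n : ℕ) :
    Continuous fun t => coeff n (logOf (F t)) := by
  induction n using Nat.strong_induction_on with
  | _ n ih =>
    cases n with
    | zero =>
      have : (fun t => coeff 0 (logOf (F t))) = fun _ => (0 : ℂ) := by
        ext t; rw [coeff_zero_eq_constantCoeff_apply, constantCoeff_logOf (h1 t)]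
      rw [this]; exact continuous_const
    | succ n =>
      have hrec : ∀ t, coeff (n + 1) (logOf (F t)) =
          coeff (n + 1) (F t) - (∑ m ∈ Finset.range n, coeff (n - m) (F t) *
            (coeff (m + 1) (logOf (F t)) * ((m : ℂ) + 1))) / ((n : ℂ) + 1) := by
        intro t
        have h := congrArg (coeff n) (derivative_logOf (h1 t))
        rw [mul_comm, coeff_derivative, coeff_mul, Finset.Nat.sum_antidiagonal_eq_sum_range_succ_mk,
          Finset.sum_range_succ] at h
        simp only [coeff_derivative, Nat.sub_self, coeff_zero_eq_constantCoeff_apply, h1 t,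
          mul_one] at h
        have hn : (n : ℂ) + 1 ≠ 0 := Nat.cast_add_one_ne_zero n
        rw [eq_sub_iff_add_eq, ← mul_left_inj' hn, ← h, add_mul, div_mul_cancel₀ _ hn, add_comm]
        congr 1
        exact Finset.sum_congr rfl fun m _ => mul_comm _ _
      simp only [hrec]
      refine (hF _).sub (Continuous.div_const (continuous_finsetSum _ fun m hm => ?_) _)
      exact (hF _).mul ((ih (m + 1) (by simpa using hm)).mul continuous_const)

theorem one_add_I_mul_ne_zero (b : ℝ) : (1 : ℂ) + Complex.I * b ≠ 0 := by
  intro h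
  simpa using congrArg Complex.re h

/-- The normalization of `1 + i b e ^ λ` to constant coefficient `1`. -/
def expFactor (b : ℝ) : PowerSeries ℂ :=
  C (1 + Complex.I * b)⁻¹ * (1 + C (Complex.I * b) * PowerSeries.exp ℂ)

theorem constantCoeff_expFactor (b : ℝ) : constantCoeff (expFactor b) = 1 := by
  simp only [expFactor, map_mul (constantCoeff (R := ℂ)), map_add (constantCoeff (R := ℂ)),
    constantCoeff_C, constantCoeff_exp, map_one, mul_one]
  exact inv_mul_cancel₀ (one_add_I_mul_ne_zero b)

theorem expFactor_zero : expFactor 0 = 1 := by simp [expFactor]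

/-- The odd part of the coefficients of `log (expFactor b)`. -/
def oddLog (b : ℝ) (i : ℕ) : ℂ := if Odd i then coeff i (logOf (expFactor b)) else 0

theorem continuous_oddLog (i : ℕ) : Continuous fun b => oddLog b i := by
  unfold oddLog
  split_ifs
  · refine continuous_coeff_logOf constantCoeff_expFactor (fun n => ?_) i
    simp only [expFactor, coeff_C_mul, map_add]
    refine Continuous.mul (Continuous.inv₀ (by fun_prop) one_add_I_mul_ne_zero) ?_
    fun_prop
  · exact continuous_const

theorem oddLog_zero (i : ℕ) : oddLog 0 i = 0 := by
  unfold oddLog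
  rw [expFactor_zero]
  have h : expSeries (fun i => coeff i (logOf (1 : PowerSeries ℂ))) = expSeries fun _ => 0 := by
    rw [expSeries_coeff_logOf (by simp), expSeries_zero]
  split_ifs with hi
  · exact expSeries_injective h (by rintro rfl; simp at hi)
  · rfl

/-- Dropping the even coefficients of the logarithm amounts to multiplying by the exponential of an
even series, which is even and so invisible to the Gram determinants. -/
theorem exists_isEven_expSeries_oddLog (b : ℝ) : ∃ e, IsEven e ∧ constantCoeff e = 1 ∧
    expSeries (oddLog b) = e * expFactor b := by
  refine ⟨expSeries fun i => if Odd i then 0 else -coeff i (logOf (expFactor b)), ?_,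
    constantCoeff_expSeries _, ?_⟩
  · intro n hn
    set y : ℕ → ℂ := fun i => if Odd i then 0 else -coeff i (logOf (expFactor b)) with hy
    have h := coeff_expSeries_rescale (-1 : ℂ) y n
    have h2 : (fun i => (-1 : ℂ) ^ i * y i) = y := by
      ext i
      by_cases hi : Odd i
      · simp [hy, hi]
      · rw [(Nat.not_odd_iff_even.mp hi).neg_one_pow, one_mul]
    rw [h2, hn.neg_one_pow] at h
    linear_combination h / 2
  · rw [← expSeries_coeff_logOf (constantCoeff_expFactor b), ← expSeries_add]
    refine expSeries_congr fun i _ => ?_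
    rw [expSeries_coeff_logOf (constantCoeff_expFactor b)]
    unfold oddLog
    split_ifs <;> simp

/-- The part of the GDNLS sequence `x⁺` which depends on `(x, t)`. -/
def waveSeq (α : ℝ) (q : ℝ × ℝ) (i : ℕ) : ℂ :=
  if Odd i then 1 / (Nat.factorial i : ℂ) * (Real.sqrt α * q.1 +
    (Real.sqrt α * (α - 1) + 2 ^ (i - 1) * Complex.I * α) * q.2) else 0

/-- The deformation of the GDNLS sequence `x⁺(0, 0)`, which is obtained for `b = 1 / √α`. -/
def famPlus (α b : ℝ) (q : ℝ × ℝ) (i : ℕ) : ℂ := waveSeq α q i + 1 / 2 * oddLog b i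

/-- The deformation of the GDNLS sequence `x⁻(0, 0)`, which is obtained for `b = 1 / √α`. -/
def famMinus (α b : ℝ) (q : ℝ × ℝ) (i : ℕ) : ℂ :=
  (starRingEnd ℂ) (waveSeq α q i - 1 / 2 * oddLog b i)

/-- Adding 1/2 at index 1 multiplies the exponential by e^(λ/2). This turns i e^(λ/2) + √α e^(-λ/2)
into √α (1 + i b e^λ) with b = 1/√α. -/
theorem hCoeff_add {α : ℝ} (hα : 0 < α) {i : ℕ} (hi : i ≠ 0) :
    hCoeff α i + (if i = 1 then 1 / 2 else 0) = coeff i (logOf (expFactor (Real.sqrt α)⁻¹)) := by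
  have hs : (Real.sqrt α : ℂ) ≠ 0 := by exact_mod_cast (Real.sqrt_pos.mpr hα).ne'
  have hne : Complex.I + (Real.sqrt α : ℂ) ≠ 0 := by
    intro h; simpa using congrArg Complex.im h
  set F := C (Complex.I + (Real.sqrt α : ℂ))⁻¹ *
      (C Complex.I * expHalf + C (Real.sqrt α : ℂ) * expNegHalf) with hF
  have hF1 : constantCoeff F = 1 := by
    rw [hF, map_mul (constantCoeff (R := ℂ)), map_add (constantCoeff (R := ℂ)),
      map_mul (constantCoeff (R := ℂ)), map_mul (constantCoeff (R := ℂ)), constantCoeff_expHalf,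
      constantCoeff_expNegHalf]
    simp only [constantCoeff_C, mul_one]
    exact inv_mul_cancel₀ hne
  have hhalf : expSeries (fun i => if i = 1 then (1 / 2 : ℂ) else 0) = expHalf := by
    refine (eq_expSeries constantCoeff_expHalf ?_).symm
    have h1 : seqSeries (fun i => if i = 1 then (1 / 2 : ℂ) else 0) = C (1 / 2 : ℂ) * X := by
      ext n
      rw [seqSeries, coeff_mk, coeff_C_mul, coeff_X]
      split_ifs <;> simp_all
    rw [h1]
    ext n
    simp only [Derivation.leibniz, expHalf, coeff_derivative, coeff_rescale, derivative_C,
      derivative_X, smul_eq_mul, mul_one, mul_zero, add_zero, coeff_mul_C, coeff_exp]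
    rw [Nat.factorial_succ]
    have : (n.factorial : ℂ) ≠ 0 := by exact_mod_cast n.factorial_ne_zero
    have : (n : ℂ) + 1 ≠ 0 := Nat.cast_add_one_ne_zero n
    push_cast
    simp
    field_simp
    rw [pow_succ]
  have hhh : expHalf * expHalf = PowerSeries.exp ℂ := by
    have := exp_mul_exp_eq_exp_add (1 / 2 : ℂ) (1 / 2)
    norm_num at this
    simpa [expHalf] using this
  have hhn : expNegHalf * expHalf = 1 := by
    have := exp_mul_exp_eq_exp_add (-1 / 2 : ℂ) (1 / 2)
    norm_num at this
    rw [expNegHalf, expHalf, show (-1 / 2 : ℂ) = -(1 / 2) by ring]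
    simpa using this
  have hprod : F * expHalf = expFactor (Real.sqrt α)⁻¹ := by
    have e1 : F * expHalf = C (Complex.I + (Real.sqrt α : ℂ))⁻¹ *
      (C Complex.I * PowerSeries.exp ℂ + C (Real.sqrt α : ℂ)) := by
      rw [hF, ← hhh]; linear_combination
        C (Complex.I + (Real.sqrt α : ℂ))⁻¹ * C (Real.sqrt α : ℂ) * hhn
    have e2 : (1 : PowerSeries ℂ) + C (Complex.I * ((Real.sqrt α)⁻¹ : ℝ)) * PowerSeries.exp ℂ =
        C (Real.sqrt α : ℂ)⁻¹ * (C Complex.I * PowerSeries.exp ℂ + C (Real.sqrt α : ℂ)) := by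
      rw [mul_add, ← map_mul C, ← mul_assoc, ← map_mul C, inv_mul_cancel₀ hs, map_one]
      push_cast
      rw [mul_comm Complex.I]; ring
    rw [e1, expFactor, e2, ← mul_assoc, ← map_mul C]
    congr 2
    push_cast
    rw [← mul_inv]
    congr 1
    field_simp
    ring
  refine expSeries_injective (x := fun i => hCoeff α i + (if i = 1 then 1 / 2 else 0))
    (y := fun i => coeff i (logOf (expFactor (Real.sqrt α)⁻¹))) ?_ hi
  rw [expSeries_coeff_logOf (constantCoeff_expFactor _), expSeries_add, hhalf, ← hprod]
  congr 1
  exact expSeries_coeff_logOf hF1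

theorem gdnlsPlus_zero {α : ℝ} (hα : 0 < α) (q : ℝ × ℝ) :
    gdnlsPlus α (fun _ => 0) 0 0 q.1 q.2 = famPlus α (Real.sqrt α)⁻¹ q := by
  ext i
  unfold gdnlsPlus famPlus waveSeq oddLog
  by_cases h1 : i = 1
  · subst h1
    rw [← hCoeff_add hα one_ne_zero]
    simp
    ring
  · by_cases h2 : Odd i
    · rw [← hCoeff_add hα (by rintro rfl; simp at h2)]
      simp [h1, h2]
      ring
    · simp [h1, h2]

theorem gdnlsMinus_zero {α : ℝ} (hα : 0 < α) (q : ℝ × ℝ) :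
    gdnlsMinus α (fun _ => 0) 0 0 q.1 q.2 = famMinus α (Real.sqrt α)⁻¹ q := by
  ext i
  unfold gdnlsMinus famMinus waveSeq oddLog
  by_cases h1 : i = 1
  · subst h1
    rw [← hCoeff_add hα one_ne_zero]
    simp [map_ofNat]
    ring
  · by_cases h2 : Odd i
    · rw [← hCoeff_add hα (by rintro rfl; simp at h2)]
      simp [h1, h2, map_ofNat]
      ring
    · simp [h1, h2]

theorem expSeries_gdnlsPlus (α : ℝ) (a : ℕ → ℂ) (n k : ℤ) (x t : ℝ) :
    expSeries (gdnlsPlus α a n k x t) =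
      expSeries (oddSeq a) * expSeries (gdnlsPlus α (fun _ => 0) n k x t) := by
  rw [← expSeries_add]
  refine expSeries_congr fun i _ => ?_
  unfold gdnlsPlus oddSeq
  split_ifs <;> ring

theorem expSeries_gdnlsMinus (α : ℝ) (a : ℕ → ℂ) (n k : ℤ) (x t : ℝ) :
    expSeries (gdnlsMinus α a n k x t) = PowerSeries.map (starRingEnd ℂ) (expSeries (oddSeq a)) *
      expSeries (gdnlsMinus α (fun _ => 0) n k x t) := by
  rw [map_expSeries, ← expSeries_add]
  refine expSeries_congr fun i _ => ?_
  unfold gdnlsMinus oddSeq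
  split_ifs <;> (simp; try ring)

theorem expSeries_nlsPlus (a : ℕ → ℂ) (n : ℤ) (x t : ℝ) :
    expSeries (nlsPlus a n x t) =
      expSeries (oddSeq a) * expSeries (nlsPlus (fun _ => 0) n x t) := by
  rw [← expSeries_add]
  refine expSeries_congr fun i _ => ?_
  unfold nlsPlus oddSeq
  split_ifs <;> ring

theorem expSeries_nlsMinus (a : ℕ → ℂ) (n : ℤ) (x t : ℝ) :
    expSeries (nlsMinus a n x t) = PowerSeries.map (starRingEnd ℂ) (expSeries (oddSeq a)) *
      expSeries (nlsMinus (fun _ => 0) n x t) := by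
  rw [map_expSeries, ← expSeries_add]
  refine expSeries_congr fun i _ => ?_
  unfold nlsMinus nlsPlus oddSeq
  split_ifs <;> (simp; try ring)

theorem expSeries_famMinus (α b : ℝ) (q : ℝ × ℝ) : expSeries (famMinus α b q) =
    PowerSeries.map (starRingEnd ℂ) (expSeries fun i => waveSeq α q i - 1 / 2 * oddLog b i) :=
  (map_expSeries _ _).symm

open scoped ComplexOrder in
theorem gramDet_conj_ne_zero (N : ℕ) {f : PowerSeries ℂ} (hf : constantCoeff f ≠ 0) :
    gramDet N f (PowerSeries.map (starRingEnd ℂ) f) ≠ 0 :=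
  (gramDet_conj_pos N hf).ne'

/-- With G built from x⁻ by conjugation, the series of x⁺ is G times the exponential of the odd part
of log(1 + i b e^λ). Up to an even factor and a constant this is the situation of `gramDet_ne_zero`;
for b = 0 positivity applies. -/
theorem gramDet_fam_ne_zero (N : ℕ) {P : PowerSeries ℂ} (hP : constantCoeff P = 1) (α b : ℝ)
    (q : ℝ × ℝ) : gramDet N (P * expSeries (famPlus α b q))
      (PowerSeries.map (starRingEnd ℂ) P * expSeries (famMinus α b q)) ≠ 0 := by
  set G := P * expSeries fun i => waveSeq α q i - 1 / 2 * oddLog b i with hG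
  have hG1 : constantCoeff G = 1 := by
    rw [hG, map_mul (constantCoeff (R := ℂ)), hP, constantCoeff_expSeries, mul_one]
  have hm : PowerSeries.map (starRingEnd ℂ) P * expSeries (famMinus α b q) =
      PowerSeries.map (starRingEnd ℂ) G := by
    rw [expSeries_famMinus, hG, map_mul (PowerSeries.map (starRingEnd ℂ))]
  obtain ⟨e, he, he1, hoe⟩ := exists_isEven_expSeries_oddLog b
  have hp : P * expSeries (famPlus α b q) = e * (C (1 + Complex.I * b)⁻¹ *
      ((1 + C (Complex.I * b) * PowerSeries.exp ℂ) * G)) := by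
    have : expSeries (famPlus α b q) =
        expSeries (oddLog b) * expSeries fun i => waveSeq α q i - 1 / 2 * oddLog b i := by
      rw [← expSeries_add]
      refine expSeries_congr fun i _ => ?_
      unfold famPlus; ring
    rw [this, hoe, expFactor, hG]; ring
  rw [hm, hp, gramDet_even_mul N he he1, gramDet_C_mul]
  refine mul_ne_zero (pow_ne_zero _ (inv_ne_zero (one_add_I_mul_ne_zero b))) ?_
  by_cases hb : b = 0
  · subst hb
    have : (1 + C (Complex.I * ((0 : ℝ) : ℂ)) * PowerSeries.exp ℂ) * G = G := by simp
    rw [this]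
    exact gramDet_conj_ne_zero N (by rw [hG1]; exact one_ne_zero)
  · exact gramDet_ne_zero N hb (by rw [hG1]; exact one_ne_zero)

open scoped ComplexOrder in
theorem gramDet_fam_zero_pos (N : ℕ) {P : PowerSeries ℂ} (hP : constantCoeff P = 1) (α : ℝ)
    (q : ℝ × ℝ) : 0 < gramDet N (P * expSeries (famPlus α 0 q))
      (PowerSeries.map (starRingEnd ℂ) P * expSeries (famMinus α 0 q)) := by
  have h : expSeries (famMinus α 0 q) =
      PowerSeries.map (starRingEnd ℂ) (expSeries (famPlus α 0 q)) := by
    rw [expSeries_famMinus]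
    congr 2
    ext i
    simp [famPlus, oddLog_zero]
  rw [h, ← map_mul (PowerSeries.map (starRingEnd ℂ))]
  refine gramDet_conj_pos N ?_
  rw [map_mul (constantCoeff (R := ℂ)), hP, constantCoeff_expSeries]; norm_num

end

section

open PowerSeries Filter Topology Asymptotics

/-! ### The GDNLS family at infinity -/

theorem waveSeq_of_not_odd (α : ℝ) (q : ℝ × ℝ) {i : ℕ} (hi : ¬ Odd i) : waveSeq α q i = 0 := by
  simp [waveSeq, hi]

theorem waveSeq_one (α : ℝ) (q : ℝ × ℝ) : waveSeq α q 1 =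
    ((Real.sqrt α * q.1 + Real.sqrt α * (α - 1) * q.2 : ℝ) : ℂ) + (α * q.2 : ℝ) * Complex.I := by
  simp [waveSeq]; ring

theorem continuous_waveSeq (α : ℝ) (i : ℕ) : Continuous fun q => waveSeq α q i := by
  unfold waveSeq
  split_ifs <;> fun_prop

/-- For α > 0 the real-linear map from (x, t) to the x_1-part is invertible, so this part can
measure the distance to infinity. -/
theorem exists_norm_le_waveSeq_one {α : ℝ} (hα : 0 < α) :
    ∃ K : ℝ, 0 < K ∧ ∀ q : ℝ × ℝ, ‖q‖ ≤ K * ‖waveSeq α q 1‖ := by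
  have hs : 0 < Real.sqrt α := Real.sqrt_pos.mpr hα
  refine ⟨(Real.sqrt α)⁻¹ + α⁻¹ * (1 + |α - 1|), by positivity, fun q => ?_⟩
  set w := waveSeq α q 1 with hw
  have him : w.im = α * q.2 := by rw [hw, waveSeq_one]; simp
  have hre : w.re = Real.sqrt α * q.1 + Real.sqrt α * (α - 1) * q.2 := by
    rw [hw, waveSeq_one]; simp
  have h2 : |q.2| ≤ α⁻¹ * ‖w‖ := by
    have := Complex.abs_im_le_norm w
    rw [him, abs_mul, abs_of_pos hα] at this
    rw [inv_mul_eq_div, le_div_iff₀ hα]; linarith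
  have h1 : |q.1| ≤ (Real.sqrt α)⁻¹ * ‖w‖ + |α - 1| * |q.2| := by
    have e : q.1 = (Real.sqrt α)⁻¹ * w.re - (α - 1) * q.2 := by
      rw [hre]; field_simp; ring
    calc |q.1| = |(Real.sqrt α)⁻¹ * w.re - (α - 1) * q.2| := by rw [← e]
      _ ≤ |(Real.sqrt α)⁻¹ * w.re| + |(α - 1) * q.2| := abs_sub _ _
      _ ≤ _ := by
        rw [abs_mul, abs_mul, abs_of_pos (inv_pos.mpr hs)]
        gcongr
        exact Complex.abs_re_le_norm w
  have h3 : |α - 1| * |q.2| ≤ |α - 1| * (α⁻¹ * ‖w‖) := by gcongr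
  have h4 : 0 ≤ (Real.sqrt α)⁻¹ * ‖w‖ := by positivity
  have h5 : 0 ≤ α⁻¹ * ‖w‖ := by positivity
  have h6 : 0 ≤ |α - 1| * (α⁻¹ * ‖w‖) := by positivity
  rw [Prod.norm_def, Real.norm_eq_abs, Real.norm_eq_abs]
  refine max_le ?_ ?_ <;> nlinarith

theorem exists_norm_waveSeq_le (α : ℝ) (i : ℕ) :
    ∃ D : ℝ, ∀ q : ℝ × ℝ, ‖waveSeq α q i‖ ≤ D * ‖q‖ := by
  by_cases hi : Odd i
  · refine ⟨‖1 / (Nat.factorial i : ℂ)‖ * (‖(Real.sqrt α : ℂ)‖ +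
      ‖(Real.sqrt α * (α - 1) + 2 ^ (i - 1) * Complex.I * α : ℂ)‖), fun q => ?_⟩
    rw [waveSeq, if_pos hi, norm_mul, mul_assoc ‖_‖]
    refine mul_le_mul_of_nonneg_left ?_ (norm_nonneg (1 / (Nat.factorial i : ℂ)))
    refine (norm_add_le _ _).trans ?_
    rw [norm_mul (Real.sqrt α : ℂ), norm_mul _ (q.2 : ℂ), add_mul]
    refine add_le_add (mul_le_mul_of_nonneg_left ?_ (norm_nonneg _))
      (mul_le_mul_of_nonneg_left ?_ (norm_nonneg _))
    · rw [Complex.norm_real]; exact norm_fst_le q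
    · rw [Complex.norm_real]; exact norm_snd_le q
  · exact ⟨0, fun q => by simp [waveSeq_of_not_odd α q hi]⟩

theorem tendsto_norm_waveSeq_one {α : ℝ} (hα : 0 < α) (s : Set ℝ) :
    Tendsto (fun z : (ℝ × ℝ) × ℝ => ‖waveSeq α z.1 1‖) (cocompact (ℝ × ℝ) ×ˢ 𝓟 s) atTop := by
  obtain ⟨K, hK, h⟩ := exists_norm_le_waveSeq_one hα
  have h1 : Tendsto (fun z : (ℝ × ℝ) × ℝ => K⁻¹ * ‖z.1‖) (cocompact (ℝ × ℝ) ×ˢ 𝓟 s) atTop :=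
    (tendsto_norm_cocompact_atTop.comp tendsto_fst).const_mul_atTop (inv_pos.mpr hK)
  refine tendsto_atTop_mono (fun z => ?_) h1
  rw [inv_mul_le_iff₀ hK]
  exact h z.1

/-- Every entry grows at most linearly in (x, t), hence like the entry of index 1, while the divisor
has degree i. Continuity of `oddLog` on a compact interval makes this uniform in b. -/
theorem tendsto_fam_div_pow {α : ℝ} (hα : 0 < α) (a : ℕ → ℂ) (s : ℂ) (b₁ : ℝ) (i : ℕ) :
    Tendsto (fun z : (ℝ × ℝ) × ℝ => (oddSeq a i + (waveSeq α z.1 i + s * oddLog z.2 i)) /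
      waveSeq α z.1 1 ^ i) (cocompact (ℝ × ℝ) ×ˢ 𝓟 (Set.Icc 0 b₁)) (𝓝 (unitSeq i)) := by
  set l := cocompact (ℝ × ℝ) ×ˢ 𝓟 (Set.Icc 0 b₁)
  have hw := tendsto_norm_waveSeq_one hα (Set.Icc 0 b₁)
  have hw0 : ∀ᶠ z : (ℝ × ℝ) × ℝ in l, waveSeq α z.1 1 ≠ 0 := by
    filter_upwards [hw.eventually_gt_atTop 0] with z hz
    exact norm_pos_iff.mp hz
  have h1w : (fun _ => (1 : ℂ)) =o[l] fun z : (ℝ × ℝ) × ℝ => waveSeq α z.1 1 := by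
    rw [isLittleO_const_left]
    exact Or.inr hw
  have hlog : (fun z : (ℝ × ℝ) × ℝ => s * oddLog z.2 i) =O[l] fun _ => (1 : ℂ) := by
    refine IsBigO.const_mul_left ?_ s
    obtain ⟨M, hM⟩ := isCompact_Icc.exists_bound_of_continuousOn
      (continuous_oddLog i).continuousOn (s := Set.Icc 0 b₁)
    refine IsBigO.of_bound M ?_
    rw [eventually_prod_principal_iff]
    filter_upwards with q b hb
    simpa using hM b hb
  have hodd : (fun _ : (ℝ × ℝ) × ℝ => oddSeq a i) =O[l] fun _ => (1 : ℂ) :=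
    isBigO_const_const _ one_ne_zero _
  rcases Nat.lt_or_ge i 2 with hi | hi
  · interval_cases i
    · simpa [oddSeq, waveSeq, oddLog, unitSeq] using tendsto_const_nhds
    · have hrest := ((hodd.add hlog).trans_isLittleO h1w).tendsto_div_nhds_zero
      have h2 := hrest.const_add 1
      rw [add_zero] at h2
      refine (h2.congr' ?_).trans (by simp [unitSeq])
      filter_upwards [hw0] with z hz
      field_simp
      ring
  · have hwave : (fun z : (ℝ × ℝ) × ℝ => waveSeq α z.1 i) =O[l] fun z => waveSeq α z.1 1 := by
      obtain ⟨K, hK, h1⟩ := exists_norm_le_waveSeq_one hα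
      obtain ⟨D, hD⟩ := exists_norm_waveSeq_le α i
      refine IsBigO.of_bound (|D| * K) (Eventually.of_forall fun z => ?_)
      calc ‖waveSeq α z.1 i‖ ≤ D * ‖z.1‖ := hD _
        _ ≤ |D| * ‖z.1‖ := by gcongr; exact le_abs_self D
        _ ≤ |D| * (K * ‖waveSeq α z.1 1‖) := by gcongr; exact h1 _
        _ = _ := by ring
    have hpow : (fun z : (ℝ × ℝ) × ℝ => waveSeq α z.1 1) =o[l] fun z => waveSeq α z.1 1 ^ i := by
      have h2 : (fun z : (ℝ × ℝ) × ℝ => waveSeq α z.1 1 * 1) =o[l]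
          fun z => waveSeq α z.1 1 * waveSeq α z.1 1 ^ (i - 1) := by
        refine (isBigO_refl _ _).mul_isLittleO ?_
        simpa using h1w.pow (n := i - 1) (by omega)
      refine h2.congr (fun z => mul_one _) fun z => ?_
      rw [← pow_succ', Nat.sub_add_cancel (by omega)]
    have hall := (((hodd.trans h1w.isBigO).add (hwave.add (hlog.trans h1w.isBigO))).trans_isLittleO
      hpow).tendsto_div_nhds_zero
    have hu : unitSeq i = 0 := by unfold unitSeq; rw [if_neg (by omega)]
    rw [hu]; exact hall

theorem eventually_gramDet_fam_mem_slitPlane (N : ℕ) {α : ℝ} (hα : 0 < α) (a : ℕ → ℂ) (b₁ : ℝ) :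
    (∀ᶠ z : (ℝ × ℝ) × ℝ in cocompact (ℝ × ℝ) ×ˢ 𝓟 (Set.Icc 0 b₁),
      gramDet N (expSeries (oddSeq a) * expSeries (famPlus α z.2 z.1))
        (PowerSeries.map (starRingEnd ℂ) (expSeries (oddSeq a)) *
          expSeries (famMinus α z.2 z.1)) ∈ Complex.slitPlane) ∧
    Tendsto (fun z : (ℝ × ℝ) × ℝ =>
      (gramDet N (expSeries (oddSeq a) * expSeries (famPlus α z.2 z.1))
        (PowerSeries.map (starRingEnd ℂ) (expSeries (oddSeq a)) *
          expSeries (famMinus α z.2 z.1))).arg)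
      (cocompact (ℝ × ℝ) ×ˢ 𝓟 (Set.Icc 0 b₁)) (𝓝 0) := by
  simp only [map_expSeries, ← expSeries_add]
  refine eventually_gramDet_mem_slitPlane N (tendsto_norm_waveSeq_one hα (Set.Icc 0 b₁))
    (fun i => tendsto_fam_div_pow hα a (1 / 2) b₁ i) fun i => ?_
  have h := (Complex.continuous_conj.tendsto _).comp (tendsto_fam_div_pow hα a (-(1 / 2)) b₁ i)
  have hu : (starRingEnd ℂ) (unitSeq i) = unitSeq i := by unfold unitSeq; split_ifs <;> simp
  rw [hu] at h
  refine h.congr fun z => ?_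
  simp only [Function.comp_apply, famMinus, map_div₀, map_pow, ← map_add]
  congr 2
  ring

/-! ### The degenerating determinants -/

/-- The determinant of the Gram matrix of `f` and `g`, compressed by `M`. -/
def compDet {N n : ℕ} (M : Matrix (Fin N) (Fin n) ℂ) (f g : PowerSeries ℂ) : ℂ :=
  (M * gramMat n f g * M.conjTranspose).det

theorem continuous_gram {T : Type*} [TopologicalSpace T] {x y : T → ℕ → ℂ}
    (hx : ∀ i, Continuous fun t => x t i) (hy : ∀ i, Continuous fun t => y t i) (n i j : ℕ) :
    Continuous fun t => gram n (expSeries (x t)) (expSeries (y t)) i j := by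
  have h : ∀ {x : T → ℕ → ℂ}, (∀ i, Continuous fun t => x t i) → ∀ (p : PowerSeries ℂ) (k : ℕ),
      Continuous fun t => coeff k (expSeries (x t) * p) := by
    intro x hx p k
    simp only [coeff_mul]
    refine continuous_finsetSum _ fun m _ => Continuous.mul ?_ continuous_const
    exact (continuous_coeff_expSeries _).comp (continuous_pi hx)
  unfold gram
  exact continuous_finsetSum _ fun ν _ => (h hx _ _).mul (h hy _ _)

theorem continuous_compDet {T : Type*} [TopologicalSpace T] {N n : ℕ}
    {M : T → Matrix (Fin N) (Fin n) ℂ} {x y : T → ℕ → ℂ}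
    (hM : ∀ i j, Continuous fun t => M t i j)
    (hx : ∀ i, Continuous fun t => x t i) (hy : ∀ i, Continuous fun t => y t i) :
    Continuous fun t => compDet (M t) (expSeries (x t)) (expSeries (y t)) := by
  have h1 : Continuous M := continuous_matrix hM
  have h2 : Continuous fun t => gramMat n (expSeries (x t)) (expSeries (y t)) :=
    continuous_matrix fun i j => continuous_gram hx hy n i j
  exact ((h1.matrix_mul h2).matrix_mul h1.matrix_conjTranspose).matrix_det

theorem isBigO_one_of_continuous {h : ℝ × ℝ → ℂ} (hh : Continuous h) {K : Set (ℝ × ℝ)}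
    (hK : IsCompact K) :
    (fun z : ℝ × ℝ × ℝ => h z.2) =O[atTop ×ˢ 𝓟 K] fun _ => (1 : ℝ) := by
  obtain ⟨M, hM⟩ := hK.exists_bound_of_continuousOn hh.continuousOn
  refine IsBigO.of_bound M ?_
  rw [eventually_prod_principal_iff]
  filter_upwards with A q hq
  simpa using hM q hq

theorem tendsto_inv_fst (K : Set (ℝ × ℝ)) :
    Tendsto (fun z : ℝ × ℝ × ℝ => z.1⁻¹) (atTop ×ˢ 𝓟 K) (𝓝 0) :=
  tendsto_inv_atTop_zero.comp tendsto_fst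

/-- The entries of E are monomials in δ = A⁻¹, so each differs from its value at δ = 0 by O(A⁻¹);
the Gram matrix does not depend on δ and is bounded on K. -/
theorem approx_compDet {N n : ℕ} {E : ℝ → Matrix (Fin N) (Fin n) ℂ}
    (hE : ∀ k m, ∃ (c : ℂ) (r : ℕ), ∀ δ : ℝ, E δ k m = c * (δ : ℂ) ^ r)
    {x y : ℝ × ℝ → ℕ → ℂ} (hx : ∀ i, Continuous fun q => x q i)
    (hy : ∀ i, Continuous fun q => y q i) {K : Set (ℝ × ℝ)} (hK : IsCompact K) :
    Approx (atTop ×ˢ 𝓟 K) (fun z : ℝ × ℝ × ℝ => z.1⁻¹)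
      (fun z => compDet (E z.1⁻¹) (expSeries (x z.2)) (expSeries (y z.2)))
      fun z => compDet (E 0) (expSeries (x z.2)) (expSeries (y z.2)) := by
  have hε := tendsto_inv_fst K
  have hent : ∀ k m, Approx (atTop ×ˢ 𝓟 K) (fun z : ℝ × ℝ × ℝ => z.1⁻¹)
      (fun z => E z.1⁻¹ k m) fun _ => E 0 k m := by
    intro k m
    obtain ⟨c, r, h⟩ := hE k m
    simp only [h]
    refine Approx.const_mul ⟨isBigO_const_const _ one_ne_zero _, ?_⟩ c
    cases r with
    | zero => simpa using isBigO_zero _ _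
    | succ r =>
      have h1 : (fun z : ℝ × ℝ × ℝ => ((z.1⁻¹ : ℝ) : ℂ)) =O[atTop ×ˢ 𝓟 K] fun z => z.1⁻¹ :=
        IsBigO.of_bound 1 (Eventually.of_forall fun z => by
          rw [Complex.norm_real, one_mul])
      have h2 := ((h1.trans (hε.isBigO_one ℝ)).pow r).mul h1
      simpa [pow_succ] using h2
  refine Approx.det hε fun i j => ?_
  simp only [Matrix.mul_apply, Matrix.conjTranspose_apply]
  refine Approx.sum _ fun k _ => Approx.mul hε (Approx.sum _ fun m _ => (hent i m).mul hε ?_)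
    (hent j k).conj
  exact Approx.refl (isBigO_one_of_continuous (continuous_gram hx hy n m k) hK)

theorem exists_bound_of_isBigO {u : ℝ → ℝ × ℝ → ℂ} {K : Set (ℝ × ℝ)}
    (h : (fun z : ℝ × ℝ × ℝ => u z.1 z.2) =O[atTop ×ˢ 𝓟 K] fun z => z.1⁻¹) :
    ∃ C A₀ : ℝ, 0 < A₀ ∧ ∀ A : ℝ, A₀ ≤ A → ∀ q ∈ K, ‖u A q‖ ≤ C / A := by
  obtain ⟨C, hC⟩ := h.bound
  rw [eventually_prod_principal_iff] at hC
  obtain ⟨A₁, hA₁⟩ := eventually_atTop.mp hC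
  refine ⟨C, max A₁ 1, by positivity, fun A hA q hq => ?_⟩
  have := hA₁ A ((le_max_left _ _).trans hA) q hq
  have hA0 : 0 < A := lt_of_lt_of_le one_pos ((le_max_right _ _).trans hA)
  rwa [Real.norm_of_nonneg (inv_nonneg.mpr hA0.le), ← div_eq_mul_inv] at this

theorem isCompact_setOf_sq_add_sq_le (R : ℝ) :
    IsCompact {q : ℝ × ℝ | q.1 ^ 2 + q.2 ^ 2 ≤ R} := by
  refine Metric.isCompact_of_isClosed_isBounded
    (isClosed_le (by fun_prop) continuous_const) ?_
  refine (Metric.isBounded_closedBall (x := (0 : ℝ × ℝ)) (r := |R| + 1)).subset fun q hq => ?_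
  have hq' : q.1 ^ 2 + q.2 ^ 2 ≤ R := hq
  have hR := le_abs_self R
  rw [mem_closedBall_zero_iff, Prod.norm_def, Real.norm_eq_abs, Real.norm_eq_abs]
  refine max_le ?_ ?_
  · refine abs_le_of_sq_le_sq ?_ (by positivity)
    nlinarith [sq_nonneg q.2, abs_nonneg R]
  · refine abs_le_of_sq_le_sq ?_ (by positivity)
    nlinarith [sq_nonneg q.1, abs_nonneg R]

end

section

open PowerSeries Filter Topology Asymptotics

/-! ### Comparison of the rogue waves -/

theorem mul_mem_slitPlane_and_arg {c : ℝ} (hc : 0 < c) {z : ℂ} :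
    (z ∈ Complex.slitPlane → (c : ℂ) * z ∈ Complex.slitPlane) ∧
      ((c : ℂ) * z).arg = z.arg := by
  refine ⟨fun hz => ?_, Complex.arg_real_mul z hc⟩
  rw [Complex.mem_slitPlane_iff_arg] at hz ⊢
  rw [Complex.arg_real_mul z hc]
  exact ⟨hz.1, mul_ne_zero (by exact_mod_cast hc.ne') hz.2⟩

open scoped ComplexOrder in
theorem exists_isLogBranch_compDet {N : ℕ} {E : ℝ → Matrix (Fin N) (Fin (2 * N)) ℂ}
    (hE : ∀ k m, ∃ (c : ℂ) (r : ℕ), ∀ δ : ℝ, E δ k m = c * (δ : ℂ) ^ r)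
    (hdet : ∀ δ : ℝ, ∃ c : ℝ, 0 < c ∧ ∃ (M : ℕ) (a : ℕ → ℂ), ∀ f g : PowerSeries ℂ,
      constantCoeff f = 1 → constantCoeff g = 1 → compDet (E δ) f g = c *
        gramDet M (expSeries (oddSeq a) * f)
          (PowerSeries.map (starRingEnd ℂ) (expSeries (oddSeq a)) * g))
    {α : ℝ} (hα : 0 < α) :
    ∃ Λ : ℝ → ℝ × ℝ → ℂ, Continuous (fun z : ℝ × ℝ × ℝ => Λ z.1 z.2) ∧
      ∀ δ, IsLogBranch (fun q => compDet (E δ) (expSeries (gdnlsPlus α (fun _ => 0) 0 0 q.1 q.2))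
        (expSeries (gdnlsMinus α (fun _ => 0) 0 0 q.1 q.2))) (Λ δ) := by
  have hEc : ∀ k m, Continuous fun δ => E δ k m := by
    intro k m
    obtain ⟨c, r, h⟩ := hE k m
    simp only [h]
    fun_prop
  set Φ : ℝ → ℝ × ℝ → ℝ → ℂ := fun δ q b =>
    compDet (E δ) (expSeries (famPlus α b q)) (expSeries (famMinus α b q)) with hΦ
  have hc : Continuous fun z : ℝ × (ℝ × ℝ) × ℝ => Φ z.1 z.2.1 z.2.2 := by
    have hw : ∀ i, Continuous fun z : ℝ × (ℝ × ℝ) × ℝ => waveSeq α z.2.1 i := fun i =>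
      (continuous_waveSeq α i).comp (by fun_prop)
    have ho : ∀ i, Continuous fun z : ℝ × (ℝ × ℝ) × ℝ => oddLog z.2.2 i := fun i =>
      (continuous_oddLog i).comp (by fun_prop)
    refine continuous_compDet (fun k m => (hEc k m).comp continuous_fst) (fun i => ?_) fun i => ?_
    · exact (hw i).add (continuous_const.mul (ho i))
    · exact Complex.continuous_conj.comp ((hw i).sub (continuous_const.mul (ho i)))
  have hE1 : ∀ a, constantCoeff (expSeries (oddSeq a)) = 1 := fun a => constantCoeff_expSeries _
  obtain ⟨Λ, h1, h2⟩ := exists_log_family (Φ := Φ) (b₁ := (Real.sqrt α)⁻¹) hc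
    (by
      intro δ q b
      obtain ⟨c, hc, M, a, h⟩ := hdet δ
      simp only [hΦ]
      rw [h _ _ (constantCoeff_expSeries _) (constantCoeff_expSeries _)]
      exact mul_ne_zero (by exact_mod_cast hc.ne') (gramDet_fam_ne_zero M (hE1 a) α b q))
    (by
      intro δ q
      obtain ⟨c, hc, M, a, h⟩ := hdet δ
      have hp := gramDet_fam_zero_pos M (hE1 a) α q
      obtain ⟨hre, him⟩ := Complex.pos_iff.mp hp
      refine ⟨_, mul_pos hc hre, ?_⟩
      simp only [hΦ]
      rw [h _ _ (constantCoeff_expSeries _) (constantCoeff_expSeries _)]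
      push_cast
      congr 1
      exact Complex.ext rfl (by simpa using him.symm))
    (by positivity)
    (by
      intro δ
      obtain ⟨c, hc, M, a, h⟩ := hdet δ
      filter_upwards [(eventually_gramDet_fam_mem_slitPlane M hα a (Real.sqrt α)⁻¹).1] with z hz
      simp only [hΦ]
      rw [h _ _ (constantCoeff_expSeries _) (constantCoeff_expSeries _)]
      exact (mul_mem_slitPlane_and_arg hc).1 hz)
    (by
      intro δ
      obtain ⟨c, hc, M, a, h⟩ := hdet δ
      have h3 := (eventually_gramDet_fam_mem_slitPlane M hα a (Real.sqrt α)⁻¹).2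
      have h4 : Tendsto (fun q : ℝ × ℝ => (q, (Real.sqrt α)⁻¹)) (cocompact (ℝ × ℝ))
          (cocompact (ℝ × ℝ) ×ˢ 𝓟 (Set.Icc 0 (Real.sqrt α)⁻¹)) :=
        tendsto_id.prodMk (tendsto_principal.mpr (Eventually.of_forall fun _ =>
          ⟨by positivity, le_rfl⟩))
      refine (h3.comp h4).congr fun q => ?_
      simp only [hΦ, Function.comp_apply]
      rw [h _ _ (constantCoeff_expSeries _) (constantCoeff_expSeries _)]
      exact (mul_mem_slitPlane_and_arg hc).2.symm)
  refine ⟨Λ, h1, fun δ => ?_⟩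
  have := h2 δ
  simp only [gdnlsPlus_zero hα, gdnlsMinus_zero hα]
  exact this

/-- A common positive factor c of f_N and g_N contributes c^(γ-1) · c · c^(-γ) = 1 and only shifts
the logarithm by the real number log c. -/
theorem gdnlsRogue_eq {N : ℕ} {γ α : ℝ} {a : ℕ → ℂ} {Φ B Λ : ℝ × ℝ → ℂ} {c : ℝ} (hc : 0 < c)
    (hF : ∀ q, gdnlsF N α a q = c * Φ q) (hG : ∀ q, gdnlsG N α a q = c * B q)
    (hΛ : IsLogBranch Φ Λ) (x t : ℝ) :
    gdnlsRogue N γ α a x t =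
      Complex.exp (Complex.I * (1 - γ - α) * x
        - 1 / 2 * Complex.I * (α ^ 2 + 2 * (γ - 2) * α + 1 - γ) * t) *
      (Complex.exp ((γ - 1) * (starRingEnd ℂ) (Λ (x, t))) * B (x, t) *
        Complex.exp (-γ * Λ (x, t))) := by
  have hL : logBranch (gdnlsF N α a) = fun q => Λ q + (Real.log c : ℂ) := by
    have : gdnlsF N α a = fun q => c * Φ q := funext hF
    rw [this]
    exact (hΛ.const_mul hc).logBranch_eq
  rw [gdnlsRogue, hL, hG]
  congr 1
  simp only [map_add, Complex.conj_ofReal]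
  have hexp : Complex.exp (Real.log c : ℂ) = c := by
    rw [← Complex.ofReal_exp, Real.exp_log hc]
  rw [div_eq_mul_inv, ← Complex.exp_neg]
  have h1 : Complex.exp ((γ - 1) * ((starRingEnd ℂ) (Λ (x, t)) + (Real.log c : ℂ))) =
      Complex.exp ((γ - 1) * (starRingEnd ℂ) (Λ (x, t))) *
        Complex.exp (γ * (Real.log c : ℂ)) * (Complex.exp (Real.log c : ℂ))⁻¹ := by
    rw [← Complex.exp_neg, ← Complex.exp_add, ← Complex.exp_add]; congr 1; ring
  have h2 : Complex.exp (-(γ * (Λ (x, t) + (Real.log c : ℂ)))) =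
      Complex.exp (-γ * Λ (x, t)) * (Complex.exp (γ * (Real.log c : ℂ)))⁻¹ := by
    rw [← Complex.exp_neg, ← Complex.exp_add]; congr 1; ring
  rw [h1, h2, hexp]
  have hc' : (c : ℂ) ≠ 0 := by exact_mod_cast hc.ne'
  have he := Complex.exp_ne_zero (γ * (Real.log c : ℂ))
  field_simp

theorem continuous_gdnlsPlus (α : ℝ) (a : ℕ → ℂ) (n k : ℤ) (i : ℕ) :
    Continuous fun q : ℝ × ℝ => gdnlsPlus α a n k q.1 q.2 i := by
  unfold gdnlsPlus
  split_ifs <;> fun_prop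

theorem continuous_gdnlsMinus (α : ℝ) (a : ℕ → ℂ) (n k : ℤ) (i : ℕ) :
    Continuous fun q : ℝ × ℝ => gdnlsMinus α a n k q.1 q.2 i := by
  unfold gdnlsMinus
  split_ifs <;> fun_prop

theorem continuous_nlsPlus (a : ℕ → ℂ) (n : ℤ) (i : ℕ) :
    Continuous fun q : ℝ × ℝ => nlsPlus a n q.1 q.2 i := by
  unfold nlsPlus
  split_ifs <;> fun_prop

theorem continuous_nlsMinus (a : ℕ → ℂ) (n : ℤ) (i : ℕ) :
    Continuous fun q : ℝ × ℝ => nlsMinus a n q.1 q.2 i := by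
  have h := Complex.continuous_conj.comp (continuous_nlsPlus a n i)
  unfold nlsMinus
  split_ifs
  · fun_prop
  · exact h

theorem nlsSigma_ne_zero (N : ℕ) (a : ℕ → ℂ) (x t : ℝ) : nlsSigma N a 0 x t ≠ 0 := by
  have h : expSeries (nlsMinus a 0 x t) =
      PowerSeries.map (starRingEnd ℂ) (expSeries (nlsPlus a 0 x t)) := by
    rw [map_expSeries]
    congr 1
    ext i
    unfold nlsMinus
    split_ifs with hi
    · subst hi; simp [nlsPlus, sub_eq_add_neg]
    · rfl
  rw [nlsSigma, rogueDet_eq, h]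
  exact gramDet_conj_ne_zero N (by simp)

/-- The matrices `E δ` describe, for `δ = A⁻¹`, the Gram determinants of order `N` with internal
parameters `κ_j A ^ (2 j + 1)`, and for `δ = 0` those of order `N₀` without internal parameters. -/
structure IsDegeneration (N N₀ : ℕ) (κ : ℕ → ℂ) (E : ℝ → Matrix (Fin N) (Fin (2 * N)) ℂ) :
    Prop where
  monomial : ∀ k m, ∃ (c : ℂ) (r : ℕ), ∀ δ : ℝ, E δ k m = c * (δ : ℂ) ^ r
  inv : ∀ A : ℝ, A ≠ 0 → ∃ C : ℝ, 0 < C ∧ ∀ f g : PowerSeries ℂ,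
    gramDet N (expSeries (oddSeq fun j => κ j * (A : ℂ) ^ (2 * j + 1)) * f)
      (PowerSeries.map (starRingEnd ℂ) (expSeries (oddSeq fun j => κ j * (A : ℂ) ^ (2 * j + 1))) *
        g) = C * compDet (E A⁻¹) f g
  zero : ∃ c : ℝ, 0 < c ∧ ∀ f g : PowerSeries ℂ, constantCoeff f = 1 → constantCoeff g = 1 →
    compDet (E 0) f g = c * gramDet N₀ f g

theorem exists_nlsRogue_sub_le {N N₀ : ℕ} {κ : ℕ → ℂ} {E : ℝ → Matrix (Fin N) (Fin (2 * N)) ℂ}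
    (h : IsDegeneration N N₀ κ E) {K : Set (ℝ × ℝ)} (hK : IsCompact K) :
    ∃ C A₀ : ℝ, 0 < A₀ ∧ ∀ A : ℝ, A₀ ≤ A → ∀ q ∈ K,
      ‖nlsRogue N (fun j => κ j * (A : ℂ) ^ (2 * j + 1)) q.1 q.2
        - nlsRogue N₀ (fun _ => 0) q.1 q.2‖ ≤ C / A := by
  obtain ⟨hE, hA, c, hc, hc0⟩ := h
  have hc' : (c : ℂ) ≠ 0 := by exact_mod_cast hc.ne'
  have hε := tendsto_inv_fst K
  let B : ℤ → ℝ → ℝ × ℝ → ℂ := fun n δ q => compDet (E δ)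
    (expSeries (nlsPlus (fun _ => 0) n q.1 q.2)) (expSeries (nlsMinus (fun _ => 0) n q.1 q.2))
  have hB : ∀ n, Approx (atTop ×ˢ 𝓟 K) (fun z : ℝ × ℝ × ℝ => z.1⁻¹)
      (fun z => B n z.1⁻¹ z.2) fun z => B n 0 z.2 := fun n =>
    approx_compDet hE (fun i => continuous_nlsPlus _ n i) (fun i => continuous_nlsMinus _ n i) hK
  have hB0 : ∀ n q, B n 0 q = c * nlsSigma N₀ (fun _ => 0) n q.1 q.2 := fun n q => by
    rw [nlsSigma, rogueDet_eq]
    exact hc0 _ _ (constantCoeff_expSeries _) (constantCoeff_expSeries _)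
  have hB0ne : ∀ q, B 0 0 q ≠ 0 := fun q => by
    rw [hB0]; exact mul_ne_zero hc' (nlsSigma_ne_zero _ _ _ _)
  have hBcont : Continuous fun q => B 0 0 q :=
    continuous_compDet (fun _ _ => continuous_const) (fun i => continuous_nlsPlus _ 0 i)
      (fun i => continuous_nlsMinus _ 0 i)
  have hinv := (hB 0).inv hε (isBigO_one_of_continuous (hBcont.inv₀ hB0ne) hK)
    (Eventually.of_forall fun z => hB0ne z.2)
  have hphase : Approx (atTop ×ˢ 𝓟 K) (fun z : ℝ × ℝ × ℝ => z.1⁻¹)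
      (fun z => Complex.exp (Complex.I * z.2.2)) fun z => Complex.exp (Complex.I * z.2.2) :=
    Approx.refl (isBigO_one_of_continuous
      (h := fun q => Complex.exp (Complex.I * q.2)) (by fun_prop) hK)
  have hall := (((hB 1).mul hε hinv).mul hε hphase).error
  refine exists_bound_of_isBigO (hall.congr' ?_ EventuallyEq.rfl)
  filter_upwards [tendsto_fst.eventually (eventually_ne_atTop (0 : ℝ))] with z hz
  obtain ⟨C, hC, hCA⟩ := hA z.1 hz
  have hσ : ∀ n, nlsSigma N (fun j => κ j * (z.1 : ℂ) ^ (2 * j + 1)) n z.2.1 z.2.2 =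
      C * B n z.1⁻¹ z.2 := by
    intro n
    rw [nlsSigma, rogueDet_eq, expSeries_nlsPlus, expSeries_nlsMinus]
    exact hCA _ _
  have hC' : (C : ℂ) ≠ 0 := by exact_mod_cast hC.ne'
  rw [nlsRogue, nlsRogue, hσ, hσ, mul_div_mul_left _ _ hC', hB0, hB0, ← div_eq_mul_inv,
    ← div_eq_mul_inv, mul_div_mul_left _ _ hc']

theorem exists_gdnlsRogue_sub_le {N N₀ : ℕ} {κ : ℕ → ℂ} {E : ℝ → Matrix (Fin N) (Fin (2 * N)) ℂ}
    (h : IsDegeneration N N₀ κ E) (γ : ℝ) {α : ℝ} (hα : 0 < α) {K : Set (ℝ × ℝ)}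
    (hK : IsCompact K) :
    ∃ C A₀ : ℝ, 0 < A₀ ∧ ∀ A : ℝ, A₀ ≤ A → ∀ q ∈ K,
      ‖gdnlsRogue N γ α (fun j => κ j * (A : ℂ) ^ (2 * j + 1)) q.1 q.2
        - gdnlsRogue N₀ γ α (fun _ => 0) q.1 q.2‖ ≤ C / A := by
  obtain ⟨hE, hA, c, hc, hc0⟩ := h
  have hc' : (c : ℂ) ≠ 0 := by exact_mod_cast hc.ne'
  have hε := tendsto_inv_fst K
  -- Every compressed determinant is a positive multiple of a genuine Gram determinant, of order N
  -- for δ ≠ 0 and of order N₀ for δ = 0. Nonvanishing and the asymptotics thus hold along the whole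
  -- family, including the limit.
  have hdet : ∀ δ : ℝ, ∃ c : ℝ, 0 < c ∧ ∃ (M : ℕ) (a : ℕ → ℂ), ∀ f g : PowerSeries ℂ,
      constantCoeff f = 1 → constantCoeff g = 1 → compDet (E δ) f g = c *
        gramDet M (expSeries (oddSeq a) * f)
          (PowerSeries.map (starRingEnd ℂ) (expSeries (oddSeq a)) * g) := by
    intro δ
    by_cases hδ : δ = 0
    · subst hδ
      refine ⟨c, hc, N₀, fun _ => 0, fun f g hf hg => ?_⟩
      have h1 : expSeries (oddSeq fun _ => 0) = 1 := by
        rw [← expSeries_zero]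
        refine expSeries_congr fun i _ => ?_
        simp [oddSeq]
      rw [hc0 f g hf hg, h1, one_mul, map_one, one_mul]
    · obtain ⟨C, hC, hCA⟩ := hA δ⁻¹ (inv_ne_zero hδ)
      refine ⟨C⁻¹, inv_pos.mpr hC, N, fun j => κ j * (δ⁻¹ : ℝ) ^ (2 * j + 1), fun f g _ _ => ?_⟩
      have hC' : (C : ℂ) ≠ 0 := by exact_mod_cast hC.ne'
      rw [hCA f g, inv_inv, Complex.ofReal_inv, inv_mul_cancel_left₀ hC']
  obtain ⟨Λ, hΛc, hΛ⟩ := exists_isLogBranch_compDet hE hdet hα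
  let B : ℤ → ℤ → ℝ → ℝ × ℝ → ℂ := fun n k δ q => compDet (E δ)
    (expSeries (gdnlsPlus α (fun _ => 0) n k q.1 q.2))
    (expSeries (gdnlsMinus α (fun _ => 0) n k q.1 q.2))
  have hB : ∀ n k, Approx (atTop ×ˢ 𝓟 K) (fun z : ℝ × ℝ × ℝ => z.1⁻¹)
      (fun z => B n k z.1⁻¹ z.2) fun z => B n k 0 z.2 := fun n k =>
    approx_compDet hE (fun i => continuous_gdnlsPlus _ _ n k i)
      (fun i => continuous_gdnlsMinus _ _ n k i) hK
  have hB0 : ∀ n k q, gdnlsSigma N₀ α (fun _ => 0) n k q.1 q.2 = (c⁻¹ : ℝ) * B n k 0 q := by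
    intro n k q
    rw [gdnlsSigma, rogueDet_eq, Complex.ofReal_inv, eq_inv_mul_iff_mul_eq₀ hc']
    exact (hc0 _ _ (constantCoeff_expSeries _) (constantCoeff_expSeries _)).symm
  have hΛapp : Approx (atTop ×ˢ 𝓟 K) (fun z : ℝ × ℝ × ℝ => z.1⁻¹)
      (fun z => Λ z.1⁻¹ z.2) fun z => Λ 0 z.2 := by
    -- Continuity of the family only gives uniform convergence of the logarithms; the rate A⁻¹ is
    -- inherited from the determinants themselves.
    refine Approx.of_exp (isBigO_one_of_continuous (hΛ 0).1 hK)
      (tendsto_sub_of_continuous hΛc hK) ((hB 0 0).error.congr_left fun z => ?_)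
    rw [(hΛ z.1⁻¹).2.1, (hΛ 0).2.1]
  have hphase : Approx (atTop ×ˢ 𝓟 K) (fun z : ℝ × ℝ × ℝ => z.1⁻¹)
      (fun z => Complex.exp (Complex.I * (1 - γ - α) * z.2.1
        - 1 / 2 * Complex.I * (α ^ 2 + 2 * (γ - 2) * α + 1 - γ) * z.2.2))
      fun z => Complex.exp (Complex.I * (1 - γ - α) * z.2.1
        - 1 / 2 * Complex.I * (α ^ 2 + 2 * (γ - 2) * α + 1 - γ) * z.2.2) :=
    Approx.refl (isBigO_one_of_continuous (h := fun q => Complex.exp (Complex.I * (1 - γ - α) * q.1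
        - 1 / 2 * Complex.I * (α ^ 2 + 2 * (γ - 2) * α + 1 - γ) * q.2)) (by fun_prop) hK)
  have hall := (hphase.mul hε ((((hΛapp.conj.const_mul (γ - 1)).exp hε).mul hε (hB (-1) 1)).mul hε
    ((hΛapp.const_mul (-γ)).exp hε))).error
  refine exists_bound_of_isBigO (hall.congr' ?_ EventuallyEq.rfl)
  filter_upwards [tendsto_fst.eventually (eventually_ne_atTop (0 : ℝ))] with z hz
  obtain ⟨C, hC, hCA⟩ := hA z.1 hz
  have hσ : ∀ n k q, gdnlsSigma N α (fun j => κ j * (z.1 : ℂ) ^ (2 * j + 1)) n k q.1 q.2 =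
      C * B n k z.1⁻¹ q := by
    intro n k q
    rw [gdnlsSigma, rogueDet_eq, expSeries_gdnlsPlus, expSeries_gdnlsMinus]
    exact hCA _ _
  rw [gdnlsRogue_eq hC (hσ 0 0) (hσ (-1) 1) (hΛ z.1⁻¹),
    gdnlsRogue_eq (inv_pos.mpr hc) (hB0 0 0) (hB0 (-1) 1) (hΛ 0)]

end

end RogueWave

end

theorem theorem4 (N N₀ : ℕ) (κ : ℕ → ℂ)
    (hκ : ∃ j ∈ Finset.Icc 1 (N - 1), κ j ≠ 0)
    (hN₀ : 1 ≤ N₀)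
    (hroot : (RogueWave.adlerMoser N κ).rootMultiplicity 0 = N₀ * (N₀ + 1) / 2) :
    N₀ < N ∧
    (∀ R : ℝ, 0 < R → ∃ C A₀ : ℝ, 0 < A₀ ∧ ∀ A : ℝ, A₀ ≤ A → ∀ x t : ℝ, x ^ 2 + t ^ 2 ≤ R →
      ‖RogueWave.nlsRogue N (fun j => κ j * (A : ℂ) ^ (2 * j + 1)) x t
        - RogueWave.nlsRogue N₀ (fun _ => 0) x t‖ ≤ C / A) ∧
    (∀ γ α : ℝ, 0 < α →
      ∀ R : ℝ, 0 < R → ∃ C A₀ : ℝ, 0 < A₀ ∧ ∀ A : ℝ, A₀ ≤ A → ∀ x t : ℝ, x ^ 2 + t ^ 2 ≤ R →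
        ‖RogueWave.gdnlsRogue N γ α (fun j => κ j * (A : ℂ) ^ (2 * j + 1)) x t
          - RogueWave.gdnlsRogue N₀ γ α (fun _ => 0) x t‖ ≤ C / A) := by
  obtain ⟨hlt, E, hE, hA, h0⟩ := RogueWave.exists_degeneration N N₀ κ hκ hN₀ hroot
  have hdeg : RogueWave.IsDegeneration N N₀ κ E := ⟨hE, hA, h0⟩
  refine ⟨hlt, fun R _ => ?_, fun γ α hα R _ => ?_⟩
  · obtain ⟨C, A₀, hA₀, h⟩ :=
      RogueWave.exists_nlsRogue_sub_le hdeg (RogueWave.isCompact_setOf_sq_add_sq_le R)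
    exact ⟨C, A₀, hA₀, fun A hA x t hxt => h A hA (x, t) hxt⟩
  · obtain ⟨C, A₀, hA₀, h⟩ :=
      RogueWave.exists_gdnlsRogue_sub_le hdeg γ hα (RogueWave.isCompact_setOf_sq_add_sq_le R)
    exact ⟨C, A₀, hA₀, fun A hA x t hxt => h A hA (x, t) hxt⟩
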